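/- Let $\Bbbk$ be an algebraically closed field and $A$ a basic, connected, non-simple finite dimensional $\Bbbk$-algebra with a primitive decomposition $1=e_1+\dots+e_n$ of the identity. Let $\mathcal C$ be a small $\Bbbk$-linear category with a $\Bbbk$-linear equivalence to the category $A\text{-mod}$ of finite dimensional left $A$-modules, and let $\mathscr C_A$ be the finitary $2$-category with one object whose $1$-morphisms are the projective functors on $\mathcal C$, i.e. the endofunctors isomorphic to finite direct sums of copies of the identity functor and of the functors $\mathrm F_{st}=(Ae_s\otimes_{\Bbbk}e_tA)\otimes_A-$, with $1\le s,t\le n$, and whose $2$-morphisms are all natural transformations. The left preorder on isomorphism classes of indecomposable $1$-morphisms is: $\mathrm F\le_L\mathrm G$ if $\mathrm G$ is a direct summand of $\mathrm H\circ\mathrm F$ for some $1$-morphism $\mathrm H$; its equivalence classes are the left cells. Let $\mathcal L_0$ be the left cell of the identity and $\mathcal L_j$, for $1\le j\le n$, the left cell containing the $\mathrm F_{sj}$, $1\le s\le n$. For a left cell $\mathcal L$, the cell $2$-representation $\mathbf C_{\mathcal L}$ is the quotient of the subrepresentation of the principal $2$-representation ($\mathscr C_A$ acting on its category of $1$-morphisms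 by composition from the left) on the direct sums of all indecomposable $\mathrm G\ge_L\mathcal L$, by its largest $\mathscr C_A$-invariant ideal that contains no $\mathrm{id}_{\mathrm F}$ with $\mathrm F\in\mathcal L$. Let $\mathbf M$ be a finitary $2$-representation (a strict $\Bbbk$-linear $2$-functor to finitary $\Bbbk$-linear categories, additive $\Bbbk$-linear functors and natural transformations). Write $X\to Y$, for indecomposable objects $X,Y$, if $Y$ is a direct summand of $\mathrm F\,X$ for some $1$-morphism $\mathrm F$; $\mathbf M$ is transitive if $X\to Y$ for all $X,Y$. The diagram of $\mathbf M$ is the Hasse diagram of the set of equivalence classes of this preorder. For transitive $2$-representations $\mathbf N',\mathbf K'$, the set $\mathrm{Dext}(\mathbf N',\mathbf K')$ of discrete extensions consists of all non-empty sets $\Theta$ of isomorphism classes of indecomposable $1$-morphisms for which there are a finitary $2$-representation $\mathbf M$ whose diagram has exactly two vertices $\rho,\tau$, connected by an edge with $\rho\to\tau$, and a transitive $2$-subrepresentation $\mathbf K$ of $\mathbf M$ whose indecomposable objects are those of $\tau$, such that $\mathbf K$ is equivalent to $\mathbf K'$, the quotient $\mathbf N$ of $\mathbf M$ by the ideal generated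 by the identity morphisms of the objects of $\mathbf K$ is equivalent to $\mathbf N'$, and $\Theta$ is the set of all classes of indecomposable $1$-morphisms $\mathrm F$ such that $\mathrm F\,X$ has a direct summand in $\tau$ for some $X\in\rho$. For $S\subseteq\{1,\dots,n\}$ put $E_S=\bigcup_{j\in S}\mathcal L_j$. For $M\in\mathcal C$ let $S(M)$ be the set of those $i$ for which the simple top $L_i$ of $Ae_i$ is a composition factor of $M$, and let $\underline{\mathcal C}$ be the stable category of $\mathcal C$ (morphisms modulo those factoring through projective objects). Then: 1. $\mathrm{Dext}(\mathbf C_{\mathcal L_0},\mathbf C_{\mathcal L_0})=\varnothing$. 2. $\mathrm{Dext}(\mathbf C_{\mathcal L_i},\mathbf C_{\mathcal L_i})=\varnothing$ for every $i\in\{1,\dots,n\}$ (in particular for $i=1$). 3. If $A$ is self-injective, then $\mathrm{Dext}(\mathbf C_{\mathcal L_i},\mathbf C_{\mathcal L_0})=\varnothing$ for every $i\in\{1,\dots,n\}$. 4. For every $i\in\{1,\dots,n\}$, every element of $\mathrm{Dext}(\mathbf C_{\mathcal L_0},\mathbf C_{\mathcal L_i})$ is of the form $E_S$ for some non-empty $S\subseteq\{1,\dots,n\}$;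 moreover, $E_{S(M)}\in\mathrm{Dext}(\mathbf C_{\mathcal L_0},\mathbf C_{\mathcal L_i})$ for every indecomposable $M\in\mathcal C$ with $\mathrm{End}_{\underline{\mathcal C}}(M)\cong\Bbbk$. -/

import Mathlib

open CategoryTheory Limits
universe u
set_option linter.unusedSectionVars false
namespace DiscExt


section Objects

variable {𝒳 : Type u} [SmallCategory 𝒳] [Preadditive 𝒳]

/-- `Y` is (isomorphic to) a direct summand of `X`. -/
def IsSummand (Y X : 𝒳) : Prop :=
  ∃ (Z : 𝒳) (b : BinaryBicone Y Z), Nonempty b.IsBilimit ∧ Nonempty (b.pt ≅ X)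

/-- `X` is indecomposable: nonzero, and not a direct sum of two nonzero objects. -/
def IsIndec (X : 𝒳) : Prop :=
  ¬ IsZero X ∧ ∀ (Y Z : 𝒳) (b : BinaryBicone Y Z), Nonempty b.IsBilimit →
    Nonempty (b.pt ≅ X) → IsZero Y ∨ IsZero Z

/-- Isomorphism of indecomposable objects. -/
def indecSetoid (𝒳 : Type u) [SmallCategory 𝒳] [Preadditive 𝒳] :
    Setoid {X : 𝒳 // IsIndec X} where
  r X Y := Nonempty (X.1 ≅ Y.1)
  iseqv := ⟨fun _ => ⟨Iso.refl _⟩, fun ⟨e⟩ => ⟨e.symm⟩, fun ⟨e⟩ ⟨f⟩ => ⟨e.trans f⟩⟩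

/-- The set of isomorphism classes of indecomposable objects. -/
def Ind (𝒳 : Type u) [SmallCategory 𝒳] [Preadditive 𝒳] : Type u :=
  _root_.Quotient (indecSetoid 𝒳)

/-- The isomorphism class of an indecomposable object. -/
def Ind.mk (X : 𝒳) (h : IsIndec X) : Ind 𝒳 := _root_.Quotient.mk (indecSetoid 𝒳) ⟨X, h⟩

variable (k : Type u) [Field k]

/-- Finitary `k`-linear categories. -/
structure IsFinitary (𝒳 : Type u) [SmallCategory 𝒳] [Preadditive 𝒳] [Linear k 𝒳] : Prop where
  additive : HasFiniteBiproducts 𝒳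
  idempotent_split : IsIdempotentComplete 𝒳
  krull_schmidt : ∀ X : 𝒳, ∃ (m : ℕ) (f : Fin m → 𝒳) (b : Bicone f),
    Nonempty b.IsBilimit ∧ Nonempty (b.pt ≅ X) ∧ ∀ i, IsLocalRing (End (f i))
  finite_ind : Finite (Ind 𝒳)
  finite_hom : ∀ X Y : 𝒳, FiniteDimensional k (X ⟶ Y)

/-- Two-sided ideals in a `k`-linear category. -/
@[ext] structure LinIdeal (𝒳 : Type u) [SmallCategory 𝒳] [Preadditive 𝒳] [Linear k 𝒳] where
  hom : ∀ X Y : 𝒳, Submodule k (X ⟶ Y)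
  comp_left : ∀ {X Y Z : 𝒳} (f : X ⟶ Y) {g : Y ⟶ Z}, g ∈ hom Y Z → f ≫ g ∈ hom X Z
  comp_right : ∀ {X Y Z : 𝒳} {f : X ⟶ Y} (g : Y ⟶ Z), f ∈ hom X Y → f ≫ g ∈ hom X Z

namespace LinIdeal

variable {k} [Linear k 𝒳] (I : LinIdeal k 𝒳)

/-- Congruence modulo an ideal. -/
def rel : HomRel 𝒳 := fun X Y f g => f - g ∈ I.hom X Y

instance : Congruence I.rel where
  comp_left f g g' h := by
    have := I.comp_left f h
    rwa [Preadditive.comp_sub] at this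
  comp_right g h := by
    have := I.comp_right g h
    rwa [Preadditive.sub_comp] at this
  equivalence :=
    { refl := fun f => by simp [rel]
      symm := fun {f g} h => by
        have := Submodule.neg_mem _ h
        rwa [neg_sub] at this
      trans := fun {f g h} h₁ h₂ => by
        have := Submodule.add_mem _ h₁ h₂
        rwa [sub_add_sub_cancel] at this }

/-- The quotient of a `k`-linear category by an ideal. -/
abbrev Quot : Type u := CategoryTheory.Quotient I.rel

lemma rel_add ⦃X Y : 𝒳⦄ (f₁ f₂ g₁ g₂ : X ⟶ Y) (h₁ : I.rel f₁ f₂) (h₂ : I.rel g₁ g₂) :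
    I.rel (f₁ + g₁) (f₂ + g₂) := by
  have := Submodule.add_mem _ h₁ h₂
  rwa [sub_add_sub_comm] at this

lemma rel_smul (a : k) ⦃X Y : 𝒳⦄ (f₁ f₂ : X ⟶ Y) (h : I.rel f₁ f₂) :
    I.rel (a • f₁) (a • f₂) := by
  have := Submodule.smul_mem _ a h
  rwa [smul_sub] at this

instance : Preadditive I.Quot := CategoryTheory.Quotient.preadditive I.rel I.rel_add

/-- The projection onto the quotient category. -/
abbrev proj : 𝒳 ⥤ I.Quot := CategoryTheory.Quotient.functor I.rel

instance : I.proj.Additive := CategoryTheory.Quotient.functor_additive I.rel I.rel_add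

instance : Linear k I.Quot := CategoryTheory.Quotient.linear k I.rel I.rel_smul

instance : I.proj.Linear k := CategoryTheory.Quotient.linear_functor k I.rel I.rel_smul

end LinIdeal

end Objects

section TwoCat

variable {C : Type u} [SmallCategory C] [Preadditive C]

/-- The endofunctors in `P` are the `1`-morphisms of a `k`-linear `2`-category with one object,
whose `2`-morphisms are all natural transformations. -/
class IsTwoCat (k : Type u) [Field k] [Linear k C] (P : ObjectProperty (C ⥤ C)) : Prop where
  id_mem : P (𝟭 C)
  comp_mem : ∀ {F G : C ⥤ C}, P F → P G → P (G ⋙ F)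
  additive : ∀ {F : C ⥤ C}, P F → F.Additive
  linear : ∀ {F : C ⥤ C}, P F → F.Linear k

variable (k : Type u) [Field k] [Linear k C] (P : ObjectProperty (C ⥤ C)) [IsTwoCat k P]

/-- The identity `1`-morphism. -/
def oneMor : P.FullSubcategory := ⟨𝟭 C, IsTwoCat.id_mem k⟩

variable {P}

/-- The composition `F ∘ G` of `1`-morphisms. -/
def compMor (F G : P.FullSubcategory) : P.FullSubcategory :=
  ⟨G.obj ⋙ F.obj, IsTwoCat.comp_mem k F.property G.property⟩

/-- Horizontal composition of `2`-morphisms. -/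
def hcompMor {F F' G G' : P.FullSubcategory} (α : F ⟶ F') (β : G ⟶ G') :
    compMor k F G ⟶ compMor k F' G' :=
  ObjectProperty.homMk (β.hom ◫ α.hom)

/-- The left preorder on `1`-morphisms: `F ≤ G` if `G` is a direct summand of some `H ∘ F`. -/
def LeftLE (F G : P.FullSubcategory) : Prop :=
  ∃ H : P.FullSubcategory, IsSummand G (compMor k H F)

/-- The left cell of the indecomposable `1`-morphism `F`. -/
def leftCell (F : P.FullSubcategory) : Set (Ind P.FullSubcategory) :=
  {c | ∃ (G : P.FullSubcategory) (h : IsIndec G), c = Ind.mk G h ∧ LeftLE k F G ∧ LeftLE k G F}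

variable (P)

/-- `2`-representations of the one-object `2`-category given by `P`: strict `k`-linear
`2`-functors to the `2`-category of small `k`-linear categories, additive `k`-linear functors and
natural transformations. -/
structure TwoRep where
  carrier : Type u
  [cat : SmallCategory carrier]
  [preadd : Preadditive carrier]
  [lin : Linear k carrier]
  act : P.FullSubcategory ⥤ (carrier ⥤ carrier)
  act_additive : act.Additive
  act_linear : act.Linear k
  obj_additive : ∀ F, (act.obj F).Additive
  obj_linear : ∀ F, (act.obj F).Linear k
  act_one : act.obj (oneMor k P) = 𝟭 carrier
  act_comp : ∀ F G, act.obj (compMor k F G) = act.obj G ⋙ act.obj F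
  act_hcomp : ∀ {F F' G G' : P.FullSubcategory} (α : F ⟶ F') (β : G ⟶ G'),
    act.map (hcompMor k α β) =
      eqToHom (act_comp F G) ≫ (act.map β ◫ act.map α) ≫ eqToHom (act_comp F' G').symm

attribute [instance] TwoRep.cat TwoRep.preadd TwoRep.lin TwoRep.act_additive TwoRep.act_linear
  TwoRep.obj_additive TwoRep.obj_linear

variable {k P}

namespace TwoRep

variable (M : TwoRep k P)

lemma act_one_obj (X : M.carrier) : (M.act.obj (oneMor k P)).obj X = X := by
  rw [M.act_one]; rfl

lemma act_comp_obj (F G : P.FullSubcategory) (X : M.carrier) :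
    (M.act.obj (compMor k F G)).obj X = (M.act.obj F).obj ((M.act.obj G).obj X) := by
  rw [M.act_comp]; rfl

lemma act_one_map {X Y : M.carrier} (f : X ⟶ Y) : (M.act.obj (oneMor k P)).map f =
    eqToHom (M.act_one_obj X) ≫ f ≫ eqToHom (M.act_one_obj Y).symm := by
  simpa using Functor.congr_hom M.act_one f

lemma act_comp_map (F G : P.FullSubcategory) {X Y : M.carrier} (f : X ⟶ Y) :
    (M.act.obj (compMor k F G)).map f = eqToHom (M.act_comp_obj F G X) ≫
      (M.act.obj F).map ((M.act.obj G).map f) ≫ eqToHom (M.act_comp_obj F G Y).symm := by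
  simpa using Functor.congr_hom (M.act_comp F G) f

lemma act_hcomp_app {F F' G G' : P.FullSubcategory} (α : F ⟶ F') (β : G ⟶ G') (X : M.carrier) :
    (M.act.map (hcompMor k α β)).app X = eqToHom (M.act_comp_obj F G X) ≫
      ((M.act.map α).app ((M.act.obj G).obj X) ≫ (M.act.obj F').map ((M.act.map β).app X)) ≫
      eqToHom (M.act_comp_obj F' G' X).symm := by
  rw [M.act_hcomp]
  simp [eqToHom_app]


/-! ### Equivalences -/

/-- Equivalences of `2`-representations: (strong) `2`-natural transformations whose underlying
functor is a `k`-linear equivalence of categories. -/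
structure Equiv (M N : TwoRep k P) where
  functor : M.carrier ⥤ N.carrier
  additive : functor.Additive
  linear : functor.Linear k
  isEquivalence : functor.IsEquivalence
  η : ∀ F, M.act.obj F ⋙ functor ≅ functor ⋙ N.act.obj F
  naturality : ∀ {F G : P.FullSubcategory} (α : F ⟶ G) (X : M.carrier),
    functor.map ((M.act.map α).app X) ≫ (η G).hom.app X =
      (η F).hom.app X ≫ (N.act.map α).app (functor.obj X)
  η_one : ∀ X : M.carrier, (η (oneMor k P)).hom.app X =
    eqToHom (by simp [act_one_obj])
  η_comp : ∀ (F G : P.FullSubcategory) (X : M.carrier), (η (compMor k F G)).hom.app X =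
    eqToHom (by simp [act_comp_obj]) ≫ (η F).hom.app ((M.act.obj G).obj X) ≫
      (N.act.obj F).map ((η G).hom.app X) ≫ eqToHom (by simp [act_comp_obj])

/-! ### Subrepresentations and quotients -/

/-- The full subcategory `Q` is invariant under the action. -/
def IsInvariant (Q : ObjectProperty M.carrier) : Prop :=
  ∀ (F : P.FullSubcategory) (X : M.carrier), Q X → Q ((M.act.obj F).obj X)

lemma full_functor_ext {𝒳 𝒴 : Type u} [SmallCategory 𝒳] [SmallCategory 𝒴]
    {Q : ObjectProperty 𝒴} {F G : 𝒳 ⥤ Q.FullSubcategory} (h : F ⋙ Q.ι = G ⋙ Q.ι) : F = G := by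
  have h1 : ∀ X, F.obj X = G.obj X := fun X =>
    ObjectProperty.FullSubcategory.ext (Functor.congr_obj h X)
  refine CategoryTheory.Functor.ext h1 (fun X Y f => ?_)
  apply Q.ι.map_injective
  have h2 := Functor.congr_hom h f
  simpa [eqToHom_map] using h2

/-- The restriction of the action to an invariant full subcategory. -/
def sub (Q : ObjectProperty M.carrier) (hQ : M.IsInvariant Q) : TwoRep k P where
  carrier := Q.FullSubcategory
  act :=
    { obj := fun F => Q.lift (Q.ι ⋙ M.act.obj F) (fun X => hQ F _ X.property)
      map := fun α =>
        { app := fun X => ObjectProperty.homMk ((M.act.map α).app X.obj)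
          naturality := fun X Y f => by
            ext
            simp } }
  act_additive := ⟨by intros; ext; simp; rfl⟩
  act_linear := ⟨by intros; ext; simp; rfl⟩
  obj_additive F := ⟨by intros; ext; exact (M.act.obj F).map_add⟩
  obj_linear F := ⟨by intros; ext; exact (M.act.obj F).map_smul _ _⟩
  act_one := full_functor_ext (by
    change Q.ι ⋙ M.act.obj _ = _
    rw [M.act_one]; rfl)
  act_comp F G := full_functor_ext (by
    change Q.ι ⋙ M.act.obj _ = _
    rw [M.act_comp]; rfl)
  act_hcomp α β := by
    ext X
    simp [eqToHom_app, M.act_hcomp_app]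

/-- Two-sided ideals which are invariant under the action. -/
structure InvIdeal extends LinIdeal k M.carrier where
  map_mem : ∀ (F : P.FullSubcategory) {X Y : M.carrier} {f : X ⟶ Y}, f ∈ hom X Y →
    (M.act.obj F).map f ∈ hom ((M.act.obj F).obj X) ((M.act.obj F).obj Y)

variable {M}

/-- The intersection of a set of invariant ideals. -/
def InvIdeal.inter (S : Set M.InvIdeal) : M.InvIdeal where
  hom X Y := ⨅ I ∈ S, I.hom X Y
  comp_left := by
    intro X Y Z f g hg
    simp only [Submodule.mem_iInf] at hg ⊢
    exact fun I hI => I.comp_left f (hg I hI)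
  comp_right := by
    intro X Y Z f g hf
    simp only [Submodule.mem_iInf] at hf ⊢
    exact fun I hI => I.comp_right g (hf I hI)
  map_mem := by
    intro F X Y f hf
    simp only [Submodule.mem_iInf] at hf ⊢
    exact fun I hI => I.map_mem F (hf I hI)

/-- The sum of a set of invariant ideals: the smallest invariant ideal containing all of them. -/
def InvIdeal.sum (S : Set M.InvIdeal) : M.InvIdeal :=
  InvIdeal.inter {J | ∀ I ∈ S, ∀ X Y : M.carrier, I.hom X Y ≤ J.hom X Y}

/-- The invariant ideal generated by the identity morphisms of the objects in `Q`. -/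
def InvIdeal.gen (Q : ObjectProperty M.carrier) : M.InvIdeal :=
  InvIdeal.inter {J | ∀ X : M.carrier, Q X → 𝟙 X ∈ J.hom X X}

lemma proj_map_eq (I : M.InvIdeal) (F : P.FullSubcategory) {X Y : M.carrier} {f g : X ⟶ Y}
    (h : I.rel f g) : (M.act.obj F ⋙ I.proj).map f = (M.act.obj F ⋙ I.proj).map g := by
  apply CategoryTheory.Quotient.sound
  have h' : f - g ∈ I.hom X Y := h
  have := I.map_mem F h'
  rw [Functor.map_sub] at this
  exact this

variable (M)

/-- The action on the quotient by an invariant ideal. -/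
def quotAct (I : M.InvIdeal) (F : P.FullSubcategory) : I.Quot ⥤ I.Quot :=
  CategoryTheory.Quotient.lift I.rel (M.act.obj F ⋙ I.proj) (fun _ _ _ _ h => proj_map_eq I F h)

/-- The action of `2`-morphisms on the quotient by an invariant ideal. -/
def quotMap (I : M.InvIdeal) {F G : P.FullSubcategory} (α : F ⟶ G) :
    M.quotAct I F ⟶ M.quotAct I G :=
  CategoryTheory.Quotient.natTransLift I.rel (Functor.whiskerRight (M.act.map α) I.proj)

lemma quotMap_app (I : M.InvIdeal) {F G : P.FullSubcategory} (α : F ⟶ G) (X : M.carrier) :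
    (M.quotMap I α).app (I.proj.obj X) = I.proj.map ((M.act.map α).app X) := rfl

lemma quotAct_obj (I : M.InvIdeal) (F : P.FullSubcategory) (X : M.carrier) :
    (M.quotAct I F).obj (I.proj.obj X) = I.proj.obj ((M.act.obj F).obj X) := rfl

lemma quotAct_map (I : M.InvIdeal) (F : P.FullSubcategory) {X Y : M.carrier} (f : X ⟶ Y) :
    (M.quotAct I F).map (I.proj.map f) = I.proj.map ((M.act.obj F).map f) := rfl

lemma quot_ext (I : M.InvIdeal) {F G : I.Quot ⥤ I.Quot} {α β : F ⟶ G}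
    (h : ∀ X : M.carrier, α.app (I.proj.obj X) = β.app (I.proj.obj X)) : α = β :=
  NatTrans.ext (funext fun ⟨X⟩ => h X)

/-- The quotient of a `2`-representation by an invariant ideal. -/
def quot (I : M.InvIdeal) : TwoRep k P where
  carrier := I.Quot
  act :=
    { obj := M.quotAct I
      map := fun α => M.quotMap I α
      map_id := fun F => M.quot_ext I fun X => by
        rw [quotMap_app, M.act.map_id]; rfl
      map_comp := fun α β => M.quot_ext I fun X => by
        rw [quotMap_app, M.act.map_comp]; rfl }
  act_additive := ⟨fun {F G} {α β} => M.quot_ext I fun X => by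
    change (M.quotMap I (α + β)).app _ = _
    rw [quotMap_app, M.act.map_add]; rfl⟩
  act_linear := ⟨fun {F G} α r => M.quot_ext I fun X => by
    change (M.quotMap I (r • α)).app _ = _
    rw [quotMap_app, M.act.map_smul]; rfl⟩
  obj_additive F := ⟨by
    rintro ⟨X⟩ ⟨Y⟩ ⟨f⟩ ⟨g⟩
    exact ((M.act.obj F) ⋙ I.proj).map_add (f := f) (g := g)⟩
  obj_linear F := ⟨by
    rintro ⟨X⟩ ⟨Y⟩ ⟨f⟩ a
    exact ((M.act.obj F) ⋙ I.proj).map_smul a f⟩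
  act_one := by
    apply CategoryTheory.Quotient.lift_unique'
    change M.act.obj _ ⋙ I.proj = _
    rw [M.act_one]; rfl
  act_comp F G := by
    apply CategoryTheory.Quotient.lift_unique'
    change M.act.obj _ ⋙ I.proj = _
    rw [M.act_comp]; rfl
  act_hcomp {F F' G G'} α β := M.quot_ext I fun X => by
    rw [NatTrans.comp_app, NatTrans.comp_app, eqToHom_app, eqToHom_app]
    have key := congrArg I.proj.map (M.act_hcomp_app α β X)
    rw [Functor.map_comp, Functor.map_comp, Functor.map_comp, eqToHom_map, eqToHom_map] at key
    exact key

end TwoRep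

variable (k P)

/-- Composition with `F` from the left, as an endofunctor of the category of `1`-morphisms. -/
def leftMul (F : P.FullSubcategory) : P.FullSubcategory ⥤ P.FullSubcategory where
  obj G := compMor k F G
  map β := ObjectProperty.homMk (Functor.whiskerRight β.hom F.obj)
  map_id G := by ext; simp [compMor]
  map_comp β γ := by ext; simp [compMor]

/-- The natural transformation between left compositions given by a `2`-morphism. -/
def leftMulMap {F G : P.FullSubcategory} (α : F ⟶ G) : leftMul k P F ⟶ leftMul k P G where
  app H := ObjectProperty.homMk (Functor.whiskerLeft H.obj α.hom)
  naturality H H' β := by ext; simp [leftMul, compMor]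

lemma leftMul_comp (F G : P.FullSubcategory) :
    leftMul k P (compMor k F G) = leftMul k P G ⋙ leftMul k P F := rfl

lemma leftMulMap_hcomp {F F' G G' : P.FullSubcategory} (α : F ⟶ F') (β : G ⟶ G') :
    leftMulMap k P (hcompMor k α β) = leftMulMap k P β ◫ leftMulMap k P α := by
  ext
  rfl

/-- The principal `2`-representation: `1`-morphisms act by composition from the left. -/
def principal : TwoRep k P where
  carrier := P.FullSubcategory
  act :=
    { obj := leftMul k P
      map := fun α => leftMulMap k P α
      map_id := fun F => by ext; rfl
      map_comp := fun α β => by ext; rfl }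
  act_additive := ⟨by intros; ext; rfl⟩
  act_linear := ⟨by intros; ext; rfl⟩
  obj_additive F := ⟨by
    have := IsTwoCat.additive k F.property
    intros; ext; exact F.obj.map_add⟩
  obj_linear F := ⟨by
    have := IsTwoCat.linear (k := k) F.property
    intros; ext; exact F.obj.map_smul _ _⟩
  act_one := rfl
  act_comp F G := rfl
  act_hcomp α β := by
    exact ((leftMulMap_hcomp k P α β).trans (Category.comp_id _).symm).trans
      (Category.id_comp _).symm

variable {k P}

/-! ### Cell `2`-representations -/

lemma leftLE_invariant (F : P.FullSubcategory) :
    (principal k P).IsInvariant (fun G : P.FullSubcategory => LeftLE k F G) := by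
  rintro K G ⟨H, Z, b, ⟨hb⟩, ⟨e⟩⟩
  have : (leftMul k P K).Additive := (principal k P).obj_additive K
  have := preservesBinaryBiproduct_of_preservesBiproduct (leftMul k P K) G Z
  exact ⟨compMor k K H, _, (leftMul k P K).mapBinaryBicone b,
    ⟨isBinaryBilimitOfPreserves (leftMul k P K) hb⟩, ⟨(leftMul k P K).mapIso e⟩⟩

/-- The subrepresentation of the principal `2`-representation on the `1`-morphisms which are
direct summands of some `H ∘ F`, that is, on the direct sums of indecomposable `1`-morphisms `G`
with `F ≤ G` in the left preorder. -/
def leftIdealRep (F : P.FullSubcategory) : TwoRep k P :=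
  (principal k P).sub _ (leftLE_invariant F)

/-- The largest invariant ideal which contains no identity morphism of a `1`-morphism in the left
cell of `F`: the sum of all invariant ideals with this property. -/
def cellIdeal (F : P.FullSubcategory) : (leftIdealRep (k := k) F).InvIdeal :=
  TwoRep.InvIdeal.sum {I | ∀ (G : P.FullSubcategory) (hG : LeftLE k F G), IsIndec G →
    LeftLE k G F → 𝟙 _ ∉ I.hom ⟨G, hG⟩ ⟨G, hG⟩}

/-- The cell `2`-representation of the left cell of `F`. -/
def cellRep (F : P.FullSubcategory) : TwoRep k P :=
  (leftIdealRep F).quot (cellIdeal F)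

/-! ### Diagrams and discrete extensions -/

namespace TwoRep

variable (M : TwoRep k P)

/-- The action preorder on isomorphism classes of indecomposable objects. -/
def Reaches (x y : Ind M.carrier) : Prop :=
  ∃ (X : M.carrier) (hX : IsIndec X) (Y : M.carrier) (hY : IsIndec Y),
    x = Ind.mk X hX ∧ y = Ind.mk Y hY ∧
      ∃ F : P.FullSubcategory, IsSummand Y ((M.act.obj F).obj X)

/-- `M` is transitive if the action preorder is the full relation. -/
def IsTransitive : Prop := ∀ x y : Ind M.carrier, M.Reaches x y

/-- The vertices of the diagram of `M`: the equivalence classes for the action preorder. -/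
def vertices : Set (Set (Ind M.carrier)) :=
  {ρ | ∃ x, ρ = {y | M.Reaches x y ∧ M.Reaches y x}}

/-- The order on vertices induced by the action preorder. -/
def VertexReaches (ρ σ : Set (Ind M.carrier)) : Prop := ∃ x ∈ ρ, ∃ y ∈ σ, M.Reaches x y

/-- There is an edge from `ρ` down to `τ` in the diagram (Hasse diagram) of `M`. -/
def IsEdge (ρ τ : Set (Ind M.carrier)) : Prop :=
  ρ ∈ M.vertices ∧ τ ∈ M.vertices ∧ ρ ≠ τ ∧ M.VertexReaches ρ τ ∧
    ∀ σ ∈ M.vertices, M.VertexReaches ρ σ → M.VertexReaches σ τ → σ = ρ ∨ σ = τ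

/-- The classes of indecomposable `1`-morphisms `F` for which some `F X`, with `X` in `ρ`, has a
direct summand in `τ`. -/
def decoration (τ ρ : Set (Ind M.carrier)) : Set (Ind P.FullSubcategory) :=
  {c | ∃ (F : P.FullSubcategory) (hF : IsIndec F) (X : M.carrier) (hX : IsIndec X)
    (Y : M.carrier) (hY : IsIndec Y), c = Ind.mk F hF ∧ Ind.mk X hX ∈ ρ ∧ Ind.mk Y hY ∈ τ ∧
      IsSummand Y ((M.act.obj F).obj X)}

/-- `Q` is (the class of objects of) a finitary `2`-subrepresentation of `M`. -/
structure IsSubrep (Q : ObjectProperty M.carrier) : Prop where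
  invariant : M.IsInvariant Q
  zero : ∀ X, IsZero X → Q X
  summand : ∀ X Y, IsSummand Y X → Q X → Q Y
  sum : ∀ (X Y : M.carrier) (b : BinaryBicone X Y), Nonempty b.IsBilimit → Q X → Q Y → Q b.pt

/-- The classes of indecomposable objects in `Q`. -/
def indIn (Q : ObjectProperty M.carrier) : Set (Ind M.carrier) :=
  {c | ∃ (X : M.carrier) (hX : IsIndec X), c = Ind.mk X hX ∧ Q X}

/-- `Θ` represents the discrete extension corresponding to the short exact sequence
`0 → K → M → N → 0` whose subobject `K` is given by `Q`. The diagram of `M` has exactly two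
vertices, `ρ` corresponding to `N` and `τ` corresponding to `K`; `Θ` is the decoration of the edge
between them if there is one, and is empty otherwise. -/
def Represents (Q : ObjectProperty M.carrier) (Θ : Set (Ind P.FullSubcategory)) : Prop :=
  ∃ ρ τ : Set (Ind M.carrier), τ = M.indIn Q ∧ ρ = (M.indIn Q)ᶜ ∧ ρ ≠ τ ∧
    M.vertices = {ρ, τ} ∧ Θ = {c | M.IsEdge ρ τ ∧ c ∈ M.decoration τ ρ}

end TwoRep

/-- The set of (nonempty) discrete extensions of `N'` by `K'`. -/
def Dext (N' K' : TwoRep k P) : Set (Set (Ind P.FullSubcategory)) :=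
  {Θ | Θ.Nonempty ∧ ∃ (M : TwoRep k P) (Q : ObjectProperty M.carrier) (hQ : M.IsSubrep Q),
    IsFinitary k M.carrier ∧ (M.sub Q hQ.invariant).IsTransitive ∧ M.Represents Q Θ ∧
    Nonempty ((M.sub Q hQ.invariant).Equiv K') ∧
    Nonempty ((M.quot (TwoRep.InvIdeal.gen Q)).Equiv N')}

end TwoCat

/-! ### Projective functors -/



section Alg

open ModuleCat
variable (k : Type u) [Field k] {A : Type u} [Ring A] [Algebra k A]

/-- The subspace `eX` of an `A`-module `X`. -/
def idemPart (e : A) (X : ModuleCat.{u} A) : Submodule k X :=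
  LinearMap.range (Algebra.lsmul k k X e)

/-- The restriction `eX → eY` of a homomorphism `X → Y`. -/
def idemMap (e : A) {X Y : ModuleCat.{u} A} (f : X ⟶ Y) :
    idemPart k e X →ₗ[k] idemPart k e Y :=
  (f.hom.restrictScalars k).restrict (by
    rintro _ ⟨x, rfl⟩
    exact ⟨f.hom x, by simp [Algebra.lsmul]⟩)

lemma idemMap_coe (e : A) {X Y : ModuleCat.{u} A} (f : X ⟶ Y) (x : idemPart k e X) :
    (idemMap k e f x : Y) = f.hom x := rfl

open TensorProduct

/-- The left `A`-module `Ae ⊗ fX`. -/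
abbrev tensMod (e f : A) (X : ModuleCat.{u} A) : Type u :=
  ↥(Ideal.span {e}) ⊗[k] ↥(idemPart k f X)

variable [Module.Finite k A]

instance (X : FGModuleCat.{u} A) : Module.Finite k X.obj := Module.Finite.trans A _

instance (e f : A) (X : FGModuleCat.{u} A) : Module.Finite A (tensMod k e f X.obj) :=
  Module.Finite.of_restrictScalars_finite k A _

/-- The functor `X ↦ Ae ⊗ fX = (Ae ⊗ fA) ⊗_A X` on finitely generated `A`-modules. -/
noncomputable def tensFunctor (e f : A) : FGModuleCat.{u} A ⥤ FGModuleCat.{u} A where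
  obj X := FGModuleCat.of A (tensMod k e f X.obj)
  map g := FGModuleCat.ofHom
    (TensorProduct.AlgebraTensorModule.lTensor A _ (idemMap k f g.hom))
  map_id X := by
    ext : 1
    apply TensorProduct.AlgebraTensorModule.ext
    intro x y
    rfl
  map_comp g h := by
    ext : 1
    apply TensorProduct.AlgebraTensorModule.ext
    intro x y
    rfl

instance (e f : A) : (tensFunctor k e f).Additive where
  map_add {X Y g h} := by
    ext : 1
    apply TensorProduct.AlgebraTensorModule.ext
    intro x y
    change x ⊗ₜ[k] (idemMap k f g.hom y + idemMap k f h.hom y) = _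
    rw [TensorProduct.tmul_add]; rfl

instance (e f : A) : (tensFunctor k e f).Linear k where
  map_smul {X Y} g r := by
    ext : 1
    apply TensorProduct.AlgebraTensorModule.ext
    intro x y
    change x ⊗ₜ[k] (r • idemMap k f g.hom y) = algebraMap k A r • (x ⊗ₜ[k] (idemMap k f g.hom y))
    rw [TensorProduct.tmul_smul, algebraMap_smul]

section comp

variable (f e : A)

/-- The space `fAe`. -/
def corner : Submodule k ↥(Ideal.span {e}) :=
  LinearMap.range (Algebra.lsmul k k ↥(Ideal.span {e}) f)

lemma exists_retr : ∃ ψ : ↥(Ideal.span {e}) →ₗ[k] corner k f e, ∀ w : corner k f e, ψ w.1 = w := by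
  obtain ⟨g, hg⟩ := LinearMap.exists_leftInverse_of_injective (corner k f e).subtype
    (Submodule.ker_subtype _)
  exact ⟨g, fun w => LinearMap.congr_fun hg w⟩

variable {k f e} (t : A)

/-- Insertion of an element of `fAe`. -/
noncomputable def cornerIn (w : corner k f e) (X : FGModuleCat.{u} A) :
    idemPart k t X.obj →ₗ[k] idemPart k f ((tensFunctor k e t).obj X).obj where
  toFun v := ⟨w.1 ⊗ₜ[k] v, by
    obtain ⟨_, a, rfl⟩ := w
    exact ⟨a ⊗ₜ[k] v, rfl⟩⟩
  map_add' v v' := Subtype.ext (TensorProduct.tmul_add _ _ _)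
  map_smul' r v := Subtype.ext (by
    change w.1 ⊗ₜ[k] (r • v) = algebraMap k A r • (w.1 ⊗ₜ[k] v)
    rw [TensorProduct.tmul_smul, algebraMap_smul])

/-- Contraction with a linear form. -/
noncomputable def contr (φ : ↥(Ideal.span {e}) →ₗ[k] k) (X : FGModuleCat.{u} A) :
    tensMod k e t X.obj →ₗ[k] idemPart k t X.obj :=
  (TensorProduct.lid k _).toLinearMap ∘ₗ LinearMap.rTensor _ φ

lemma contr_tmul (φ : ↥(Ideal.span {e}) →ₗ[k] k) (X : FGModuleCat.{u} A) (a) (v) :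
    contr t φ X (a ⊗ₜ[k] v) = φ a • v := by
  simp [contr]

variable (f) in
/-- Contraction with a linear form, restricted. -/
noncomputable def cornerOut (φ : ↥(Ideal.span {e}) →ₗ[k] k) (X : FGModuleCat.{u} A) :
    idemPart k f ((tensFunctor k e t).obj X).obj →ₗ[k] idemPart k t X.obj where
  toFun z := contr t φ X z.1
  map_add' z z' := (contr t φ X).map_add _ _
  map_smul' r z := by
    have h : ∀ z : tensMod k e t X.obj,
        contr t φ X (algebraMap k A r • z) = r • contr t φ X z := fun z => by
      rw [algebraMap_smul, map_smul]
    exact h z.1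

variable (f) in
/-- The inclusion attached to an element of `fAe`. -/
noncomputable def inNat (g : A) (w : corner k f e) :
    tensFunctor k g t ⟶ tensFunctor k e t ⋙ tensFunctor k g f where
  app X := FGModuleCat.ofHom
    (TensorProduct.AlgebraTensorModule.lTensor A _ (cornerIn t w X))
  naturality X Y h := by
    ext : 1
    apply TensorProduct.AlgebraTensorModule.ext
    intro x y
    rfl

variable (f) in
/-- The projection attached to a linear form. -/
noncomputable def outNat (g : A) (φ : ↥(Ideal.span {e}) →ₗ[k] k) :
    tensFunctor k e t ⋙ tensFunctor k g f ⟶ tensFunctor k g t where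
  app X := FGModuleCat.ofHom
    (TensorProduct.AlgebraTensorModule.lTensor A _ (cornerOut f t φ X))
  naturality X Y h := by
    ext : 1
    apply TensorProduct.AlgebraTensorModule.ext
    intro x y
    change x ⊗ₜ[k] _ = x ⊗ₜ[k] _
    congr 1
    obtain ⟨y, hy⟩ := y
    change contr t φ Y (TensorProduct.AlgebraTensorModule.lTensor A _ (idemMap k t h.hom) y) =
      idemMap k t h.hom (contr t φ X y)
    clear hy
    induction y using TensorProduct.induction_on with
    | zero => simp
    | add a b ha hb => rw [map_add, map_add, map_add, map_add, ha, hb]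
    | tmul a b =>
      rw [TensorProduct.AlgebraTensorModule.lTensor_tmul, contr_tmul, contr_tmul, map_smul]

lemma decomp_aux (ψ : ↥(Ideal.span {e}) →ₗ[k] corner k f e) (hψ : ∀ w : corner k f e, ψ w.1 = w)
    {J : Type} [Fintype J] (B : Module.Basis J k (corner k f e)) (X : FGModuleCat.{u} A)
    (z : tensMod k e t X.obj) :
    ∑ j, (B j).1 ⊗ₜ[k] contr t (B.coord j ∘ₗ ψ) X (f • z) = f • z := by
  induction z using TensorProduct.induction_on with
  | zero => simp
  | add y z hy hz =>
    simp only [smul_add, map_add, TensorProduct.tmul_add, Finset.sum_add_distrib, hy, hz]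
  | tmul a u =>
    have h1 : f • (a ⊗ₜ[k] u) = (f • a) ⊗ₜ[k] u := rfl
    have h2 := B.sum_repr ⟨f • a, a, rfl⟩
    have h3 := hψ ⟨f • a, a, rfl⟩
    dsimp only at h3
    simp only [h1, contr_tmul, LinearMap.comp_apply, h3, Module.Basis.coord_apply,
      ← TensorProduct.smul_tmul, ← TensorProduct.sum_tmul]
    congr 1
    have h4 := congrArg Subtype.val h2
    rwa [Submodule.coe_sum] at h4

variable (k f e) in
/-- `(Ag ⊗ fA) ⊗_A (Ae ⊗ tA)` is a direct sum of copies of `Ag ⊗ tA`. -/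
lemma exists_decomp (g : A) : ∃ (d : ℕ) (b : Bicone (fun _ : Fin d => tensFunctor k g t)),
    Nonempty b.IsBilimit ∧ b.pt = tensFunctor k e t ⋙ tensFunctor k g f := by
  obtain ⟨ψ, hψ⟩ := exists_retr k f e
  let B := Module.finBasis k (corner k f e)
  let b : Bicone (fun _ : Fin (Module.finrank k (corner k f e)) => tensFunctor k g t) :=
    { pt := tensFunctor k e t ⋙ tensFunctor k g f
      ι := fun j => inNat f t g (B j)
      π := fun j => outNat f t g (B.coord j ∘ₗ ψ)
      ι_π := fun i j => by
        apply NatTrans.ext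
        funext X
        ext : 1
        apply TensorProduct.AlgebraTensorModule.ext
        intro x v
        change x ⊗ₜ[k] contr t (B.coord j ∘ₗ ψ) X ((B i).1 ⊗ₜ[k] v) = _
        rw [contr_tmul, LinearMap.comp_apply, hψ, Module.Basis.coord_apply, B.repr_self]
        by_cases hij : i = j
        · subst hij
          rw [Finsupp.single_eq_same, one_smul, dif_pos rfl]
          rfl
        · rw [Finsupp.single_eq_of_ne (Ne.symm hij), zero_smul, TensorProduct.tmul_zero,
            dif_neg hij]
          rfl }
  refine ⟨_, b, ⟨isBilimitOfTotal b ?_⟩, rfl⟩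
  apply NatTrans.ext
  funext X
  ext : 1
  apply TensorProduct.AlgebraTensorModule.ext
  intro x v
  let ev : (b.pt ⟶ b.pt) →+ (b.pt.obj X).obj :=
    { toFun := fun α => (α.app X).hom.hom (x ⊗ₜ[k] v)
      map_zero' := rfl
      map_add' := fun _ _ => rfl }
  change ev (∑ j, b.π j ≫ b.ι j) = ev (𝟙 _)
  rw [map_sum]
  change (∑ j, x ⊗ₜ[k] cornerIn t (B j) X (cornerOut f t (B.coord j ∘ₗ ψ) X v)) = x ⊗ₜ[k] v
  rw [← TensorProduct.tmul_sum]
  congr 1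
  apply Subtype.ext
  rw [Submodule.coe_sum]
  change (∑ j, (B j).1 ⊗ₜ[k] contr t (B.coord j ∘ₗ ψ) X v.1) = v.1
  obtain ⟨_, z, rfl⟩ := v
  exact decomp_aux t ψ hψ B X z

end comp


/-! #### Direct sums -/

section sums

variable {𝒳 : Type*} [Category 𝒳] [Preadditive 𝒳]

/-- `X` is a finite direct sum of objects satisfying `Q`. -/
def IsSumOf (Q : ObjectProperty 𝒳) : ObjectProperty 𝒳 := fun X =>
  ∃ (m : ℕ) (f : Fin m → 𝒳) (b : Bicone f),
    (∀ i, Q (f i)) ∧ Nonempty b.IsBilimit ∧ Nonempty (b.pt ≅ X)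

variable {Q : ObjectProperty 𝒳}

lemma isSumOf_of_total {J : Type} [Fintype J] (f : J → 𝒳) (hf : ∀ j, Q (f j)) (X : 𝒳)
    (i : ∀ j, f j ⟶ X) (p : ∀ j, X ⟶ f j) (h1 : ∀ j, i j ≫ p j = 𝟙 _)
    (h2 : ∀ j l, j ≠ l → i j ≫ p l = 0) (h3 : ∑ j, p j ≫ i j = 𝟙 X) : IsSumOf Q X := by
  classical
  let e := (Fintype.equivFin J).symm
  let b : Bicone (fun a => f (e a)) :=
    { pt := X
      ι := fun a => i (e a)
      π := fun a => p (e a)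
      ι_π := fun a c => by
        by_cases h : a = c
        · subst h; simp [h1]
        · rw [dif_neg h]
          exact h2 _ _ (fun h' => h (e.injective h')) }
  refine ⟨_, _, b, fun a => hf _, ⟨isBilimitOfTotal b ?_⟩, ⟨Iso.refl _⟩⟩
  change ∑ a, p (e a) ≫ i (e a) = 𝟙 X
  rw [← h3]
  exact e.sum_comp (fun j => p j ≫ i j)

lemma IsSumOf.exists_total {X : 𝒳} (h : IsSumOf Q X) : ∃ (m : ℕ) (f : Fin m → 𝒳)
    (_ : ∀ j, Q (f j)) (i : ∀ j, f j ⟶ X) (p : ∀ j, X ⟶ f j), (∀ j, i j ≫ p j = 𝟙 _) ∧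
    (∀ j l, j ≠ l → i j ≫ p l = 0) ∧ ∑ j, p j ≫ i j = 𝟙 X := by
  obtain ⟨m, f, b, hf, ⟨hb⟩, ⟨e⟩⟩ := h
  refine ⟨m, f, hf, fun j => b.ι j ≫ e.hom, fun j => e.inv ≫ b.π j, ?_, ?_, ?_⟩
  · intro j; simp
  · intro j l hjl; simp [bicone_ι_π_ne b hjl]
  · have : ∑ j, (e.inv ≫ b.π j) ≫ b.ι j ≫ e.hom = e.inv ≫ (∑ j, b.π j ≫ b.ι j) ≫ e.hom := by
      rw [Preadditive.sum_comp, Preadditive.comp_sum]; simp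
    rw [this, IsBilimit.total hb]
    change e.inv ≫ 𝟙 _ ≫ e.hom = _
    simp

lemma IsSumOf.of_iso {X Y : 𝒳} (h : IsSumOf Q X) (e : X ≅ Y) : IsSumOf Q Y := by
  obtain ⟨m, f, b, hf, hb, ⟨e'⟩⟩ := h
  exact ⟨m, f, b, hf, hb, ⟨e'.trans e⟩⟩

lemma IsSumOf.of_mem {X : 𝒳} (h : Q X) : IsSumOf Q X :=
  isSumOf_of_total (J := Unit) (fun _ => X) (fun _ => h) X (fun _ => 𝟙 X) (fun _ => 𝟙 X)
    (by simp) (fun j l h => (h rfl).elim) (by simp)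

lemma IsSumOf.flatten {X : 𝒳} (h : IsSumOf (IsSumOf Q) X) : IsSumOf Q X := by
  obtain ⟨m, f, hf, i, p, h1, h2, h3⟩ := h.exists_total
  choose n g hg i' p' h1' h2' h3' using fun j => (hf j).exists_total
  refine isSumOf_of_total (J := Σ j, Fin (n j)) (fun a => g a.1 a.2) (fun a => hg _ _) X
    (fun a => i' a.1 a.2 ≫ i a.1) (fun a => p a.1 ≫ p' a.1 a.2) ?_ ?_ ?_
  · rintro ⟨j, a⟩
    simp [reassoc_of% h1 j, h1']
  · rintro ⟨j, a⟩ ⟨l, c⟩ hne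
    by_cases hjl : j = l
    · subst hjl
      have : a ≠ c := fun h => hne (by rw [h])
      simp [reassoc_of% h1 j, h2' _ _ _ this]
    · simp [reassoc_of% h2 _ _ hjl]
  · rw [Fintype.sum_sigma, ← h3]
    refine Finset.sum_congr rfl fun j _ => ?_
    have : ∑ a, (p j ≫ p' j a) ≫ i' j a ≫ i j = p j ≫ (∑ a, p' j a ≫ i' j a) ≫ i j := by
      rw [Preadditive.sum_comp, Preadditive.comp_sum]; simp
    rw [this, h3']; simp

lemma IsSumOf.map {𝒴 : Type*} [Category 𝒴] [Preadditive 𝒴] (Φ : 𝒳 ⥤ 𝒴) [Φ.Additive]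
    {R : ObjectProperty 𝒴} (hR : ∀ X, Q X → R (Φ.obj X)) {X : 𝒳} (h : IsSumOf Q X) :
    IsSumOf R (Φ.obj X) := by
  obtain ⟨m, f, hf, i, p, h1, h2, h3⟩ := h.exists_total
  refine isSumOf_of_total (fun j => Φ.obj (f j)) (fun j => hR _ (hf j)) _ (fun j => Φ.map (i j))
    (fun j => Φ.map (p j)) ?_ ?_ ?_
  · intro j; rw [← Φ.map_comp, h1, Φ.map_id]
  · intro j l hjl; rw [← Φ.map_comp, h2 j l hjl, Φ.map_zero]
  · rw [← Φ.map_id, ← h3, Φ.map_sum]; simp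

end sums

section ProjFun

variable {C : Type u} [SmallCategory C] [Preadditive C] [Linear k C]
  (ι : C ⥤ FGModuleCat.{u} A) [ι.IsEquivalence] [ι.Additive] [ι.Linear k]

/-- The functor `X ↦ (Ae ⊗ fA) ⊗_A X`, transported to a category `C` equivalent to `A-mod`. -/
noncomputable def projFun (e f : A) : C ⥤ C := ι ⋙ tensFunctor k e f ⋙ ι.inv

instance : ι.inv.Additive :=
  have : ι.asEquivalence.functor.Additive := ‹ι.Additive›
  ι.asEquivalence.inverse_additive

instance : ι.inv.Linear k :=
  have : Functor.Linear k ι.asEquivalence.functor := ‹ι.Linear k›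
  Equivalence.inverseLinear k ι.asEquivalence

instance (e f : A) : (projFun k ι e f).Additive := by unfold projFun; infer_instance

instance (e f : A) : (projFun k ι e f).Linear k := by unfold projFun; infer_instance

variable {n : ℕ} (e : Fin n → A)

/-- The identity functor and the functors of tensoring with `Ae_s ⊗ e_tA`. -/
def projGen : ObjectProperty (C ⥤ C) := fun F =>
  F = 𝟭 C ∨ ∃ s t : Fin n, F = projFun k ι (e s) (e t)

/-- Projective functors: the functors isomorphic to finite direct sums of identity functors and
functors of tensoring with `Ae_s ⊗ e_tA`. -/
def IsProjFun : ObjectProperty (C ⥤ C) := IsSumOf (projGen k ι e)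

variable {k ι e}

lemma IsProjFun.map_eq {F : C ⥤ C} (h : IsProjFun k ι e F) : ∃ (m : ℕ) (f : Fin m → (C ⥤ C))
    (i : ∀ j, f j ⟶ F) (p : ∀ j, F ⟶ f j), (∀ j, (f j).Additive) ∧ (∀ j, (f j).Linear k) ∧
    ∀ {X Y : C} (g : X ⟶ Y), F.map g = ∑ j, (p j).app X ≫ (f j).map g ≫ (i j).app Y := by
  obtain ⟨m, f, hf, i, p, -, -, h3⟩ := h.exists_total
  refine ⟨m, f, i, p, fun j => ?_, fun j => ?_, fun {X Y} g => ?_⟩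
  · obtain h | ⟨s, t, h⟩ := hf j <;> rw [h] <;> infer_instance
  · obtain h | ⟨s, t, h⟩ := hf j <;> rw [h] <;> infer_instance
  · have := congrArg (fun α : F ⟶ F => α.app X ≫ F.map g) h3
    simpa [NatTrans.app_sum, Preadditive.sum_comp] using this.symm

lemma IsProjFun.comp_projGen {F G : C ⥤ C} (hF : projGen k ι e F) (hG : IsProjFun k ι e G) :
    IsProjFun k ι e (G ⋙ F) := by
  obtain rfl | ⟨s, t, rfl⟩ := hF
  · exact hG
  · refine IsSumOf.flatten (IsSumOf.map ((Functor.whiskeringRight C C C).obj _) ?_ hG)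
    rintro H (rfl | ⟨u, v, rfl⟩)
    · exact IsSumOf.of_mem (Or.inr ⟨s, t, rfl⟩)
    · obtain ⟨d, b, hb, hpt⟩ := exists_decomp k (e t) (e u) (e v) (e s)
      have h1 : IsSumOf (fun T => T = tensFunctor k (e s) (e v))
          (tensFunctor k (e u) (e v) ⋙ tensFunctor k (e s) (e t)) :=
        ⟨d, _, b, fun _ => rfl, hb, ⟨eqToIso hpt⟩⟩
      have h2 := IsSumOf.map (R := projGen k ι e)
        ((Functor.whiskeringRight _ _ _).obj ι.inv ⋙ (Functor.whiskeringLeft _ _ _).obj ι)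
        (by rintro _ rfl; exact Or.inr ⟨s, v, rfl⟩) h1
      refine h2.of_iso ?_
      let E := ι.asEquivalence.counitIso
      exact Functor.isoWhiskerLeft ι (Functor.isoWhiskerLeft (tensFunctor k (e u) (e v))
        (Functor.isoWhiskerRight E.symm (tensFunctor k (e s) (e t) ⋙ ι.inv)))

variable (k ι e)

instance : IsTwoCat k (IsProjFun k ι e) where
  id_mem := IsSumOf.of_mem (Or.inl rfl)
  comp_mem {F G} hF hG :=
    IsSumOf.flatten (IsSumOf.map ((Functor.whiskeringLeft C C C).obj G)
      (fun _ hH => IsProjFun.comp_projGen hH hG) hF)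
  additive hF := by
    obtain ⟨m, f, i, p, h1, -, h3⟩ := hF.map_eq
    exact ⟨fun {X Y g h} => by
      rw [h3, h3 g, h3 h, ← Finset.sum_add_distrib]
      exact Finset.sum_congr rfl fun j _ => by simp⟩
  linear hF := by
    obtain ⟨m, f, i, p, -, h2, h3⟩ := hF.map_eq
    exact ⟨fun {X Y} g r => by
      rw [h3, h3 g, Finset.smul_sum]
      exact Finset.sum_congr rfl fun j _ => by simp⟩

end ProjFun

end Alg
/-! ### Algebras and modules -/

section Algebra

variable {A : Type u} [Ring A]

/-- A primitive idempotent: nonzero, and not a sum of two nonzero orthogonal idempotents. -/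
def IsPrimitiveIdem (e : A) : Prop :=
  IsIdempotentElem e ∧ e ≠ 0 ∧ ∀ f g : A, IsIdempotentElem f → IsIdempotentElem g →
    f * g = 0 → g * f = 0 → e = f + g → f = 0 ∨ g = 0

/-- A primitive decomposition `1 = e_1 + ⋯ + e_n` of the identity. -/
def IsPrimitiveDecomposition {n : ℕ} (e : Fin n → A) : Prop :=
  CompleteOrthogonalIdempotents e ∧ ∀ i, IsPrimitiveIdem (e i)

/-- The algebra is basic: the modules `Ae_i` of a primitive decomposition are pairwise
nonisomorphic. -/
def IsBasicWrt {n : ℕ} (e : Fin n → A) : Prop :=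
  ∀ i j, Nonempty (↥(Ideal.span {e i}) ≃ₗ[A] ↥(Ideal.span {e j})) → i = j

/-- The algebra is connected: it is nonzero and not a product of two nonzero algebras. -/
def IsConnectedAlg (A : Type u) [Ring A] : Prop :=
  Nontrivial A ∧ ∀ e : A, IsIdempotentElem e → (∀ a, e * a = a * e) → e = 0 ∨ e = 1

/-- The simple top `L` of the projective module `Ae`, for a primitive idempotent `e`. -/
abbrev simpleTop (e : A) : Type u :=
  ↥(Ideal.span {e}) ⧸ Module.jacobson A ↥(Ideal.span {e})

/-- `L` is a composition factor of `X`, that is, isomorphic to a subquotient of `X`. -/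
def IsFactor (L X : Type u) [AddCommGroup L] [Module A L] [AddCommGroup X] [Module A X] : Prop :=
  ∃ U V : Submodule A X, U ≤ V ∧ Nonempty ((↥V ⧸ U.submoduleOf V) ≃ₗ[A] L)

end Algebra

section Stable

variable (k : Type u) [Field k] {C : Type u} [SmallCategory C] [Preadditive C] [Linear k C]

/-- The ideal of (sums of) morphisms which factor through projective objects. -/
def projIdeal (C : Type u) [SmallCategory C] [Preadditive C] [Linear k C] : LinIdeal k C where
  hom X Y := Submodule.span k {f | ∃ (Z : C) (_ : Projective Z) (g : X ⟶ Z) (h : Z ⟶ Y), f = g ≫ h}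
  comp_left {X Y Z} f {g} hg := by
    induction hg using Submodule.span_induction with
    | mem g hg =>
      obtain ⟨W, hW, a, b, rfl⟩ := hg
      exact Submodule.subset_span ⟨W, hW, f ≫ a, b, by simp⟩
    | zero => simp
    | add a b _ _ ha hb => rw [Preadditive.comp_add]; exact Submodule.add_mem _ ha hb
    | smul r a _ ha => rw [Linear.comp_smul]; exact Submodule.smul_mem _ r ha
  comp_right {X Y Z} {f} g hf := by
    induction hf using Submodule.span_induction with
    | mem f hf =>
      obtain ⟨W, hW, a, b, rfl⟩ := hf
      exact Submodule.subset_span ⟨W, hW, a, b ≫ g, by simp⟩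
    | zero => simp
    | add a b _ _ ha hb => rw [Preadditive.add_comp]; exact Submodule.add_mem _ ha hb
    | smul r a _ ha => rw [Linear.smul_comp]; exact Submodule.smul_mem _ r ha

/-- The stable category of `C`. -/
abbrev StableCat (C : Type u) [SmallCategory C] [Preadditive C] [Linear k C] : Type u :=
  (projIdeal k C).Quot

end Stable

section Final

variable (k : Type u) [Field k] {A : Type u} [Ring A] [Algebra k A] [Module.Finite k A]
  {C : Type u} [SmallCategory C] [Preadditive C] [Linear k C]
  (ι : C ⥤ FGModuleCat.{u} A) [ι.IsEquivalence] [ι.Additive] [ι.Linear k]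
  {n : ℕ} (e : Fin n → A)

/-- The `1`-morphisms of the `2`-category of projective functors. -/
abbrev ProjMor : Type u := (IsProjFun k ι e).FullSubcategory

/-- The `1`-morphism of tensoring with `Ae_s ⊗ e_tA`. -/
noncomputable def projMor (s t : Fin n) : ProjMor k ι e :=
  ⟨projFun k ι (e s) (e t), IsSumOf.of_mem (Or.inr ⟨s, t, rfl⟩)⟩

/-- The left cell `L_0`. -/
def cellL0 : Set (Ind (ProjMor k ι e)) := leftCell k (oneMor k (IsProjFun k ι e))

/-- The left cell `L_j`. -/
def cellL (j : Fin n) : Set (Ind (ProjMor k ι e)) := leftCell k (projMor k ι e j j)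

/-- The cell `2`-representation of the left cell `L_0`. -/
def cellRep0 : TwoRep k (IsProjFun k ι e) := cellRep (oneMor k (IsProjFun k ι e))

/-- The cell `2`-representation of the left cell `L_j`. -/
noncomputable def cellRepAt (j : Fin n) : TwoRep k (IsProjFun k ι e) :=
  cellRep (projMor k ι e j j)

/-- The union `E_S` of the left cells `L_j` with `j` in `S`. -/
def cellUnion (S : Set (Fin n)) : Set (Ind (ProjMor k ι e)) := ⋃ j ∈ S, cellL k ι e j

/-- The signature of an object of `C`: the set of `i` such that `L_i` is a composition factor. -/
def signature (X : C) : Set (Fin n) := {i | IsFactor (A := A) (simpleTop (e i)) (ι.obj X)}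

end Final

end DiscExt

/-!
The functor `F_st` takes `X` to the direct sum of `dim Hom(Ae_t, X)` copies of `Ae_s`. It is used
through the universal property of the copower `Ae_s ⊗ Hom(Ae_t, X)` (`Copower`), which gives the
natural transformations between such functors, the decomposition of `F_st ∘ F_uv` into copies of
`F_sv`, and a counit `F_ss → Id` with the property that the induced `F_ss ∘ F_st → F_st` is a split
epimorphism. Composition with `F_ut` generates the identity of `F_tt` from every natural
transformation that is nonzero modulo the radical of `e_t A e_t`. Hence the cell `2`-representation
of `L_i` is the action on projective objects (`nonempty_cellRepAt_equiv`), while in that of the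
identity all `F_st` act by zero (`isZero_act_cellRep0`), because there is a module which is not
projective. The tool for recognizing a cell `2`-representation is `cellIdeal_eq_ker`: its ideal is
the kernel of a morphism of `2`-representations as soon as every morphism outside of the kernel
generates the identity of a `1`-morphism in the cell.

In a discrete extension, a `1`-morphism in the decoration is some `F_st`, and `F_st X` has a summand
`Y` in the subrepresentation for some `X` outside of it.

* If the subrepresentation is the cell `2`-representation of the identity, then `F_ss Y = 0`. By the
  counit every morphism `F_st X → Y` factors through `F_ss Y`, and thus vanishes
  (`hom_eq_zero_of_isZero_act`). So there are no such extensions, whatever the quotient is.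
* If the quotient is the cell `2`-representation of the identity, then all `F_st X` lie in the
  subrepresentation, and `F_st X = 0` depends on `t` and `X` only. So the decoration is the union of
  the left cells of those `t` for which `F_tt` does not kill all indecomposable objects outside of
  the subrepresentation (`decoration_eq_cellUnion`).
* If both are the cell `2`-representation of `L_i`, then the `Ae_u` lift to indecomposable objects
  `X_u`, and `F_pq X_u` is the direct sum of `c_qu = dim Hom(Ae_q, Ae_u)` copies of `X_p` and an
  object `B_pqu` of the subrepresentation. Let `h W` be the dimension of the space of morphisms from
  a fixed object to `W`. Since `F_rs F_pq` consists of `c_sp` copies of `F_rq`, it follows that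
  `c_sp h(B_rqu) = c_qu h(B_rsp) + h(F_rs B_pqu)`. Summed over all `s`, `p`, `q` and `u`, the first
  two terms cancel. So all `F_rs` kill all `B_pqu`, and these are zero, as an object of the cell
  `2`-representation of `L_i` with this property is zero (`not_isSummand_act`).
* Let `V` be indecomposable with stable endomorphism algebra `k`. The direct sums of copies of `V`
  and of projective objects form a `2`-representation with the action on projective objects as
  a subrepresentation. The quotient is the cell `2`-representation of the identity, by evaluation at
  `V` (`nonempty_cellRep0_equiv`), and `F_tt V` is nonzero if and only if `e_t V` is, that is, if
  `t` belongs to the signature of `V` (`decoration_addRep`).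
-/

open CategoryTheory Limits
open scoped ZeroObject
set_option linter.unusedSectionVars false

namespace DiscExt

/-! ### Finite dimensional local algebras -/

section LocalRings

lemma exists_isUnit_of_isUnit_sum {R : Type*} [Ring R] [IsLocalRing R] {J : Type*} (s : Finset J)
    (f : J → R) (h : IsUnit (∑ j ∈ s, f j)) : ∃ j ∈ s, IsUnit (f j) := by
  classical
  induction s using Finset.induction_on with
  | empty => simp at h
  | insert a s ha ih =>
    rw [Finset.sum_insert ha] at h
    obtain ⟨v, hv⟩ := h
    have h1 : (↑v⁻¹ : R) * f a + ↑v⁻¹ * ∑ j ∈ s, f j = 1 := by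
      rw [← mul_add, ← hv, Units.inv_mul]
    obtain h2 | h2 := IsLocalRing.isUnit_or_isUnit_of_add_one h1
    · exact ⟨a, by simp, by simpa using h2⟩
    · obtain ⟨j, hj, hj'⟩ := ih (by simpa using h2)
      exact ⟨j, by simp [hj], hj'⟩

lemma IsIdempotentElem.eq_zero_or_one_of_isLocalRing {R : Type*} [Ring R] [IsLocalRing R] {x : R}
    (h : IsIdempotentElem x) : x = 0 ∨ x = 1 := by
  obtain h1 | h1 := IsLocalRing.isUnit_or_isUnit_of_add_one (add_sub_cancel x 1)
  · right
    exact h1.mul_left_cancel (by rw [h.eq, mul_one])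
  · left
    exact h1.mul_left_cancel (by rw [sub_mul, one_mul, h.eq, sub_self, mul_zero])

variable {R : Type*} [Ring R]

/-- Fitting's lemma: the right ideals `x ^ m R` and `{r | x ^ m r = 0}` are complementary for large
`m`, and `e` is the component of `1` in the former. -/
lemma exists_fitting_idempotent (k : Type*) [Field k] [Algebra k R] [FiniteDimensional k R]
    (x : R) : ∃ (m : ℕ) (e y : R), 0 < m ∧ IsIdempotentElem e ∧
    e = x ^ m * y ∧ x ^ m * e = x ^ m := by
  obtain ⟨m, hm, hm0⟩ := ((LinearMap.mulLeft k x).eventually_isCompl_ker_pow_range_pow.and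
    (Filter.eventually_gt_atTop 0)).exists
  rw [LinearMap.pow_mulLeft] at hm
  obtain ⟨a, ha, b, hb, hab⟩ : ∃ a, x ^ m * a = 0 ∧ ∃ b, (∃ y, x ^ m * y = b) ∧ a + b = 1 := by
    have h1 : (1 : R) ∈ LinearMap.ker (LinearMap.mulLeft k (x ^ m)) ⊔
        LinearMap.range (LinearMap.mulLeft k (x ^ m)) := by rw [hm.sup_eq_top]; trivial
    obtain ⟨a, ha, b, hb, hab⟩ := Submodule.mem_sup.1 h1
    exact ⟨a, by simpa using ha, b, by simpa using hb, hab⟩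
  obtain ⟨y, hy⟩ := hb
  have hba : b * a = 0 := by
    have h1 : b * a ∈ LinearMap.ker (LinearMap.mulLeft k (x ^ m)) ⊓
        LinearMap.range (LinearMap.mulLeft k (x ^ m)) := by
      refine ⟨?_, ⟨y * a, ?_⟩⟩
      · have : b * a = a - a * a := by
          rw [show b = 1 - a from eq_sub_of_add_eq' hab, sub_mul, one_mul]
        simp [this, mul_sub, ← mul_assoc, ha]
      · simp [← hy, mul_assoc]
    rw [hm.inf_eq_bot] at h1
    simpa using h1
  refine ⟨m, b, y, hm0, ?_, hy.symm, ?_⟩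
  · have : b * (a + b) = b := by rw [hab, mul_one]
    rwa [mul_add, hba, zero_add] at this
  · have : x ^ m * (a + b) = x ^ m := by rw [hab, mul_one]
    rwa [mul_add, ha, zero_add] at this

lemma isUnit_of_mul_eq_one_of_finite (k : Type*) [Field k] [Algebra k R] [FiniteDimensional k R]
    {x y : R} (h : x * y = 1) : IsUnit x := by
  have : IsNoetherianRing R := isNoetherian_of_tower k inferInstance
  exact IsUnit.of_mul_eq_one y h

/-- Fitting's lemma produces an idempotent which is `0` if `x` is nilpotent and `1` if `x` is a
unit. -/
lemma isNilpotent_or_isUnit_of_idempotents (k : Type*) [Field k] [Algebra k R]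
    [FiniteDimensional k R] (h : ∀ e : R, IsIdempotentElem e → e = 0 ∨ e = 1) (x : R) :
    IsNilpotent x ∨ IsUnit x := by
  obtain ⟨m, e, y, hm, he, hxy, hx⟩ := exists_fitting_idempotent k x
  obtain rfl | rfl := h e he
  · left
    exact ⟨m, by rw [← hx, mul_zero]⟩
  · right
    obtain ⟨m, rfl⟩ := Nat.exists_eq_succ_of_ne_zero hm.ne'
    rw [pow_succ', mul_assoc] at hxy
    exact isUnit_of_mul_eq_one_of_finite k hxy.symm

lemma isLocalRing_of_idempotents (k : Type*) [Field k] [Algebra k R] [FiniteDimensional k R]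
    [Nontrivial R] (h : ∀ e : R, IsIdempotentElem e → e = 0 ∨ e = 1) : IsLocalRing R where
  isUnit_or_isUnit_of_add_one {a b} hab := by
    obtain h1 | h1 := isNilpotent_or_isUnit_of_idempotents k h a
    · right
      rw [show b = 1 - a from eq_sub_of_add_eq' hab]
      exact h1.isUnit_one_sub
    · exact Or.inl h1

lemma isNilpotent_or_isUnit (k : Type*) [Field k] [Algebra k R] [FiniteDimensional k R]
    [IsLocalRing R] (x : R) : IsNilpotent x ∨ IsUnit x :=
  isNilpotent_or_isUnit_of_idempotents k
    (fun _ he => IsIdempotentElem.eq_zero_or_one_of_isLocalRing he) x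

end LocalRings

/-! ### Retracts, direct sums and indecomposable objects -/

section Retracts

variable {𝒳 : Type*} [Category 𝒳] [Preadditive 𝒳]

/-- A presentation of `X` as the direct sum of the finite family `f`, by injections and
projections. -/
structure SumDecomp {J : Type} [Fintype J] (f : J → 𝒳) (X : 𝒳) where
  ι : ∀ j, f j ⟶ X
  π : ∀ j, X ⟶ f j
  ι_π : ∀ j, ι j ≫ π j = 𝟙 _
  ι_π_ne : ∀ j l, j ≠ l → ι j ≫ π l = 0
  total : ∑ j, π j ≫ ι j = 𝟙 X

namespace SumDecomp

variable {J : Type} [Fintype J] {f : J → 𝒳} {X : 𝒳}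

/-- The image of a direct sum under an additive functor. -/
@[simps] def map {𝒴 : Type*} [Category 𝒴] [Preadditive 𝒴] (d : SumDecomp f X) (Φ : 𝒳 ⥤ 𝒴)
    [Φ.Additive] : SumDecomp (fun j => Φ.obj (f j)) (Φ.obj X) where
  ι j := Φ.map (d.ι j)
  π j := Φ.map (d.π j)
  ι_π j := by rw [← Φ.map_comp, d.ι_π, Φ.map_id]
  ι_π_ne j l h := by rw [← Φ.map_comp, d.ι_π_ne j l h, Φ.map_zero]
  total := by rw [← Φ.map_id, ← d.total, Φ.map_sum]; simp

/-- Transport of a direct sum along isomorphisms. -/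
def congr {g : J → 𝒳} {Y : 𝒳} (d : SumDecomp f X) (e : ∀ j, f j ≅ g j) (e' : X ≅ Y) :
    SumDecomp g Y where
  ι j := (e j).inv ≫ d.ι j ≫ e'.hom
  π j := e'.inv ≫ d.π j ≫ (e j).hom
  ι_π j := by simp [reassoc_of% d.ι_π j]
  ι_π_ne j l h := by simp [reassoc_of% d.ι_π_ne j l h]
  total := by
    have : ∑ j, (e'.inv ≫ d.π j ≫ (e j).hom) ≫ (e j).inv ≫ d.ι j ≫ e'.hom =
        e'.inv ≫ (∑ j, d.π j ≫ d.ι j) ≫ e'.hom := by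
      rw [Preadditive.sum_comp, Preadditive.comp_sum]; simp
    rw [this, d.total]; simp

/-- Each summand is a retract. -/
@[simps] def retract (d : SumDecomp f X) (j : J) : Retract (f j) X where
  i := d.ι j
  r := d.π j
  retract := d.ι_π j

lemma eq_id_comp (d : SumDecomp f X) {Y : 𝒳} (h : X ⟶ Y) : h = ∑ j, d.π j ≫ d.ι j ≫ h := by
  have := Preadditive.sum_comp Finset.univ (fun j => d.π j ≫ d.ι j) h
  rw [d.total, Category.id_comp] at this
  simpa using this

lemma eq_comp_id (d : SumDecomp f X) {Y : 𝒳} (h : Y ⟶ X) : h = ∑ j, (h ≫ d.π j) ≫ d.ι j := by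
  have := Preadditive.comp_sum Finset.univ h (fun j => d.π j ≫ d.ι j)
  rw [d.total, Category.comp_id] at this
  simpa using this

lemma isSumOf (d : SumDecomp f X) {Q : ObjectProperty 𝒳} (h : ∀ j, Q (f j)) : IsSumOf Q X :=
  isSumOf_of_total f h X d.ι d.π d.ι_π d.ι_π_ne d.total

lemma isZero (d : SumDecomp f X) (h : ∀ j, IsZero (f j)) : IsZero X := by
  rw [IsZero.iff_id_eq_zero, d.eq_id_comp (𝟙 X)]
  exact Finset.sum_eq_zero fun j _ => by rw [(h j).eq_of_src (d.ι j) 0]; simp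

lemma finrank_hom {k : Type*} [Field k] [Linear k 𝒳] (d : SumDecomp f X)
    (T : 𝒳) [∀ j, FiniteDimensional k (T ⟶ f j)] :
    Module.finrank k (T ⟶ X) = ∑ j, Module.finrank k (T ⟶ f j) := by
  classical
  rw [← Module.finrank_pi_fintype k]
  refine LinearEquiv.finrank_eq
    { toFun := fun h j => h ≫ d.π j
      invFun := fun g => ∑ j, g j ≫ d.ι j
      map_add' := fun _ _ => by ext; simp
      map_smul' := fun _ _ => by ext; simp
      left_inv := fun h => (d.eq_comp_id h).symm
      right_inv := fun g => by
        ext j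
        dsimp only
        rw [Preadditive.sum_comp, Finset.sum_eq_single j]
        · simp [d.ι_π]
        · intro l _ h; simp [d.ι_π_ne l j h]
        · simp }

end SumDecomp

lemma IsSumOf.exists_sumDecomp {Q : ObjectProperty 𝒳} {X : 𝒳} (h : IsSumOf Q X) :
    ∃ (m : ℕ) (f : Fin m → 𝒳) (_ : ∀ j, Q (f j)), Nonempty (SumDecomp f X) := by
  obtain ⟨m, f, hf, i, p, h1, h2, h3⟩ := h.exists_total
  exact ⟨m, f, hf, ⟨⟨i, p, h1, h2, h3⟩⟩⟩

lemma IsSumOf.of_zero {Q : ObjectProperty 𝒳} {X : 𝒳} (h : IsZero X) : IsSumOf Q X :=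
  isSumOf_of_total (J := Empty) (fun j => j.elim) (fun j => j.elim) X (fun j => j.elim)
    (fun j => j.elim) (fun j => j.elim) (fun j => j.elim) (h.eq_of_src _ _)

lemma IsSumOf.mono {Q R : ObjectProperty 𝒳} (hQR : ∀ X, Q X → R X) {X : 𝒳} (h : IsSumOf Q X) :
    IsSumOf R X := by
  obtain ⟨m, f, b, hf, hb⟩ := h
  exact ⟨m, f, b, fun i => hQR _ (hf i), hb⟩

/-- The decomposition given by a binary biproduct. -/
def SumDecomp.ofBinaryBicone {Y Z X : 𝒳} (b : BinaryBicone Y Z) (hb : b.IsBilimit)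
    (e : b.pt ≅ X) : SumDecomp (fun j : Bool => cond j Y Z) X where
  ι j := match j with
    | true => b.inl ≫ e.hom
    | false => b.inr ≫ e.hom
  π j := match j with
    | true => e.inv ≫ b.fst
    | false => e.inv ≫ b.snd
  ι_π j := by cases j <;> simp
  ι_π_ne j l h := by cases j <;> cases l <;> simp at h ⊢
  total := by
    have := IsBilimit.binary_total hb
    simp only [Fintype.sum_bool]
    calc _ = e.inv ≫ (b.fst ≫ b.inl + b.snd ≫ b.inr) ≫ e.hom := by simp
      _ = 𝟙 X := by rw [this]; simp

lemma isSumOf_of_binaryBicone {Q : ObjectProperty 𝒳} {Y Z X : 𝒳} (b : BinaryBicone Y Z)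
    (hb : b.IsBilimit) (e : b.pt ≅ X) (hY : IsSumOf Q Y) (hZ : IsSumOf Q Z) : IsSumOf Q X :=
  ((SumDecomp.ofBinaryBicone b hb e).isSumOf (Q := IsSumOf Q) (by rintro (_ | _) <;> assumption)).flatten

/-- A direct summand is a retract. -/
lemma IsSummand.nonempty_retract {𝒳 : Type u} [SmallCategory 𝒳] [Preadditive 𝒳] {Y X : 𝒳}
    (h : IsSummand Y X) : Nonempty (Retract Y X) := by
  obtain ⟨Z, b, ⟨hb⟩, ⟨e⟩⟩ := h
  exact ⟨⟨b.inl ≫ e.hom, e.inv ≫ b.fst, by simp⟩⟩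

lemma isZero_of_retract {Y X : 𝒳} (r : Retract Y X) (h : IsZero X) : IsZero Y := by
  rw [IsZero.iff_id_eq_zero, ← r.retract, h.eq_of_tgt r.i 0, zero_comp]

/-- The binary biproduct attached to complementary retracts. -/
@[simps] def complBicone {X Y Z : 𝒳} (r : Retract Y X) (s : Retract Z X)
    (h : r.r ≫ r.i + s.r ≫ s.i = 𝟙 X) : BinaryBicone Y Z where
  pt := X
  fst := r.r
  snd := s.r
  inl := r.i
  inr := s.i
  inl_fst := r.retract
  inr_snd := s.retract
  inl_snd := by
    have := r.i ≫= h =≫ s.r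
    simpa using this
  inr_fst := by
    have := s.i ≫= h =≫ r.r
    simpa using this

/-- Complementary retracts form a biproduct. -/
def complBiconeIsBilimit {X Y Z : 𝒳} (r : Retract Y X) (s : Retract Z X)
    (h : r.r ≫ r.i + s.r ≫ s.i = 𝟙 X) : (complBicone r s h).IsBilimit :=
  isBinaryBilimitOfTotal _ h

lemma exists_compl [IsIdempotentComplete 𝒳] {X Y : 𝒳} (r : Retract Y X) :
    ∃ (Z : 𝒳) (s : Retract Z X), r.r ≫ r.i + s.r ≫ s.i = 𝟙 X := by
  obtain ⟨Z, i, q, h1, h2⟩ := IsIdempotentComplete.idempotents_split X (𝟙 X - r.r ≫ r.i)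
    (by simp [Preadditive.sub_comp, Preadditive.comp_sub])
  exact ⟨Z, ⟨i, q, h1⟩, by simp [h2]⟩

section Small

variable {𝒳 : Type u} [SmallCategory 𝒳] [Preadditive 𝒳]

lemma isSummand_of_retract [IsIdempotentComplete 𝒳] {X Y : 𝒳} (r : Retract Y X) :
    IsSummand Y X := by
  obtain ⟨Z, s, h⟩ := exists_compl r
  exact ⟨Z, _, ⟨complBiconeIsBilimit r s h⟩, ⟨Iso.refl _⟩⟩

lemma IsSummand.of_iso {X X' Y : 𝒳} (h : IsSummand Y X) (e : X ≅ X') : IsSummand Y X' := by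
  obtain ⟨Z, b, hb, ⟨f⟩⟩ := h
  exact ⟨Z, b, hb, ⟨f ≪≫ e⟩⟩

lemma isSummand_of_iso [HasZeroObject 𝒳] {X Y : 𝒳} (e : X ≅ Y) : IsSummand X Y := by
  have h0 := isZero_zero 𝒳
  refine ⟨0, complBicone (Retract.ofIso e) ⟨0, 0, h0.eq_of_src _ _⟩ (by simp [Retract.ofIso]),
    ⟨complBiconeIsBilimit _ _ _⟩, ⟨Iso.refl _⟩⟩

lemma IsIndec.of_iso {X Y : 𝒳} (h : IsIndec X) (e : X ≅ Y) : IsIndec Y :=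
  ⟨fun h0 => h.1 (h0.of_iso e), fun _ _ b hb ⟨f⟩ => h.2 _ _ b hb ⟨f ≪≫ e.symm⟩⟩

lemma Ind.mk_eq_mk {X Y : 𝒳} {hX : IsIndec X} {hY : IsIndec Y} :
    Ind.mk X hX = Ind.mk Y hY ↔ Nonempty (X ≅ Y) :=
  ⟨fun h => _root_.Quotient.exact h, fun h => _root_.Quotient.sound h⟩

lemma isIndec_of_isLocalRing {X : 𝒳} (h : IsLocalRing (End X)) : IsIndec X := by
  refine ⟨fun h0 => ?_, fun Y Z b ⟨hb⟩ ⟨e⟩ => ?_⟩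
  · exact one_ne_zero (α := End X) (h0.eq_of_src _ _)
  · have hi : IsIdempotentElem (M := End X) (e.inv ≫ b.fst ≫ b.inl ≫ e.hom) := by
      change (_ ≫ _) ≫ _ ≫ _ = _
      simp
    obtain h1 | h1 := IsIdempotentElem.eq_zero_or_one_of_isLocalRing hi
    · left
      have := b.inl ≫= e.hom ≫= ((h1 =≫ e.inv) =≫ b.fst)
      rw [IsZero.iff_id_eq_zero]
      simpa using this
    · right
      have := b.inr ≫= e.hom ≫= ((h1 =≫ e.inv) =≫ b.snd)
      rw [IsZero.iff_id_eq_zero]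
      have h2 : b.inr ≫ e.hom ≫ (1 : End X) ≫ e.inv ≫ b.snd = 0 := by
        simpa using this.symm
      have h3 : b.inr ≫ e.hom ≫ 𝟙 X ≫ e.inv ≫ b.snd = 0 := h2
      simpa using h3

end Small

/-- The idempotent given by a nonzero retract of an object with local endomorphism ring is the
identity. -/
lemma nonempty_iso_of_retract {X Y : 𝒳} (r : Retract Y X) (hX : IsLocalRing (End X))
    (hY : ¬ IsZero Y) : Nonempty (Y ≅ X) := by
  have hi : IsIdempotentElem (M := End X) (r.r ≫ r.i) := by
    change (_ ≫ _) ≫ _ ≫ _ = _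
    simp
  obtain h1 | h1 := IsIdempotentElem.eq_zero_or_one_of_isLocalRing hi
  · refine (hY ?_).elim
    have := r.i ≫= h1 =≫ r.r
    rw [IsZero.iff_id_eq_zero]
    simpa using this
  · exact ⟨⟨r.i, r.r, r.retract, h1⟩⟩

lemma not_isZero_of_isLocalRing {X : 𝒳} (h : IsLocalRing (End X)) : ¬ IsZero X := fun h0 =>
  one_ne_zero (α := End X) (h0.eq_of_src _ _)

lemma isLocalRing_end_of_iso {X Y : 𝒳} (e : X ≅ Y) (h : IsLocalRing (End X)) :
    IsLocalRing (End Y) := by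
  have : Nontrivial (End Y) := ⟨⟨1, 0, fun h0 => not_isZero_of_isLocalRing h
    (((IsZero.iff_id_eq_zero Y).2 h0).of_iso e)⟩⟩
  refine ⟨fun {a b} hab => ?_⟩
  have key : ∀ a : End Y, IsUnit (M := End X) (e.hom ≫ a ≫ e.inv) → IsUnit a := by
    intro a ha
    rw [isUnit_iff_isIso] at ha ⊢
    have : a = e.inv ≫ (e.hom ≫ a ≫ e.inv) ≫ e.hom := by simp
    rw [this]
    infer_instance
  refine (h.isUnit_or_isUnit_of_add_one (a := e.hom ≫ a ≫ e.inv) (b := e.hom ≫ b ≫ e.inv) ?_).imp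
    (key a) (key b)
  have h1 : a + b = 𝟙 Y := hab
  rw [← Preadditive.comp_add, ← Preadditive.add_comp, h1]
  simp

/-- A local retract of a direct sum is a retract of one of the summands. -/
lemma SumDecomp.exists_retract {J : Type} [Fintype J] {f : J → 𝒳} {X Y : 𝒳} (d : SumDecomp f X)
    (hY : IsLocalRing (End Y)) (r : Retract Y X) : ∃ j, Nonempty (Retract Y (f j)) := by
  have h1 : (1 : End Y) = ∑ j, (r.i ≫ d.π j) ≫ d.ι j ≫ r.r := by
    change 𝟙 Y = _
    rw [← r.retract]
    conv_lhs => rw [d.eq_comp_id r.i]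
    simp [Preadditive.sum_comp]
  obtain ⟨j, -, hj⟩ := exists_isUnit_of_isUnit_sum (R := End Y) Finset.univ
    (fun j => (r.i ≫ d.π j) ≫ d.ι j ≫ r.r) (h1 ▸ isUnit_one)
  have : IsIso ((r.i ≫ d.π j) ≫ d.ι j ≫ r.r) := (isUnit_iff_isIso _).1 hj
  exact ⟨j, ⟨⟨r.i ≫ d.π j, d.ι j ≫ r.r ≫ inv ((r.i ≫ d.π j) ≫ d.ι j ≫ r.r), by
    have := IsIso.hom_inv_id ((r.i ≫ d.π j) ≫ d.ι j ≫ r.r)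
    simpa only [Category.assoc] using this⟩⟩⟩

lemma IsSumOf.exists_retract {Q : ObjectProperty 𝒳} {X Y : 𝒳} (h : IsSumOf Q X)
    (hY : IsLocalRing (End Y)) (r : Retract Y X) : ∃ Z, Q Z ∧ Nonempty (Retract Y Z) := by
  obtain ⟨m, f, hf, ⟨d⟩⟩ := h.exists_sumDecomp
  obtain ⟨j, hj⟩ := d.exists_retract hY r
  exact ⟨f j, hf j, hj⟩

end Retracts

/-! ### Hom-finite categories -/

section HomFinite

variable (k : Type u) [Field k] {𝒳 : Type u} [SmallCategory 𝒳] [Preadditive 𝒳] [Linear k 𝒳]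

/-- In a hom-finite category with split idempotents, indecomposable objects have local endomorphism
rings. -/
lemma IsIndec.isLocalRing [IsIdempotentComplete 𝒳] (hfin : ∀ X Y : 𝒳, FiniteDimensional k (X ⟶ Y))
    {X : 𝒳} (h : IsIndec X) : IsLocalRing (End X) := by
  have : FiniteDimensional k (End X) := hfin X X
  have : Nontrivial (End X) := ⟨⟨1, 0, fun h0 => h.1 ((IsZero.iff_id_eq_zero X).2 h0)⟩⟩
  refine isLocalRing_of_idempotents k fun e he => ?_
  obtain ⟨Y, i, q, h1, h2⟩ := IsIdempotentComplete.idempotents_split X e he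
  let r : Retract Y X := ⟨i, q, h1⟩
  obtain ⟨Z, s, hs⟩ := exists_compl r
  obtain h0 | h0 := h.2 Y Z _ ⟨complBiconeIsBilimit r s hs⟩ ⟨Iso.refl _⟩
  · left
    rw [← h2, h0.eq_of_src i 0, comp_zero]
  · right
    rw [h0.eq_of_src s.i 0, comp_zero, add_zero] at hs
    rw [← h2]; exact hs

/-- Existence of Krull-Schmidt decompositions. -/
lemma isSumOf_isIndec (hfin : ∀ X Y : 𝒳, FiniteDimensional k (X ⟶ Y)) (X : 𝒳) :
    IsSumOf (IsIndec (𝒳 := 𝒳)) X := by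
  induction h : Module.finrank k (X ⟶ X) using Nat.strong_induction_on generalizing X with
  | _ N ih =>
  by_cases h0 : IsZero X
  · exact IsSumOf.of_zero h0
  by_cases hX : IsIndec X
  · exact IsSumOf.of_mem hX
  simp only [IsIndec, not_and, not_forall, not_or] at hX
  obtain ⟨Y, Z, b, ⟨hb⟩, ⟨e⟩, hY, hZ⟩ := hX h0
  have hpos : ∀ W : 𝒳, ¬ IsZero W → 0 < Module.finrank k (W ⟶ W) := fun W hW =>
    Module.finrank_pos_iff_exists_ne_zero.2 ⟨𝟙 W, fun h => hW ((IsZero.iff_id_eq_zero W).2 h)⟩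
  have hle : Module.finrank k (Y ⟶ Y) + Module.finrank k (Z ⟶ Z) ≤ Module.finrank k (X ⟶ X) := by
    rw [← Module.finrank_prod]
    let φ : ((Y ⟶ Y) × (Z ⟶ Z)) →ₗ[k] (X ⟶ X) :=
      { toFun := fun g => e.inv ≫ (b.fst ≫ g.1 ≫ b.inl + b.snd ≫ g.2 ≫ b.inr) ≫ e.hom
        map_add' := fun g g' => by simp; abel
        map_smul' := fun r g => by simp }
    refine LinearMap.finrank_le_finrank_of_injective (f := φ) fun g g' hg => ?_
    have h1 : e.inv ≫ (b.fst ≫ g.1 ≫ b.inl + b.snd ≫ g.2 ≫ b.inr) ≫ e.hom =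
      e.inv ≫ (b.fst ≫ g'.1 ≫ b.inl + b.snd ≫ g'.2 ≫ b.inr) ≫ e.hom := hg
    have h2 := b.inl ≫= e.hom ≫= ((h1 =≫ e.inv) =≫ b.fst)
    have h3 := b.inr ≫= e.hom ≫= ((h1 =≫ e.inv) =≫ b.snd)
    exact Prod.ext (by simpa using h2) (by simpa using h3)
  have := hpos Y hY
  have := hpos Z hZ
  exact isSumOf_of_binaryBicone b hb e (ih _ (by omega) Y rfl) (ih _ (by omega) Z rfl)

variable {k}

/-- If `U` and `V` become isomorphic modulo an ideal `I` and no nonzero idempotent endomorphism of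
`V` lies in `I`, then `U` is the direct sum of `V` and an object which vanishes modulo `I`. -/
lemma exists_split_of_iso_mod [IsIdempotentComplete 𝒳]
    (hfin : ∀ X Y : 𝒳, FiniteDimensional k (X ⟶ Y)) (I : LinIdeal k 𝒳) {U V : 𝒳}
    (hV : ∀ p : V ⟶ V, p ≫ p = p → p ∈ I.hom V V → p = 0) (f : U ⟶ V) (g : V ⟶ U)
    (hgf : g ≫ f - 𝟙 V ∈ I.hom V V) (hfg : f ≫ g - 𝟙 U ∈ I.hom U U) :
    ∃ (r : Retract V U) (B : 𝒳) (s : Retract B U),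
      r.r ≫ r.i + s.r ≫ s.i = 𝟙 U ∧ 𝟙 B ∈ I.hom B B := by
  have : FiniteDimensional k (End V) := hfin V V
  -- `x` lies in `I`, and so does its Fitting idempotent, which is therefore zero
  let x : End V := 𝟙 V - g ≫ f
  have hx : IsNilpotent x := by
    obtain ⟨m, e, y, hm, he, hxy, hxm⟩ := exists_fitting_idempotent k x
    have hxI : (x : V ⟶ V) ∈ I.hom V V := by
      have := Submodule.neg_mem _ hgf
      rwa [neg_sub] at this
    obtain ⟨m, rfl⟩ := Nat.exists_eq_succ_of_ne_zero hm.ne'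
    have h0 : e = 0 := by
      refine hV e he ?_
      rw [hxy, pow_succ', mul_assoc]
      exact I.comp_left _ hxI
    exact ⟨m + 1, by rw [← hxm, h0, mul_zero]⟩
  have hu : IsUnit (M := End V) (g ≫ f) := by
    have h1 : (1 : End V) - x = (g ≫ f : V ⟶ V) := by
      change 𝟙 V - (𝟙 V - g ≫ f) = g ≫ f
      simp
    have h2 := hx.isUnit_one_sub
    rwa [h1] at h2
  have : IsIso (g ≫ f) := (isUnit_iff_isIso _).1 hu
  let r : Retract V U := ⟨g, f ≫ inv (g ≫ f), by
    have := IsIso.hom_inv_id (g ≫ f); simpa only [Category.assoc] using this⟩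
  obtain ⟨B, s, hs⟩ := exists_compl r
  refine ⟨r, B, s, hs, ?_⟩
  have h1 : s.i ≫ f = 0 := by
    have h2 : s.i ≫ r.r = 0 := (complBicone r s hs).inr_fst
    have h3 := h2 =≫ (g ≫ f)
    simpa [r] using h3
  have h2 := I.comp_left s.i (I.comp_right s.r hfg)
  rw [Preadditive.sub_comp, Preadditive.comp_sub, Category.assoc, reassoc_of% h1] at h2
  simpa using Submodule.neg_mem _ h2

end HomFinite

/-! ### The projective objects attached to idempotents -/

section ProjObj

open ModuleCat

variable {k : Type u} [Field k] {A : Type u} [Ring A] [Algebra k A] [Module.Finite k A]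
  {C : Type u} [SmallCategory C] [Preadditive C] [Linear k C]
  (ι : C ⥤ FGModuleCat.{u} A) [ι.IsEquivalence] [ι.Additive] [ι.Linear k]

/-- The object of `C` corresponding to the module `Ae`. -/
noncomputable def projObj (e : A) : C := ι.inv.obj (FGModuleCat.of A ↥(Ideal.span {e}))

variable {ι}

variable (ι) in
/-- The counit `ι (ι⁻¹ M) ≅ M`. -/
noncomputable def counitAt (M : FGModuleCat.{u} A) : ι.obj (ι.inv.obj M) ≅ M :=
  ι.asEquivalence.counitIso.app M

variable (ι) in
/-- The unit `ι⁻¹ (ι X) ≅ X`. -/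
noncomputable def unitAt (X : C) : ι.inv.obj (ι.obj X) ≅ X :=
  (ι.asEquivalence.unitIso.app X).symm

lemma counitAt_inv_naturality {M N : FGModuleCat.{u} A} (g : M ⟶ N) :
    (counitAt ι M).inv ≫ ι.map (ι.inv.map g) = g ≫ (counitAt ι N).inv :=
  (ι.asEquivalence.counitIso.inv.naturality g).symm

lemma counitAt_inv_naturality_assoc {M N : FGModuleCat.{u} A} (g : M ⟶ N) {Z : FGModuleCat.{u} A}
    (h : ι.obj (ι.inv.obj N) ⟶ Z) :
    (counitAt ι M).inv ≫ ι.map (ι.inv.map g) ≫ h = g ≫ (counitAt ι N).inv ≫ h := by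
  rw [← Category.assoc, counitAt_inv_naturality, Category.assoc]

lemma counitAt_inv_map_unitAt_hom (X : C) :
    (counitAt ι (ι.obj X)).inv ≫ ι.map (unitAt ι X).hom = 𝟙 _ :=
  ι.asEquivalence.counitInv_functor_comp X

/-- The homomorphism `M → ι X` adjoint to `ι⁻¹ M → X`. -/
noncomputable def toMod {M : FGModuleCat.{u} A} {X : C} (v : ι.inv.obj M ⟶ X) :
    M.obj →ₗ[A] (ι.obj X).obj :=
  ((counitAt ι M).inv ≫ ι.map v).hom.hom

/-- The morphism `ι⁻¹ M → X` adjoint to `M → ι X`. -/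
noncomputable def ofMod {M : FGModuleCat.{u} A} {X : C} (g : M.obj →ₗ[A] (ι.obj X).obj) :
    ι.inv.obj M ⟶ X :=
  ι.inv.map (ObjectProperty.homMk (ModuleCat.ofHom g)) ≫ (unitAt ι X).hom

lemma toMod_ofMod {M : FGModuleCat.{u} A} {X : C} (g : M.obj →ₗ[A] (ι.obj X).obj) :
    toMod (ofMod g) = g := by
  have : (counitAt ι M).inv ≫ ι.map (ofMod g) = ObjectProperty.homMk (ModuleCat.ofHom g) := by
    rw [ofMod, ι.map_comp, counitAt_inv_naturality_assoc, counitAt_inv_map_unitAt_hom,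
      Category.comp_id]
  exact congrArg (fun φ : M ⟶ ι.obj X => φ.hom.hom) this

lemma toMod_injective {M : FGModuleCat.{u} A} {X : C} :
    Function.Injective (toMod (ι := ι) (M := M) (X := X)) := by
  intro v w h
  have h1 : (counitAt ι M).inv ≫ ι.map v = (counitAt ι M).inv ≫ ι.map w := by
    ext : 1
    exact h
  exact ι.map_injective ((cancel_epi _).1 h1)

lemma toMod_comp {M : FGModuleCat.{u} A} {X Y : C} (v : ι.inv.obj M ⟶ X) (g : X ⟶ Y) (m : M.obj) :
    toMod (v ≫ g) m = (ι.map g).hom.hom (toMod v m) := by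
  simp [toMod]

lemma toMod_add {M : FGModuleCat.{u} A} {X : C} (v w : ι.inv.obj M ⟶ X) :
    toMod (v + w) = toMod v + toMod w := by
  rw [toMod, ι.map_add, Preadditive.comp_add]
  rfl

lemma toMod_smul {M : FGModuleCat.{u} A} {X : C} (r : k) (v : ι.inv.obj M ⟶ X) (m : M.obj) :
    toMod (r • v) m = algebraMap k A r • toMod v m := by
  simp only [toMod, Functor.map_smul, Linear.comp_smul]
  rfl

lemma toMod_map {M N : FGModuleCat.{u} A} {X : C} (g : M ⟶ N) (v : ι.inv.obj N ⟶ X) (m : M.obj) :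
    toMod (ι.inv.map g ≫ v) m = toMod v (g.hom.hom m) := by
  rw [toMod, ι.map_comp, counitAt_inv_naturality_assoc]
  rfl

/-- The generator of `Ae`. -/
def spanGen (e : A) : ↥(Ideal.span {e}) := ⟨e, Ideal.mem_span_singleton_self e⟩

lemma exists_smul_spanGen {e : A} (a : ↥(Ideal.span {e})) : ∃ b : A, a = b • spanGen e := by
  obtain ⟨b, hb⟩ := Ideal.mem_span_singleton'.1 a.2
  exact ⟨b, Subtype.ext hb.symm⟩

lemma smul_spanGen {e : A} (he : IsIdempotentElem e) (a : ↥(Ideal.span {e})) :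
    a.1 • spanGen e = a := by
  obtain ⟨b, rfl⟩ := exists_smul_spanGen a
  apply Subtype.ext
  change (b * e) * e = b * e
  rw [mul_assoc, he.eq]

/-- The element of `e (ι X)` corresponding to a morphism from the object attached to `e`. -/
noncomputable def elem {e : A} {X : C} (v : projObj ι e ⟶ X) : (ι.obj X).obj :=
  toMod v (spanGen e)

lemma elem_comp {e : A} {X Y : C} (v : projObj ι e ⟶ X) (g : X ⟶ Y) :
    elem (v ≫ g) = (ι.map g).hom.hom (elem v) := toMod_comp _ _ _

lemma elem_add {e : A} {X : C} (v w : projObj ι e ⟶ X) : elem (v + w) = elem v + elem w := by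
  exact congrArg (fun φ : _ →ₗ[A] _ => φ (spanGen e)) (toMod_add v w)

lemma elem_zero {e : A} {X : C} : elem (0 : projObj ι e ⟶ X) = 0 := by
  have := elem_add (ι := ι) (0 : projObj ι e ⟶ X) 0
  rwa [add_zero, left_eq_add] at this

lemma elem_smul {e : A} {X : C} (r : k) (v : projObj ι e ⟶ X) :
    elem (r • v) = algebraMap k A r • elem v := toMod_smul _ _ _

lemma smul_elem {e : A} (he : IsIdempotentElem e) {X : C} (v : projObj ι e ⟶ X) :
    e • elem v = elem v := by
  rw [elem, ← map_smul, show e • spanGen e = spanGen e from Subtype.ext he.eq]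

lemma toMod_eq {e : A} (he : IsIdempotentElem e) {X : C} (v : projObj ι e ⟶ X)
    (a : ↥(Ideal.span {e})) : toMod v a = a.1 • elem v := by
  rw [elem, ← map_smul, smul_spanGen he]

lemma elem_injective {e : A} {X : C} : Function.Injective (elem (ι := ι) (e := e) (X := X)) := by
  intro v w h
  apply toMod_injective
  ext a
  obtain ⟨b, rfl⟩ := exists_smul_spanGen a
  rw [map_smul, map_smul]
  exact congrArg _ h

/-- The morphism from the object attached to `e` corresponding to an element `x` of `ι X`. -/
noncomputable def ofElem (e : A) {X : C} (x : (ι.obj X).obj) : projObj ι e ⟶ X :=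
  ofMod (M := FGModuleCat.of A ↥(Ideal.span {e}))
    ((LinearMap.toSpanSingleton A _ x) ∘ₗ (Ideal.span {e}).subtype)

lemma elem_ofElem {e : A} {X : C} {x : (ι.obj X).obj} : elem (ofElem e x) = e • x := by
  rw [elem, ofElem]
  erw [toMod_ofMod]
  rfl

lemma ofElem_elem {e : A} (he : IsIdempotentElem e) {X : C} (v : projObj ι e ⟶ X) :
    ofElem e (elem v) = v := elem_injective (by rw [elem_ofElem, smul_elem he])

lemma elem_mem {e : A} (he : IsIdempotentElem e) {X : C} (v : projObj ι e ⟶ X) :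
    elem v ∈ idemPart k e (ι.obj X).obj := ⟨elem v, smul_elem he v⟩

variable (k ι) in
/-- Morphisms from the object attached to `e` to `X` are the elements of `e (ι X)`. -/
noncomputable def elemHom {e : A} (he : IsIdempotentElem e) (X : C) :
    (projObj ι e ⟶ X) →ₗ[k] idemPart k e (ι.obj X).obj where
  toFun v := ⟨elem v, elem_mem he v⟩
  map_add' v w := Subtype.ext (elem_add v w)
  map_smul' r v := Subtype.ext (elem_smul r v)

variable (k ι) in
/-- The inverse of `elemHom`, which does not require `e` to be idempotent: `x` and `e • x` give the
same morphism. -/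
noncomputable def ofElemHom (e : A) (X : C) :
    idemPart k e (ι.obj X).obj →ₗ[k] (projObj ι e ⟶ X) where
  toFun x := ofElem e x.1
  map_add' x y := elem_injective (by simp [elem_add, elem_ofElem])
  map_smul' r x := elem_injective (by
    rw [elem_smul, elem_ofElem, elem_ofElem]
    change e • algebraMap k A r • x.1 = _
    rw [smul_smul, smul_smul, Algebra.commutes]
    rfl)

end ProjObj

/-! ### Functors given by copowers -/

/-- `F` is the functor `X ↦ P ⊗ Hom(R, X)`, expressed by the universal property of the copower: the
morphisms `ins v : P ⟶ F X`, for `v : R ⟶ X`, form a universal linear family. -/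
structure Copower (k : Type*) [Field k] {C : Type*} [Category C] [Preadditive C] [Linear k C]
    (P R : C) (F : C ⥤ C) where
  ins : ∀ X, (R ⟶ X) →ₗ[k] (P ⟶ F.obj X)
  ins_map : ∀ {X Y : C} (v : R ⟶ X) (g : X ⟶ Y), ins X v ≫ F.map g = ins Y (v ≫ g)
  desc : ∀ {X Z : C}, ((R ⟶ X) →ₗ[k] (P ⟶ Z)) → (F.obj X ⟶ Z)
  ins_desc : ∀ {X Z : C} (θ : (R ⟶ X) →ₗ[k] (P ⟶ Z)) (v : R ⟶ X), ins X v ≫ desc θ = θ v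
  hom_ext : ∀ {X Z : C} {f g : F.obj X ⟶ Z}, (∀ v, ins X v ≫ f = ins X v ≫ g) → f = g

section

open ModuleCat

variable (k : Type u) [Field k] {A : Type u} [Ring A] [Algebra k A] [Module.Finite k A]
  {C : Type u} [SmallCategory C] [Preadditive C] [Linear k C]
  (ι : C ⥤ FGModuleCat.{u} A) [ι.IsEquivalence] [ι.Additive] [ι.Linear k]

open TensorProduct

/-- The homomorphisms `a ↦ a ⊗ x` from `Ae` to `Ae ⊗ f M`. -/
noncomputable def tmulHom (e f : A) (M : FGModuleCat.{u} A) : idemPart k f M.obj →ₗ[k]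
    (FGModuleCat.of A ↥(Ideal.span {e}) ⟶ FGModuleCat.of A (tensMod k e f M.obj)) where
  toFun x := FGModuleCat.ofHom ((TensorProduct.AlgebraTensorModule.mk k A _ _).flip x)
  map_add' x y := by
    ext a
    exact TensorProduct.tmul_add _ _ _
  map_smul' r x := by
    ext a
    change a ⊗ₜ[k] (r • x) = algebraMap k A r • (a ⊗ₜ[k] x)
    rw [TensorProduct.tmul_smul, algebraMap_smul]

/-- The insertions for the functor `X ↦ ι⁻¹ (Ae ⊗ f (ι X))`. -/
noncomputable def insHom {e f : A} (hf : IsIdempotentElem f) (X : C) : (projObj ι f ⟶ X) →ₗ[k]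
    (projObj ι e ⟶ ι.inv.obj (FGModuleCat.of A (tensMod k e f (ι.obj X).obj))) :=
  ι.inv.mapLinearMap k ∘ₗ tmulHom k e f (ι.obj X) ∘ₗ elemHom k ι hf X

lemma toMod_insHom {e f : A} (hf : IsIdempotentElem f) {X Z : C} (v : projObj ι f ⟶ X)
    (g : ι.inv.obj (FGModuleCat.of A (tensMod k e f (ι.obj X).obj)) ⟶ Z)
    (a : ↥(Ideal.span {e})) :
    toMod (M := FGModuleCat.of A ↥(Ideal.span {e})) (insHom k ι hf X v ≫ g) a =
      toMod g (a ⊗ₜ[k] elemHom k ι hf X v) :=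
  toMod_map _ _ _

/-- The homomorphism `Ae ⊗ f (ι X) → ι Z` given by a linear family of morphisms. -/
noncomputable def descHom {e f : A} {X Z : C}
    (θ : (projObj ι f ⟶ X) →ₗ[k] (projObj ι e ⟶ Z)) :
    tensMod k e f (ι.obj X).obj →ₗ[A] (ι.obj Z).obj :=
  TensorProduct.AlgebraTensorModule.lift
    { toFun := fun a =>
        { toFun := fun x => toMod (θ (ofElemHom k ι f X x)) a
          map_add' := fun x y => by
            rw [map_add, map_add]
            exact LinearMap.congr_fun (toMod_add (M := FGModuleCat.of A ↥(Ideal.span {e})) _ _) a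
          map_smul' := fun r x => by
            rw [map_smul, map_smul]
            exact toMod_smul _ _ _ }
      map_add' := fun a b => LinearMap.ext fun x =>
        map_add (toMod (θ (ofElemHom k ι f X x))) a b
      map_smul' := fun r b => LinearMap.ext fun x =>
        map_smul (toMod (θ (ofElemHom k ι f X x))) r b }

/-- The functor of tensoring with `Ae ⊗ fA` is the copower functor `X ↦ Ae ⊗ Hom(Af, X)`. -/
noncomputable def projFunCopower (e : A) {f : A} (hf : IsIdempotentElem f) :
    Copower k (projObj ι e) (projObj ι f) (projFun k ι e f) where
  ins X := insHom k ι hf X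
  ins_map {X Y} v g := by
    refine (ι.inv.map_comp _ _).symm.trans ?_
    change _ = ι.inv.map _
    congr 1
    ext a
    change a ⊗ₜ[k] _ = a ⊗ₜ[k] _
    congr 1
    exact Subtype.ext (elem_comp v g).symm
  desc {X Z} θ := ofMod (M := FGModuleCat.of A (tensMod k e f (ι.obj X).obj)) (descHom k ι θ)
  ins_desc {X Z} θ v := by
    apply toMod_injective
    refine LinearMap.ext fun a => ?_
    refine (toMod_insHom k ι hf v _ a).trans ?_
    rw [toMod_ofMod]
    change toMod (θ (ofElem f (elem v))) a = toMod (θ v) a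
    rw [ofElem_elem hf]
  hom_ext {X Z} g h hgh := by
    apply toMod_injective (M := FGModuleCat.of A (tensMod k e f (ι.obj X).obj))
    apply TensorProduct.AlgebraTensorModule.ext
    intro a x
    have h1 := congrArg (fun φ => toMod (M := FGModuleCat.of A ↥(Ideal.span {e})) φ a)
      (hgh (ofElemHom k ι f X x))
    have h2 : elemHom k ι hf X (ofElemHom k ι f X x) = x := by
      apply Subtype.ext
      change elem (ofElem f x.1) = x.1
      rw [elem_ofElem]
      obtain ⟨x, y, rfl⟩ := x
      change f • f • y = f • y
      rw [smul_smul, hf.eq]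
    have h3 := (toMod_insHom k ι hf (ofElemHom k ι f X x) g a).symm.trans
      (h1.trans (toMod_insHom k ι hf (ofElemHom k ι f X x) h a))
    rwa [h2] at h3

end

/-! ### Semisimple rings without central idempotents -/

section Semisimple

variable {A : Type u} [Ring A]

/-- A left ideal of a semisimple ring has a right unit: the component of `1` in the ideal, with
respect to a complement. -/
lemma exists_right_unit_of_isSemisimpleRing [IsSemisimpleRing A] (I : Ideal A) :
    ∃ f ∈ I, ∀ x ∈ I, x * f = x := by
  obtain ⟨J, hJ⟩ := exists_isCompl I
  obtain ⟨a, ha, b, hb, hab⟩ : ∃ a ∈ I, ∃ b ∈ J, a + b = 1 := by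
    have : (1 : A) ∈ I ⊔ J := by rw [hJ.sup_eq_top]; trivial
    exact Submodule.mem_sup.1 this
  refine ⟨a, ha, fun x hx => ?_⟩
  have h1 : x * b ∈ I ⊓ J := by
    refine ⟨?_, J.mul_mem_left x hb⟩
    rw [show b = 1 - a from eq_sub_of_add_eq' hab, mul_sub, mul_one]
    exact I.sub_mem hx (I.mul_mem_left x ha)
  rw [hJ.inf_eq_bot, Submodule.mem_bot] at h1
  have h2 : x * (a + b) = x := by rw [hab, mul_one]
  rwa [mul_add, h1, add_zero] at h2

/-- A semisimple ring without nontrivial central idempotents is simple: the right unit of a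
two-sided ideal is a central idempotent. -/
lemma IsConnectedAlg.isSimpleRing [IsSemisimpleRing A] (h : IsConnectedAlg A) :
    IsSimpleRing A := by
  refine isSimpleRing_iff_isTwoSided_imp.2 ⟨h.1, fun I hI => ?_⟩
  obtain ⟨f, hf, hIf⟩ := exists_right_unit_of_isSemisimpleRing I
  have h1 : ∀ x, f * x * f = f * x := fun x => hIf _ (I.mul_mem_right x hf)
  -- the ring is semiprime
  have hzero : ∀ y : A, (∀ x, y * x * y = 0) → y = 0 := by
    intro y hy
    obtain ⟨g, hg, hyg⟩ := exists_right_unit_of_isSemisimpleRing (Ideal.span {y})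
    obtain ⟨r, rfl⟩ := Ideal.mem_span_singleton'.1 hg
    rw [← hyg y (Ideal.mem_span_singleton_self y), ← mul_assoc, hy]
  have h2 : ∀ x, f * x = x * f := by
    intro x
    have h3 : x * f - f * x * f = 0 := by
      refine hzero _ fun r => ?_
      have : (x * f - f * x * f) * r * (x * f - f * x * f) =
          x * (f * r * x * f) - x * (f * r * f * x * f) - f * x * (f * r * x * f)
            + f * x * (f * r * f * x * f) := by noncomm_ring
      rw [this, h1 r]
      abel
    rw [← h1, ← sub_eq_zero.1 h3]
  obtain rfl | rfl := h.2 f (hIf f hf) h2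
  · left
    rw [eq_bot_iff]
    intro x hx
    rw [← hIf x hx, mul_zero]
    exact zero_mem _
  · right
    exact (Ideal.eq_top_iff_one I).2 hf

end Semisimple

/-! ### The category of finite dimensional modules -/

section ModCat

open ModuleCat

variable (k : Type u) [Field k] {A : Type u} [Ring A] [Algebra k A] [Module.Finite k A]
  {C : Type u} [SmallCategory C] [Preadditive C] [Linear k C]
  (ι : C ⥤ FGModuleCat.{u} A) [ι.IsEquivalence] [ι.Additive] [ι.Linear k]

lemma isNoetherianRing_of_finite (k : Type u) [Field k] (A : Type u) [Ring A] [Algebra k A]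
    [Module.Finite k A] : IsNoetherianRing A :=
  isNoetherian_of_tower k inferInstance

lemma hasFiniteBiproducts_of_mod (k : Type u) [Field k] [Algebra k A] [Module.Finite k A]
    (ι : C ⥤ FGModuleCat.{u} A) [ι.IsEquivalence] : HasFiniteBiproducts C := by
  have := isNoetherianRing_of_finite k A
  have : HasFiniteProducts C :=
    ⟨fun _ => Adjunction.hasLimitsOfShape_of_equivalence ι⟩
  exact HasFiniteBiproducts.of_hasFiniteProducts

lemma hasCokernels_of_mod (k : Type u) [Field k] [Algebra k A] [Module.Finite k A]
    (ι : C ⥤ FGModuleCat.{u} A) [ι.IsEquivalence] : HasCokernels C := by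
  have := isNoetherianRing_of_finite k A
  have : HasColimitsOfShape WalkingParallelPair C :=
    Adjunction.hasColimitsOfShape_of_equivalence ι
  exact ⟨fun _ => inferInstance⟩

lemma isIdempotentComplete_of_mod (k : Type u) [Field k] [Algebra k A] [Module.Finite k A]
    (ι : C ⥤ FGModuleCat.{u} A) [ι.IsEquivalence] : IsIdempotentComplete C := by
  have := isNoetherianRing_of_finite k A
  exact (Idempotents.isIdempotentComplete_iff_of_equivalence ι.asEquivalence).2 inferInstance

lemma finiteDimensional_hom_of_mod (k : Type u) [Field k] [Algebra k A] [Module.Finite k A]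
    [Linear k C] (ι : C ⥤ FGModuleCat.{u} A) [ι.IsEquivalence] [ι.Additive] [ι.Linear k] (X Y : C) :
    FiniteDimensional k (X ⟶ Y) := by
  have : SMulCommClass A k (ι.obj Y).obj := ⟨fun a r y => by
    change a • algebraMap k A r • y = algebraMap k A r • a • y
    rw [smul_smul, smul_smul, Algebra.commutes]⟩
  let φ : (X ⟶ Y) →ₗ[k] ((ι.obj X).obj →ₗ[k] (ι.obj Y).obj) :=
    { toFun := fun f => (ι.map f).hom.hom.restrictScalars k
      map_add' := fun f g => by rw [ι.map_add]; rfl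
      map_smul' := fun r f => by rw [ι.map_smul]; rfl }
  refine FiniteDimensional.of_injective φ fun f g h => ι.map_injective ?_
  ext x
  exact LinearMap.congr_fun h x

variable {k ι}

lemma epi_iff_surjective_of_mod (k : Type u) [Field k] [Algebra k A] [Module.Finite k A] {X Y : C}
    (f : X ⟶ Y) : Epi f ↔ Function.Surjective (ι.map f).hom.hom := by
  have := isNoetherianRing_of_finite k A
  have h1 : Epi f ↔ Epi (ι.map f) := ⟨fun _ => inferInstance, fun _ => ι.epi_of_epi_map ‹_›⟩
  have h2 : Epi (ι.map f) ↔ Epi ((forget₂ (FGModuleCat.{u} A) (ModuleCat.{u} A)).map (ι.map f)) :=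
    ⟨fun _ => inferInstance, fun _ => Functor.epi_of_epi_map _ ‹_›⟩
  rw [h1, h2, ModuleCat.epi_iff_surjective]
  rfl

lemma projective_projObj (k : Type u) [Field k] [Algebra k A] [Module.Finite k A] {e : A}
    (he : IsIdempotentElem e) : Projective (projObj ι e) where
  factors {E X} f p hp := by
    obtain ⟨x, hx⟩ := (epi_iff_surjective_of_mod k (ι := ι) p).1 hp (elem f)
    refine ⟨ofElem e x, elem_injective ?_⟩
    rw [elem_comp, elem_ofElem, map_smul, hx, smul_elem he]

/-- Morphisms are determined by their compositions with morphisms from the projectives attached to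
the idempotents of a decomposition of the identity. -/
lemma hom_ext_projObj {n : ℕ} {e : Fin n → A} (he : IsPrimitiveDecomposition e) {X Y : C}
    {f g : X ⟶ Y} (h : ∀ (t : Fin n) (v : projObj ι (e t) ⟶ X), v ≫ f = v ≫ g) : f = g := by
  apply ι.map_injective
  ext x
  have h1 : x = ∑ t, e t • x := by rw [← Finset.sum_smul, he.1.complete, one_smul]
  rw [h1, map_sum, map_sum]
  refine Finset.sum_congr rfl fun t _ => ?_
  have h2 := congrArg elem (h t (ofElem (e t) x))
  rwa [elem_comp, elem_comp, elem_ofElem] at h2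

/-- A finite family of morphisms from the indecomposable projectives which is jointly epi. -/
lemma exists_cover {n : ℕ} {e : Fin n → A} (he : IsPrimitiveDecomposition e) (X : C) :
    ∃ (m : ℕ) (t : Fin m → Fin n) (v : ∀ j, projObj ι (e (t j)) ⟶ X),
      ∀ (Y : C) (f g : X ⟶ Y), (∀ j, v j ≫ f = v j ≫ g) → f = g := by
  obtain ⟨N, x, hx⟩ := Module.Finite.exists_fin (R := A) (M := (ι.obj X).obj)
  let E := (finProdFinEquiv (m := N) (n := n)).symm
  refine ⟨N * n, fun j => (E j).2, fun j => ofElem _ (x (E j).1), fun Y f g h => ?_⟩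
  apply ι.map_injective
  ext y
  have hy : y ∈ Submodule.span A (Set.range x) := by rw [hx]; trivial
  refine LinearMap.eqOn_span (f := (ι.map f).hom.hom) (g := (ι.map g).hom.hom) ?_ hy
  rintro _ ⟨i, rfl⟩
  have h1 : x i = ∑ t, e t • x i := by rw [← Finset.sum_smul, he.1.complete, one_smul]
  rw [h1, map_sum, map_sum]
  refine Finset.sum_congr rfl fun t _ => ?_
  have h2 := congrArg elem (h (E.symm (i, t)))
  simp only [elem_comp, elem_ofElem, Equiv.apply_symm_apply] at h2
  exact h2

/-- Projective objects are retracts of direct sums of the indecomposable projectives. -/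
lemma exists_retract_of_projective {n : ℕ} {e : Fin n → A} (he : IsPrimitiveDecomposition e)
    (k : Type u) [Field k] [Algebra k A] [Module.Finite k A] (X : C) [Projective X] :
    ∃ W : C, IsSumOf (fun Z => ∃ t, Z = projObj ι (e t)) W ∧ Nonempty (Retract X W) := by
  have := hasFiniteBiproducts_of_mod k ι
  obtain ⟨m, t, v, hv⟩ := exists_cover (ι := ι) he X
  let p : (⨁ fun j => projObj ι (e (t j))) ⟶ X := biproduct.desc v
  have hp : Epi p := ⟨fun f g h => hv _ _ _ fun j => by
    have := biproduct.ι (fun j => projObj ι (e (t j))) j ≫= h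
    simpa [p] using this⟩
  refine ⟨_, ⟨m, _, biproduct.bicone _, fun j => ⟨t j, rfl⟩, ⟨biproduct.isBilimit _⟩,
    ⟨Iso.refl _⟩⟩, ⟨⟨Projective.factorThru (𝟙 X) p, p, by simp⟩⟩⟩

variable (ι) in
/-- The identification of the module of the object attached to `e` with `Ae`. -/
noncomputable def projEquiv (e : A) : (ι.obj (projObj ι e)).obj ≃ₗ[A] ↥(Ideal.span {e}) :=
  FGModuleCat.isoToLinearEquiv (counitAt ι (FGModuleCat.of A ↥(Ideal.span {e})))

lemma toMod_projObj {e : A} {X : C} (g : projObj ι e ⟶ X) (a : ↥(Ideal.span {e})) :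
    toMod g a = (ι.map g).hom.hom ((projEquiv ι e).symm a) := rfl

/-- The element of `fAe` giving a morphism between the projectives attached to `f` and `e`. -/
noncomputable def val {f e : A} (g : projObj ι f ⟶ projObj ι e) : A :=
  (projEquiv ι e (elem g)).1

lemma val_comp {f e h : A} (he : IsIdempotentElem e) (g : projObj ι f ⟶ projObj ι e)
    (g' : projObj ι e ⟶ projObj ι h) : val (g ≫ g') = val g * val g' := by
  have h2 : elem (g ≫ g') = (projEquiv ι e (elem g)).1 • elem g' := by
    rw [elem_comp, ← toMod_eq he, toMod_projObj, LinearEquiv.symm_apply_apply]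
  rw [val, h2, map_smul]
  rfl

lemma val_injective {f e : A} {g g' : projObj ι f ⟶ projObj ι e} (h : val g = val g') :
    g = g' :=
  elem_injective ((projEquiv ι e).injective (Subtype.ext h))

lemma val_add {f e : A} (g g' : projObj ι f ⟶ projObj ι e) : val (g + g') = val g + val g' := by
  rw [val, elem_add, map_add]
  rfl

lemma val_zero {f e : A} : val (0 : projObj ι f ⟶ projObj ι e) = 0 := by
  have := val_add (0 : projObj ι f ⟶ projObj ι e) 0
  simpa using this

lemma mul_val {f e : A} (hf : IsIdempotentElem f) (g : projObj ι f ⟶ projObj ι e) :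
    f * val g = val g := by
  rw [val, ← smul_eq_mul, ← Submodule.coe_smul, ← map_smul, smul_elem hf]

/-- The morphism given by an element. -/
lemma exists_val {f e : A} (a : A) :
    ∃ g : projObj ι f ⟶ projObj ι e, val g = f * a * e := by
  refine ⟨ofElem f ((projEquiv ι e).symm (a • spanGen e)), ?_⟩
  rw [val, elem_ofElem, map_smul, LinearEquiv.apply_symm_apply]
  change f * (a * e) = _
  rw [mul_assoc]

lemma val_id {e : A} (he : IsIdempotentElem e) : val (𝟙 (projObj ι e)) = e := by
  obtain ⟨g, hg⟩ := exists_val (ι := ι) (f := e) (e := e) 1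
  rw [mul_one, he.eq] at hg
  have h1 := val_comp he (𝟙 _) g
  rw [Category.id_comp, hg] at h1
  obtain ⟨b, hb⟩ := Ideal.mem_span_singleton'.1
    (projEquiv ι e (elem (𝟙 (projObj ι e)))).2
  have hb' : b * e = val (𝟙 (projObj ι e)) := hb
  rw [← hb', mul_assoc, he.eq] at h1
  rw [← hb', ← h1]

lemma isLocalRing_end_projObj (k : Type u) [Field k] [Algebra k A] [Module.Finite k A]
    [Linear k C] (ι : C ⥤ FGModuleCat.{u} A) [ι.IsEquivalence] [ι.Additive] [ι.Linear k] {e : A}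
    (he : IsPrimitiveIdem e) : IsLocalRing (End (projObj ι e)) := by
  have : FiniteDimensional k (End (projObj ι e)) := finiteDimensional_hom_of_mod k ι _ _
  have hid := val_id (ι := ι) he.1
  have : Nontrivial (End (projObj ι e)) := ⟨⟨1, 0, fun h => he.2.1 (by
    rw [← hid]
    exact (congrArg val h).trans val_zero)⟩⟩
  refine isLocalRing_of_idempotents k fun p hp => ?_
  have h1 : val p * val p = val p := by
    rw [← val_comp he.1]
    exact congrArg val hp
  have h2 : e * val p = val p := mul_val he.1 _
  have h3 : val p * e = val p := by
    have := val_comp he.1 p (𝟙 (projObj ι e))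
    rwa [Category.comp_id, hid, eq_comm] at this
  obtain h4 | h4 := he.2.2 (val p) (e - val p) h1
    (by simp [IsIdempotentElem, mul_sub, sub_mul, h1, h2, h3, he.1.eq])
    (by simp [mul_sub, h1, h3]) (by simp [sub_mul, h1, h2]) (by simp)
  · left
    exact val_injective (h4.trans val_zero.symm)
  · right
    refine val_injective ((sub_eq_zero.1 h4).symm.trans hid.symm)

end ModCat

/-! ### Endomorphism rings over an algebraically closed field -/

section LocalEnd

/-- A fully faithful functor reflects locality of endomorphism rings. -/
lemma isLocalRing_end_of_map {𝒳 𝒴 : Type*} [Category 𝒳] [Category 𝒴] [Preadditive 𝒳]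
    [Preadditive 𝒴] (Φ : 𝒳 ⥤ 𝒴) [Φ.Additive] [Φ.Full] [Φ.Faithful] {X : 𝒳}
    (h : IsLocalRing (End (Φ.obj X))) : IsLocalRing (End X) := by
  have : Nontrivial (End X) := ⟨⟨1, 0, fun h0 => one_ne_zero (α := End (Φ.obj X)) (by
    have := congrArg Φ.map h0
    rwa [End.one_def, Φ.map_id, Φ.map_zero] at this)⟩⟩
  refine ⟨fun {a b} hab => ?_⟩
  have key : ∀ a : End X, IsUnit (M := End (Φ.obj X)) (Φ.map a) → IsUnit a := by
    intro a ha
    rw [isUnit_iff_isIso] at ha ⊢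
    exact isIso_of_fully_faithful Φ a
  refine (h.isUnit_or_isUnit_of_add_one (a := Φ.map a) (b := Φ.map b) ?_).imp (key a) (key b)
  have h1 : a + b = 𝟙 X := hab
  rw [← Φ.map_add, h1, Φ.map_id]
  rfl

/-- Every element is the sum of an element of its spectrum and a nonunit. -/
lemma exists_eq_smul_add_of_isAlgClosed (k : Type*) [Field k] [IsAlgClosed k] {R : Type*} [Ring R]
    [Algebra k R] [FiniteDimensional k R] [IsLocalRing R] (x : R) :
    ∃ (c : k) (y : R), x = algebraMap k R c + y ∧ ¬ IsUnit y := by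
  obtain ⟨c, hc⟩ := spectrum.nonempty_of_isAlgClosed_of_finiteDimensional k x
  refine ⟨c, x - algebraMap k R c, by simp, fun h => hc ?_⟩
  have := h.neg
  rwa [neg_sub] at this

lemma not_isUnit_sum {R : Type*} [Ring R] [IsLocalRing R] {J : Type*} (s : Finset J)
    (f : J → R) (h : ∀ j ∈ s, ¬ IsUnit (f j)) : ¬ IsUnit (∑ j ∈ s, f j) := fun hs => by
  obtain ⟨j, hj, hj'⟩ := exists_isUnit_of_isUnit_sum s f hs
  exact h j hj hj'

end LocalEnd

section ModCat

open ModuleCat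

variable {k : Type u} [Field k] {A : Type u} [Ring A] [Algebra k A] [Module.Finite k A]
  {C : Type u} [SmallCategory C] [Preadditive C] [Linear k C]
  {ι : C ⥤ FGModuleCat.{u} A} [ι.IsEquivalence] [ι.Additive] [ι.Linear k]

/-- The object `L` is the quotient of `Ae` by the submodule generated by the radical of `eAe`, so that
`Hom(Ae, L)` is the residue field of the local ring `eAe`. -/
lemma exists_hom_one_dim [IsAlgClosed k] (ι : C ⥤ FGModuleCat.{u} A) [ι.IsEquivalence]
    [ι.Additive] [ι.Linear k] {e : A} (he : IsPrimitiveIdem e) :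
    ∃ (L : C) (x : projObj ι e ⟶ L), x ≠ 0 ∧ ∀ y : projObj ι e ⟶ L, ∃ c : k, y = c • x := by
  have := hasFiniteBiproducts_of_mod k ι
  have := hasCokernels_of_mod k ι
  have : FiniteDimensional k (End (projObj ι e)) := finiteDimensional_hom_of_mod k ι _ _
  have := isLocalRing_end_projObj k ι he
  have := projective_projObj k (ι := ι) he.1
  let B := Module.finBasis k (Submodule.span k {f : End (projObj ι e) | ¬ IsUnit f})
  have hB : ∀ j, ¬ IsUnit (B j : End (projObj ι e)) := by
    intro j
    obtain ⟨b, hb⟩ := B j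
    dsimp only
    induction hb using Submodule.span_induction with
    | mem f hf => exact hf
    | zero => exact not_isUnit_zero (M₀ := End (projObj ι e))
    | add f g _ _ hf hg =>
      intro h
      have h2 : IsUnit (∑ b : Bool, cond b f g) := by simpa using h
      refine not_isUnit_sum (R := End (projObj ι e)) Finset.univ (fun b : Bool => cond b f g)
        ?_ h2
      rintro (_ | _) - <;> assumption
    | smul r f _ hf =>
      intro h
      obtain hn | hn := isNilpotent_or_isUnit k f
      · obtain ⟨N, hN⟩ := hn
        have := h.pow N
        rw [smul_pow, hN, smul_zero] at this
        exact not_isUnit_zero this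
      · exact hf hn
  -- the image of `p` is generated by the radical of the local ring `End (Ae)`
  let p : (⨁ fun _ : Fin (Module.finrank k
      (Submodule.span k {f : End (projObj ι e) | ¬ IsUnit f})) => projObj ι e) ⟶ projObj ι e :=
    biproduct.desc fun j => ((B j : End (projObj ι e)) : projObj ι e ⟶ projObj ι e)
  have hp : ∀ f : End (projObj ι e), ¬ IsUnit f → (f : projObj ι e ⟶ projObj ι e) ≫ cokernel.π p = 0 := by
    intro f hf
    have h1 := B.sum_repr ⟨f, Submodule.subset_span hf⟩
    have h2 := congrArg Subtype.val h1
    rw [Submodule.coe_sum] at h2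
    have h3 : (f : projObj ι e ⟶ projObj ι e) = ∑ j, (B.repr ⟨f, Submodule.subset_span hf⟩ j) •
      ((B j : End (projObj ι e)) : projObj ι e ⟶ projObj ι e) := h2.symm
    rw [h3, Preadditive.sum_comp]
    refine Finset.sum_eq_zero fun j _ => ?_
    have h4 : ((B j : End (projObj ι e)) : projObj ι e ⟶ projObj ι e) =
      biproduct.ι (fun _ => projObj ι e) j ≫ p := by simp [p]
    rw [Linear.smul_comp, h4, Category.assoc, cokernel.condition, comp_zero, smul_zero]
  refine ⟨cokernel p, cokernel.π p, fun h0 => ?_, fun y => ?_⟩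
  · have := Preadditive.epi_of_cokernel_zero h0
    let s := Projective.factorThru (𝟙 (projObj ι e)) p
    have hs : s ≫ p = 𝟙 _ := Projective.factorThru_comp _ _
    have h1 : (1 : End (projObj ι e)) = ∑ j, (B j : End (projObj ι e)) *
        (show End (projObj ι e) from s ≫ biproduct.π _ j) := by
      change 𝟙 _ = ∑ j, (s ≫ biproduct.π _ j) ≫ (B j : End (projObj ι e))
      rw [← hs]
      have : p = ∑ j, biproduct.π _ j ≫ (B j : End (projObj ι e)) := by
        simp only [p]
        apply biproduct.hom_ext'
        intro j
        rw [Preadditive.comp_sum, Finset.sum_eq_single j]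
        · simp
        · intro l _ hl
          rw [biproduct.ι_π_ne_assoc _ hl.symm, zero_comp]
        · simp
      conv_lhs => rw [this]
      simp [Preadditive.comp_sum]
    refine not_isUnit_sum Finset.univ _ (fun j _ hj => ?_) (h1 ▸ isUnit_one)
    obtain ⟨u, hu⟩ := hj
    refine hB j (isUnit_of_mul_eq_one_of_finite k 
      (y := (show End (projObj ι e) from s ≫ biproduct.π _ j) * (↑u⁻¹ : End (projObj ι e))) ?_)
    rw [← mul_assoc]
    exact (congrArg (fun c => c * (↑u⁻¹ : End (projObj ι e))) hu.symm).trans u.mul_inv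
  · let t : End (projObj ι e) := Projective.factorThru y (cokernel.π p)
    have ht : (t : projObj ι e ⟶ projObj ι e) ≫ cokernel.π p = y := Projective.factorThru_comp _ _
    obtain ⟨c, z, hz, hz'⟩ := exists_eq_smul_add_of_isAlgClosed k t
    refine ⟨c, ?_⟩
    have h5 : (t : projObj ι e ⟶ projObj ι e) = c • 𝟙 _ + z := by
      rw [hz, Algebra.algebraMap_eq_smul_one]
      rfl
    rw [← ht, h5, Preadditive.add_comp, hp z hz', Linear.smul_comp, Category.id_comp, add_zero]

/-- A connected algebra which is not simple has a module which is not projective: otherwise all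
surjections `A → A / I` split, and the algebra is semisimple. -/
lemma exists_not_projective (k : Type u) [Field k] [Algebra k A] [Module.Finite k A]
    (ι : C ⥤ FGModuleCat.{u} A) [ι.IsEquivalence] [ι.Additive]
    (hconn : IsConnectedAlg A) (hns : ¬ IsSimpleRing A) : ∃ X : C, ¬ Projective X := by
  by_contra! hall
  refine hns ?_
  have : IsSemisimpleRing A := by
    refine (isSemisimpleModule_iff A A).2 ⟨fun I => ?_⟩
    let q : FGModuleCat.of A A ⟶ FGModuleCat.of A (A ⧸ I) := FGModuleCat.ofHom I.mkQ
    have hq : Epi (ι.inv.map q) := by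
      rw [epi_iff_surjective_of_mod k (ι := ι)]
      intro y
      obtain ⟨a, ha⟩ := I.mkQ_surjective ((counitAt ι _).hom.hom.hom y)
      refine ⟨(counitAt ι (FGModuleCat.of A A)).inv.hom.hom a, ?_⟩
      have h1 := congrArg (fun φ => φ.hom.hom a) (counitAt_inv_naturality (ι := ι) q)
      refine h1.trans ?_
      have h2 := congrArg (fun φ => φ.hom.hom y) (counitAt ι (FGModuleCat.of A (A ⧸ I))).hom_inv_id
      refine Eq.trans ?_ h2
      exact congrArg _ ha
    have := hall (ι.inv.obj (FGModuleCat.of A (A ⧸ I)))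
    let s := Projective.factorThru (𝟙 _) (ι.inv.map q)
    have hs : s ≫ ι.inv.map q = 𝟙 _ := Projective.factorThru_comp _ _
    let s' := ι.inv.preimage s
    have hs' : s' ≫ q = 𝟙 _ := ι.inv.map_injective (by simp [s', hs])
    have h3 : I.mkQ ∘ₗ s'.hom.hom = LinearMap.id := congrArg (fun φ => φ.hom.hom) hs'
    have := LinearMap.isCompl_of_proj (f := LinearMap.codRestrict I
      (LinearMap.id - s'.hom.hom ∘ₗ I.mkQ) (fun a => by
        rw [← Submodule.Quotient.mk_eq_zero, ← Submodule.mkQ_apply, LinearMap.sub_apply, map_sub]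
        have := LinearMap.congr_fun h3 (I.mkQ a)
        simp only [LinearMap.comp_apply, LinearMap.id_apply] at this ⊢
        rw [this, sub_self])) (fun x => by
          apply Subtype.ext
          have : I.mkQ x.1 = 0 := (Submodule.Quotient.mk_eq_zero I).2 x.2
          simp [-Submodule.mkQ_apply, this])
    exact ⟨_, this⟩
  exact hconn.isSimpleRing

/-- The endomorphism ring of the identity functor is local: its elements are determined by their
components at `A`, so that its idempotents are given by central idempotents of `A`. -/
lemma isLocalRing_end_id (k : Type u) [Field k] [Algebra k A] [Module.Finite k A]
    [Linear k C] (ι : C ⥤ FGModuleCat.{u} A) [ι.IsEquivalence] [ι.Additive] [ι.Linear k]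
    (hconn : IsConnectedAlg A) : IsLocalRing (End (𝟭 C)) := by
  have h1 : IsIdempotentElem (1 : A) := IsIdempotentElem.one
  let U : C := projObj ι (1 : A)
  have : FiniteDimensional k (U ⟶ U) := finiteDimensional_hom_of_mod k ι _ _
  have hext : ∀ a b : End (𝟭 C), a.app U = b.app U → a = b := by
    intro a b hab
    apply NatTrans.ext
    funext X
    apply ι.map_injective
    ext x
    have h2 : ∀ c : End (𝟭 C), (ι.map (c.app X)).hom.hom x = elem (c.app U ≫ ofElem 1 x) := by
      intro c
      have h3 := congrArg elem (c.naturality (ofElem (ι := ι) 1 x))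
      refine Eq.trans ?_ h3
      change _ = elem (ofElem 1 x ≫ c.app X)
      rw [elem_comp, elem_ofElem, one_smul]
    exact (h2 a).trans ((congrArg (fun f => elem (f ≫ ofElem 1 x)) hab).trans (h2 b).symm)
  have : FiniteDimensional k (End (𝟭 C)) := by
    let φ : (𝟭 C ⟶ 𝟭 C) →ₗ[k] (U ⟶ U) :=
      { toFun := fun c => c.app U
        map_add' := fun _ _ => rfl
        map_smul' := fun _ _ => rfl }
    exact FiniteDimensional.of_injective φ hext
  have hU : 𝟙 U ≠ 0 := by
    intro h
    have := hconn.1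
    have h2 := val_id (ι := ι) h1
    exact one_ne_zero (h2.symm.trans ((congrArg val h).trans val_zero))
  have : Nontrivial (End (𝟭 C)) := ⟨⟨1, 0, fun h => hU (congrArg (fun c : 𝟭 C ⟶ 𝟭 C => c.app U) h)⟩⟩
  refine isLocalRing_of_idempotents k fun p hp => ?_
  have hcomm : ∀ g : U ⟶ U, val g * val (p.app U) = val (p.app U) * val g := by
    intro g
    rw [← val_comp h1, ← val_comp h1]
    exact congrArg val (p.naturality g)
  have hidem : val (p.app U) * val (p.app U) = val (p.app U) := by
    rw [← val_comp h1]
    exact congrArg (fun c : 𝟭 C ⟶ 𝟭 C => val (c.app U)) hp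
  obtain h2 | h2 := hconn.2 (val (p.app U)) hidem (fun a => by
    obtain ⟨g, hg⟩ := exists_val (ι := ι) (f := 1) (e := 1) a
    rw [one_mul, mul_one] at hg
    rw [← hg, hcomm])
  · left
    exact hext _ _ (val_injective (h2.trans val_zero.symm))
  · right
    exact hext _ _ (val_injective (h2.trans (val_id h1).symm))

/-- The simple top of `Ae_i` is a composition factor of `X` if and only if `e_i X` is nonzero. -/
lemma mem_signature_iff (k : Type u) [Field k] [Algebra k A] [Module.Finite k A]
    [Linear k C] (ι : C ⥤ FGModuleCat.{u} A) [ι.IsEquivalence] [ι.Additive] [ι.Linear k]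
    {n : ℕ} {e : Fin n → A} (he : IsPrimitiveDecomposition e) (X : C)
    (i : Fin n) : i ∈ signature ι e X ↔ ∃ v : projObj ι (e i) ⟶ X, v ≠ 0 := by
  have hi := (he.2 i).1
  have := isNoetherianRing_of_finite k A
  have hval : ∀ (x : (ι.obj X).obj), e i • x ≠ 0 → ∃ v : projObj ι (e i) ⟶ X, v ≠ 0 :=
    fun x hx => ⟨ofElem (e i) x, fun h => hx (by
      rw [← elem_ofElem (ι := ι), h, elem_zero])⟩
  have hgen : ∀ N : Submodule A ↥(Ideal.span {e i}), spanGen (e i) ∈ N → N = ⊤ := by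
    intro N hN
    rw [eq_top_iff]
    rintro a -
    obtain ⟨b, rfl⟩ := exists_smul_spanGen a
    exact N.smul_mem b hN
  have hnt : Nontrivial ↥(Ideal.span {e i}) :=
    ⟨⟨spanGen (e i), 0, fun h => (he.2 i).2.1 (congrArg Subtype.val h)⟩⟩
  constructor
  · rintro ⟨U, V, hUV, ⟨φ⟩⟩
    have hjac := Module.jacobson_lt_top A ↥(Ideal.span {e i})
    obtain ⟨w, hw⟩ := Submodule.mkQ_surjective _ (φ.symm
      (Submodule.Quotient.mk (p := Module.jacobson A ↥(Ideal.span {e i})) (spanGen (e i))))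
    refine hval w.1 fun h0 => hjac.ne (hgen _ ?_)
    have h1 : e i • w = 0 := Subtype.ext h0
    rw [← Submodule.Quotient.mk_eq_zero]
    have h2 := congrArg (fun y => φ (e i • y)) hw
    rw [← map_smul, h1, map_zero, map_zero, ← map_smul, LinearEquiv.apply_symm_apply,
      ← Submodule.Quotient.mk_smul] at h2
    rw [show e i • spanGen (e i) = spanGen (e i) from Subtype.ext hi.eq] at h2
    exact h2.symm
  · rintro ⟨v, hv⟩
    let f : ↥(Ideal.span {e i}) →ₗ[A] (ι.obj X).obj := toMod v
    have hf : f (spanGen (e i)) ≠ 0 := fun h => hv (elem_injective (ι := ι)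
      (h.trans elem_zero.symm))
    -- `Ae_i` is the only submodule of `Ae_i` which is not in the radical, and `ker f` is proper;
    -- hence the simple top is the quotient of the image of `f` by the image of the radical
    have hker : LinearMap.ker f ≤ Module.jacobson A ↥(Ideal.span {e i}) := by
      rw [Module.jacobson]
      refine le_sInf fun m hm => ?_
      by_contra hnot
      have hsup : LinearMap.ker f ⊔ m = ⊤ := by
        rw [sup_comm]
        exact hm.2 _ (lt_of_le_of_ne le_sup_left fun h => hnot (h ▸ le_sup_right))
      obtain ⟨a, ha, b, hb, hab⟩ : ∃ a ∈ LinearMap.ker f, ∃ b ∈ m, a + b = spanGen (e i) := by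
        have : spanGen (e i) ∈ LinearMap.ker f ⊔ m := by rw [hsup]; trivial
        exact Submodule.mem_sup.1 this
      -- one of `e_i a` and `e_i b` is invertible in the local ring `e_i A e_i`
      have key : ∀ c : ↥(Ideal.span {e i}), ∃ g : End (projObj ι (e i)), val g = e i * c.1 := by
        intro c
        obtain ⟨g, hg⟩ := exists_val (ι := ι) (f := e i) (e := e i) c.1
        refine ⟨g, hg.trans ?_⟩
        have := congrArg Subtype.val (smul_spanGen hi c)
        rw [mul_assoc]
        exact congrArg _ this
      obtain ⟨g, hg⟩ := key a
      obtain ⟨g', hg'⟩ := key b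
      have hgg : g + g' = 1 := by
        apply val_injective
        refine (val_add _ _).trans ?_
        rw [hg, hg', ← mul_add]
        refine Eq.trans ?_ (val_id hi).symm
        have := congrArg (fun c => e i * c.1) hab
        exact this.trans hi
      have hunit : ∀ (N : Submodule A ↥(Ideal.span {e i})) (c : ↥(Ideal.span {e i}))
          (g : End (projObj ι (e i))), c ∈ N → val g = e i * c.1 → IsUnit g → N = ⊤ := by
        rintro N c g hc hg ⟨u, rfl⟩
        refine hgen N ?_
        have h3 : val ((↑u⁻¹ : End (projObj ι (e i))) : projObj ι (e i) ⟶ projObj ι (e i)) *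
            val ((↑u : End (projObj ι (e i))) : projObj ι (e i) ⟶ projObj ι (e i)) = e i := by
          rw [← val_comp hi]
          exact (congrArg val u.mul_inv).trans (val_id hi)
        rw [hg, ← mul_assoc] at h3
        have h4 : (val ((↑u⁻¹ : End (projObj ι (e i))) : projObj ι (e i) ⟶ projObj ι (e i)) * e i) •
          c = spanGen (e i) := Subtype.ext h3
        exact h4 ▸ N.smul_mem _ hc
      have := isLocalRing_end_projObj k ι (he.2 i)
      obtain h5 | h5 := IsLocalRing.isUnit_or_isUnit_of_add_one hgg
      · have := hunit _ a g ha hg h5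
        refine hf ?_
        have h6 : spanGen (e i) ∈ LinearMap.ker f := by rw [this]; trivial
        exact h6
      · exact hm.1 (hunit _ b g' hb hg' h5)
    refine ⟨(Module.jacobson A ↥(Ideal.span {e i})).map f, LinearMap.range f,
      LinearMap.map_le_range, ⟨?_⟩⟩
    let q : LinearMap.range f →ₗ[A] simpleTop (e i) :=
      ((LinearMap.ker f).liftQ (Submodule.mkQ _) (by rwa [Submodule.ker_mkQ])) ∘ₗ
        f.quotKerEquivRange.symm.toLinearMap
    have hq : ∀ a, q ⟨f a, a, rfl⟩ = Submodule.Quotient.mk a := by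
      intro a
      have : f.quotKerEquivRange.symm ⟨f a, a, rfl⟩ = Submodule.Quotient.mk a := by
        rw [LinearEquiv.symm_apply_eq]
        rfl
      simp [q, this]
    have hqs : Function.Surjective q := by
      intro y
      obtain ⟨a, rfl⟩ := Submodule.mkQ_surjective _ y
      exact ⟨_, hq a⟩
    have hqk : LinearMap.ker q = ((Module.jacobson A ↥(Ideal.span {e i})).map f).submoduleOf
        (LinearMap.range f) := by
      ext ⟨_, a, rfl⟩
      rw [LinearMap.mem_ker, hq, Submodule.Quotient.mk_eq_zero]
      constructor
      · exact fun ha => ⟨a, ha, rfl⟩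
      · rintro ⟨b, hb, hab⟩
        have : a - b ∈ LinearMap.ker f := by simp [hab]
        have := Submodule.add_mem _ (hker this) hb
        rwa [sub_add_cancel] at this
    exact (Submodule.quotEquivOfEq _ _ hqk.symm).trans (q.quotKerEquivOfSurjective hqs)

end ModCat

/-! ### Direct sums in full subcategories -/

section FullSub

variable {𝒳 : Type*} [Category 𝒳] [Preadditive 𝒳]

/-- The biproduct bicone of a direct sum presentation. -/
def SumDecomp.bicone {J : Type} [Fintype J] [DecidableEq J] {f : J → 𝒳} {X : 𝒳}
    (d : SumDecomp f X) : Bicone f where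
  pt := X
  ι := d.ι
  π := d.π
  ι_π i j := by
    by_cases h : i = j
    · subst h; simp [d.ι_π]
    · rw [dif_neg h, d.ι_π_ne i j h]

/-- The presentation given by the chosen biproduct. -/
noncomputable def SumDecomp.ofBiproduct {J : Type} [Fintype J] (f : J → 𝒳) [HasBiproduct f] :
    SumDecomp f (⨁ f) where
  ι := biproduct.ι f
  π := biproduct.π f
  ι_π j := biproduct.ι_π_self f j
  ι_π_ne j l h := biproduct.ι_π_ne f h
  total := by classical exact IsBilimit.total (biproduct.isBilimit f)

lemma SumDecomp.hasBiproduct {J : Type} [Fintype J] {f : J → 𝒳} {X : 𝒳} (d : SumDecomp f X) :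
    HasBiproduct f := by
  classical
  exact HasBiproduct.mk ⟨d.bicone, isBilimitOfTotal _ d.total⟩

lemma hasFiniteBiproducts_of_sumDecomp
    (h : ∀ (m : ℕ) (f : Fin m → 𝒳), ∃ X, Nonempty (SumDecomp f X)) : HasFiniteBiproducts 𝒳 :=
  ⟨fun m => ⟨fun f => by
    obtain ⟨X, ⟨d⟩⟩ := h m f
    exact d.hasBiproduct⟩⟩

/-- Direct sums in a full subcategory. -/
def SumDecomp.lift {P : ObjectProperty 𝒳} {J : Type} [Fintype J] {f : J → P.FullSubcategory}
    {X : P.FullSubcategory} (d : SumDecomp (fun j => (f j).obj) X.obj) : SumDecomp f X where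
  ι j := ObjectProperty.homMk (d.ι j)
  π j := ObjectProperty.homMk (d.π j)
  ι_π j := by ext; exact d.ι_π j
  ι_π_ne j l h := by ext; exact d.ι_π_ne j l h
  total := by
    apply P.ι.map_injective
    rw [Functor.map_sum]
    exact d.total

/-- Retracts in a full subcategory. -/
def liftRetract {P : ObjectProperty 𝒳} {X Y : P.FullSubcategory} (r : Retract X.obj Y.obj) :
    Retract X Y where
  i := ObjectProperty.homMk r.i
  r := ObjectProperty.homMk r.r
  retract := by ext; exact r.retract

lemma hasFiniteBiproducts_fullSubcategory [HasFiniteBiproducts 𝒳] (P : ObjectProperty 𝒳)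
    (h : ∀ X, IsSumOf P X → P X) : HasFiniteBiproducts P.FullSubcategory :=
  hasFiniteBiproducts_of_sumDecomp fun _ f =>
    ⟨⟨⨁ fun j => (f j).obj, h _ ((SumDecomp.ofBiproduct _).isSumOf fun j => (f j).property)⟩,
      ⟨SumDecomp.lift (SumDecomp.ofBiproduct fun j => (f j).obj)⟩⟩

lemma projective_of_sumDecomp {J : Type} [Fintype J] {f : J → 𝒳} {X : 𝒳} (d : SumDecomp f X)
    (h : ∀ j, Projective (f j)) : Projective X where
  factors {E Y} g p hp := by
    refine ⟨∑ j, d.π j ≫ Projective.factorThru (d.ι j ≫ g) p, ?_⟩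
    conv_rhs => rw [d.eq_id_comp g]
    simp [Preadditive.sum_comp]

lemma projective_of_retract {X Y : 𝒳} (r : Retract X Y) [Projective Y] : Projective X where
  factors {E Z} g p hp := ⟨r.i ≫ Projective.factorThru (r.r ≫ g) p, by simp⟩

/-- In a category with finite biproducts, each member of a direct sum has a complement. -/
lemma SumDecomp.exists_complBicone [HasFiniteBiproducts 𝒳] {J : Type} [Fintype J] {f : J → 𝒳}
    {X : 𝒳} (d : SumDecomp f X) (j : J) : ∃ (Z : 𝒳) (b : BinaryBicone (f j) Z),
      Nonempty b.IsBilimit ∧ b.pt = X := by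
  classical
  let Z := ⨁ fun l : {l // l ≠ j} => f l.1
  let s : Retract Z X := ⟨biproduct.desc fun l => d.ι l.1, biproduct.lift fun l => d.π l.1, by
    apply biproduct.hom_ext'
    intro l
    apply biproduct.hom_ext
    intro m
    by_cases h : l = m
    · subst h
      simp [d.ι_π, Z]
    · have h' : l.1 ≠ m.1 := fun h' => h (Subtype.ext h')
      simp [d.ι_π_ne _ _ h', biproduct.ι_π_ne _ h, Z]⟩
  have hs : (d.retract j).r ≫ (d.retract j).i + s.r ≫ s.i = 𝟙 X := by
    have : s.r ≫ s.i = ∑ l : {l // l ≠ j}, d.π l.1 ≫ d.ι l.1 := by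
      simp [s, biproduct.lift_desc]
    rw [this, ← d.total]
    dsimp only [SumDecomp.retract]
    rw [← Finset.sum_subtype (p := fun l => l ≠ j) (Finset.univ.erase j) (by simp)
      (fun l => d.π l ≫ d.ι l)]
    exact Finset.add_sum_erase _ (fun l => d.π l ≫ d.ι l) (Finset.mem_univ j)
  exact ⟨Z, _, ⟨complBiconeIsBilimit _ s hs⟩, rfl⟩

end FullSub

lemma SumDecomp.isSummand {𝒳 : Type u} [SmallCategory 𝒳] [Preadditive 𝒳] [HasFiniteBiproducts 𝒳]
    {J : Type} [Fintype J] {f : J → 𝒳} {X : 𝒳} (d : SumDecomp f X) (j : J) :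
    IsSummand (f j) X := by
  obtain ⟨Z, b, hb, h⟩ := d.exists_complBicone j
  exact ⟨Z, b, hb, ⟨eqToIso h⟩⟩

/-- An indecomposable direct sum is isomorphic to one of its nonzero members. -/
lemma IsIndec.exists_iso {𝒳 : Type u} [SmallCategory 𝒳] [Preadditive 𝒳] [HasFiniteBiproducts 𝒳]
    {X : 𝒳} (h : IsIndec X) {Q : ObjectProperty 𝒳} (hX : IsSumOf Q X) :
    ∃ Y, Q Y ∧ Nonempty (Y ≅ X) := by
  obtain ⟨m, f, hf, ⟨d⟩⟩ := hX.exists_sumDecomp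
  obtain ⟨j, hj⟩ : ∃ j, ¬ IsZero (f j) := by
    by_contra! h0
    exact h.1 (d.isZero h0)
  obtain ⟨Z, b, ⟨hb⟩, rfl⟩ := d.exists_complBicone j
  refine ⟨f j, hf j, ⟨⟨b.inl, b.fst, b.inl_fst, ?_⟩⟩⟩
  have h1 := (h.2 _ _ b ⟨hb⟩ ⟨Iso.refl _⟩).resolve_left hj
  have h2 := IsBilimit.binary_total hb
  rwa [h1.eq_of_src b.inr 0, comp_zero, add_zero] at h2

/-! ### Natural transformations out of copower functors -/

namespace Copower

variable {k : Type*} [Field k] {C : Type*} [Category C] [Preadditive C] [Linear k C]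
  {P R : C} {F : C ⥤ C} (c : Copower k P R F)

lemma ins_eq {X : C} (v : R ⟶ X) : c.ins X v = c.ins R (𝟙 R) ≫ F.map v := by
  rw [c.ins_map, Category.id_comp]

lemma nat_ext {G : C ⥤ C} {α β : F ⟶ G}
    (h : c.ins R (𝟙 R) ≫ α.app R = c.ins R (𝟙 R) ≫ β.app R) : α = β := by
  apply NatTrans.ext
  funext X
  refine c.hom_ext fun v => ?_
  rw [c.ins_eq, Category.assoc, Category.assoc, α.naturality, β.naturality, reassoc_of% h]

/-- The natural transformation out of a copower functor given by the Yoneda lemma. -/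
def natDesc {G : C ⥤ C} [G.Additive] [G.Linear k] (y : P ⟶ G.obj R) : F ⟶ G where
  app X := c.desc (Linear.leftComp k _ y ∘ₗ G.mapLinearMap k)
  naturality X Y g := c.hom_ext fun v => by
    rw [← Category.assoc, c.ins_map, c.ins_desc, ← Category.assoc, c.ins_desc]
    change y ≫ G.map (v ≫ g) = (y ≫ G.map v) ≫ G.map g
    simp

lemma ins_natDesc {G : C ⥤ C} [G.Additive] [G.Linear k] (y : P ⟶ G.obj R) {X : C} (v : R ⟶ X) :
    c.ins X v ≫ (c.natDesc y).app X = y ≫ G.map v :=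
  c.ins_desc _ v

/-- The values of a copower functor are direct sums of copies of `P`. -/
noncomputable def sumDecomp {X : C} {m : ℕ} (B : Module.Basis (Fin m) k (R ⟶ X)) :
    SumDecomp (fun _ : Fin m => P) (F.obj X) where
  ι j := c.ins X (B j)
  π j := c.desc ((LinearMap.toSpanSingleton k _ (𝟙 P)) ∘ₗ B.coord j)
  ι_π j := by simp [c.ins_desc]
  ι_π_ne j l h := by simp [c.ins_desc, Finsupp.single_eq_of_ne h.symm]
  total := c.hom_ext fun v => by
    rw [Preadditive.comp_sum, Category.comp_id]
    conv_rhs => rw [← B.sum_repr v, map_sum]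
    refine Finset.sum_congr rfl fun j _ => ?_
    rw [← Category.assoc, c.ins_desc]
    simp

lemma ins_sumDecomp_π {X : C} {m : ℕ} (B : Module.Basis (Fin m) k (R ⟶ X)) (v : R ⟶ X)
    (j : Fin m) : c.ins X v ≫ (c.sumDecomp B).π j = B.coord j v • 𝟙 P := c.ins_desc _ _

variable [∀ X Y : C, FiniteDimensional k (X ⟶ Y)]

lemma isZero_iff (c : Copower k P R F) (hP : ¬ IsZero P) {X : C} :
    IsZero (F.obj X) ↔ ∀ v : R ⟶ X, v = 0 := by
  constructor
  · intro h v
    by_contra hv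
    let B := Module.finBasis k (R ⟶ X)
    obtain ⟨j, -⟩ : ∃ j, B.repr v j ≠ 0 := by
      by_contra! h0
      exact hv (B.repr.map_eq_zero_iff.1 (Finsupp.ext h0))
    exact hP (isZero_of_retract ((c.sumDecomp B).retract j) h)
  · intro h
    rw [IsZero.iff_id_eq_zero]
    refine c.hom_ext fun v => ?_
    rw [h v, map_zero, zero_comp, zero_comp]

/-- `F X` is a direct sum of copies of `P`. -/
lemma projective (c : Copower k P R F) [Projective P] (X : C) : Projective (F.obj X) :=
  projective_of_sumDecomp (c.sumDecomp (Module.finBasis k (R ⟶ X))) fun _ => ‹_›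

/-! #### Composition -/

section comp

variable {P' R' : C} {G H : C ⥤ C} [F.Additive] [F.Linear k] [G.Additive] [G.Linear k]
  [H.Additive] [H.Linear k] (d : Copower k P' R' G) (h : Copower k P R' H)

/-- The insertion `H → F ∘ G` given by `w : R ⟶ P'`. -/
def inComp (w : R ⟶ P') : H ⟶ G ⋙ F :=
  h.natDesc (G := G ⋙ F) (c.ins _ (w ≫ d.ins R' (𝟙 R')))

lemma ins_inComp (w : R ⟶ P') {X : C} (v : R' ⟶ X) :
    h.ins X v ≫ (c.inComp d h w).app X = c.ins (G.obj X) (w ≫ d.ins X v) := by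
  rw [inComp, ins_natDesc]
  change _ ≫ F.map (G.map v) = _
  rw [c.ins_map, Category.assoc, ← d.ins_eq]

lemma ins_inComp_assoc (w : R ⟶ P') {X Z : C} (v : R' ⟶ X) (g : F.obj (G.obj X) ⟶ Z) :
    h.ins X v ≫ (c.inComp d h w).app X ≫ g = c.ins (G.obj X) (w ≫ d.ins X v) ≫ g := by
  rw [← ins_inComp c d h w v, Category.assoc]

/-- Contraction of the values of a copower functor with a linear form. -/
noncomputable def contract (φ : (R ⟶ P') →ₗ[k] k) (X : C) : (R ⟶ G.obj X) →ₗ[k] (R' ⟶ X) :=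
  ∑ j, (LinearMap.toSpanSingleton k _ (Module.finBasis k (R' ⟶ X) j)) ∘ₗ φ ∘ₗ
    { toFun := fun z => z ≫ (d.sumDecomp (Module.finBasis k (R' ⟶ X))).π j
      map_add' := fun _ _ => Preadditive.add_comp _ _ _ _ _ _
      map_smul' := fun _ _ => Linear.smul_comp _ _ _ _ _ _ }

lemma contract_comp_ins (φ : (R ⟶ P') →ₗ[k] k) {X : C} (w : R ⟶ P') (v : R' ⟶ X) :
    d.contract φ X (w ≫ d.ins X v) = φ w • v := by
  have h1 : ∀ j, φ ((w ≫ d.ins X v) ≫ (d.sumDecomp (Module.finBasis k (R' ⟶ X))).π j) =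
      (Module.finBasis k (R' ⟶ X)).repr v j * φ w := by
    intro j
    rw [Category.assoc, ins_sumDecomp_π, Linear.comp_smul, Category.comp_id, map_smul]
    rfl
  simp only [contract, LinearMap.sum_apply, LinearMap.comp_apply, LinearMap.coe_mk,
    AddHom.coe_mk, h1, LinearMap.toSpanSingleton_apply]
  conv_rhs => rw [← (Module.finBasis k (R' ⟶ X)).sum_repr v, Finset.smul_sum]
  refine Finset.sum_congr rfl fun j _ => ?_
  rw [smul_smul, mul_comm]

lemma eq_sum_ins {X Z : C} (z : Z ⟶ G.obj X) :
    z = ∑ j, (z ≫ (d.sumDecomp (Module.finBasis k (R' ⟶ X))).π j) ≫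
      d.ins X (Module.finBasis k (R' ⟶ X) j) :=
  (d.sumDecomp (Module.finBasis k (R' ⟶ X))).eq_comp_id z

/-- The projection `F ∘ G → H` given by a linear form on `Hom(R, P')`. -/
noncomputable def outComp (φ : (R ⟶ P') →ₗ[k] k) : G ⋙ F ⟶ H where
  app X := c.desc (h.ins X ∘ₗ d.contract φ X)
  naturality X Y g := c.hom_ext fun z => by
    rw [← Category.assoc, ← Category.assoc, c.ins_desc]
    change (c.ins _ z ≫ F.map (G.map g)) ≫ _ = _
    rw [c.ins_map, c.ins_desc, LinearMap.comp_apply, LinearMap.comp_apply, h.ins_map]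
    congr 1
    rw [d.eq_sum_ins z, Preadditive.sum_comp, map_sum, map_sum, Preadditive.sum_comp]
    refine Finset.sum_congr rfl fun j _ => ?_
    rw [Category.assoc, d.ins_map, contract_comp_ins, contract_comp_ins, Linear.smul_comp]

lemma ins_outComp (φ : (R ⟶ P') →ₗ[k] k) {X : C} (w : R ⟶ P') (v : R' ⟶ X) :
    c.ins (G.obj X) (w ≫ d.ins X v) ≫ (c.outComp d h φ).app X = φ w • h.ins X v := by
  refine (c.ins_desc _ _).trans ?_
  rw [LinearMap.comp_apply, contract_comp_ins, map_smul]

lemma comp_hom_ext {X Z : C} {f g : F.obj (G.obj X) ⟶ Z}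
    (hfg : ∀ (w : R ⟶ P') (v : R' ⟶ X), c.ins _ (w ≫ d.ins X v) ≫ f =
      c.ins _ (w ≫ d.ins X v) ≫ g) : f = g := by
  refine c.hom_ext fun z => ?_
  rw [d.eq_sum_ins z, map_sum, Preadditive.sum_comp, Preadditive.sum_comp]
  exact Finset.sum_congr rfl fun j _ => hfg _ _

/-- `F ∘ G` is a direct sum of copies of `H`, indexed by a basis of `Hom(R, P')`. -/
noncomputable def compDecomp {m : ℕ} (B : Module.Basis (Fin m) k (R ⟶ P')) :
    SumDecomp (fun _ : Fin m => H) (G ⋙ F) where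
  ι j := c.inComp d h (B j)
  π j := c.outComp d h (B.coord j)
  ι_π j := by
    refine NatTrans.ext (funext fun X => h.hom_ext fun v => ?_)
    rw [NatTrans.comp_app, ins_inComp_assoc, ins_outComp]
    simp
  ι_π_ne j l hjl := by
    refine NatTrans.ext (funext fun X => h.hom_ext fun v => ?_)
    rw [NatTrans.comp_app, ins_inComp_assoc, ins_outComp]
    simp [Finsupp.single_eq_of_ne hjl.symm]
  total := by
    refine NatTrans.ext (funext fun X => c.comp_hom_ext d fun w v => ?_)
    rw [NatTrans.app_sum, Preadditive.comp_sum]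
    have h1 : ∀ j, c.ins (G.obj X) (w ≫ d.ins X v) ≫
        (c.outComp d h (B.coord j) ≫ c.inComp d h (B j)).app X =
        B.repr w j • c.ins (G.obj X) (B j ≫ d.ins X v) := by
      intro j
      rw [NatTrans.comp_app, ← Category.assoc, ins_outComp, Linear.smul_comp, ins_inComp]
      rfl
    refine (Finset.sum_congr rfl fun j _ => h1 j).trans ?_
    refine Eq.trans ?_ (Category.comp_id _).symm
    conv_rhs => rw [← B.sum_repr w, Preadditive.sum_comp, map_sum]
    refine Finset.sum_congr rfl fun j _ => ?_
    rw [Linear.smul_comp, map_smul]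

end comp

end Copower

/-! ### Endomorphism rings of copower functors -/

namespace Copower

variable {k : Type*} [Field k] {C : Type*} [Category C] [Preadditive C] [Linear k C]
  {P R : C} {F : C ⥤ C} [F.Additive] [F.Linear k] [∀ X Y : C, FiniteDimensional k (X ⟶ Y)]

/-- If `Hom(R, L)` is spanned by `x ≠ 0`, then the value of a copower functor at `L` is `P`. -/
@[simps] noncomputable def isoOfSpan (c : Copower k P R F) {L : C} (x : R ⟶ L) (hx : x ≠ 0)
    (hspan : ∀ y : R ⟶ L, ∃ r : k, y = r • x) : P ≅ F.obj L where
  hom := c.ins L x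
  inv := c.desc (LinearMap.toSpanSingleton k _ (𝟙 P) ∘ₗ
    (LinearEquiv.toSpanNonzeroSingleton k (R ⟶ L) x hx).symm.toLinearMap ∘ₗ
    LinearMap.codRestrict _ LinearMap.id (fun y => by
      obtain ⟨r, rfl⟩ := hspan y
      exact Submodule.mem_span_singleton.2 ⟨r, rfl⟩))
  hom_inv_id := by
    rw [c.ins_desc]
    have : (LinearEquiv.toSpanNonzeroSingleton k (R ⟶ L) x hx).symm
      ⟨x, Submodule.mem_span_singleton_self x⟩ = 1 := LinearEquiv.coord_self k _ x hx
    simp only [LinearMap.comp_apply, LinearEquiv.coe_coe]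
    erw [this]
    simp
  inv_hom_id := c.hom_ext fun v => by
    obtain ⟨r, rfl⟩ := hspan v
    have : (LinearEquiv.toSpanNonzeroSingleton k (R ⟶ L) x hx).symm
      ⟨x, Submodule.mem_span_singleton_self x⟩ = 1 := LinearEquiv.coord_self k _ x hx
    rw [map_smul, Linear.smul_comp, Linear.smul_comp, ← Category.assoc, c.ins_desc]
    simp only [LinearMap.comp_apply, LinearEquiv.coe_coe]
    erw [this]
    simp

/-- Morphisms between the values at `L` lift to natural transformations. -/
lemma exists_app_eq (c : Copower k P R F) {P' : C} {F' : C ⥤ C} [F'.Additive] [F'.Linear k]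
    (c' : Copower k P' R F') {L : C} (x : R ⟶ L) (hx : x ≠ 0)
    (hspan : ∀ y : R ⟶ L, ∃ r : k, y = r • x) (g : F.obj L ⟶ F'.obj L) :
    ∃ α : F ⟶ F', α.app L = g := by
  let g' : P ⟶ P' := c.ins L x ≫ g ≫ (c'.isoOfSpan x hx hspan).inv
  have hg' : g' ≫ c'.ins L x = c.ins L x ≫ g := by
    have := (c'.isoOfSpan x hx hspan).inv_hom_id
    simp only [isoOfSpan_hom] at this
    simp only [g', Category.assoc, this, Category.comp_id]
  refine ⟨c.natDesc (g' ≫ c'.ins R (𝟙 R)), c.hom_ext fun v => ?_⟩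
  obtain ⟨r, rfl⟩ := hspan v
  rw [map_smul, Linear.smul_comp, Linear.smul_comp, ins_natDesc, Category.assoc, c'.ins_map,
    Category.id_comp, hg']

/-- An endomorphism of a copower functor vanishing at `L` is nilpotent: it takes `P ⊗ Hom(R, X)` to
`P ⊗ rad(R) Hom(R, X)`. -/
lemma isNilpotent_of_app_eq_zero [IsAlgClosed k] (c : Copower k P R F)
    (hR : IsLocalRing (End R)) {L : C} (x : R ⟶ L) (hx : x ≠ 0)
    (hspan : ∀ y : R ⟶ L, ∃ r : k, y = r • x) (α : End F) (hα : α.app L = 0) :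
    IsNilpotent α := by
  have hfin : FiniteDimensional k (End R) := inferInstanceAs (FiniteDimensional k (R ⟶ R))
  have : IsArtinianRing (End R) := isArtinian_of_tower k inferInstance
  have : IsNoetherianRing (End R) := isNoetherian_of_tower k inferInstance
  let J : Ideal (End R) := Ideal.jacobson ⊥
  have hJ : ∀ r : End R, ¬ IsUnit r → r ∈ J := by
    intro r hr
    refine Ideal.mem_jacobson_iff.2 fun y => ?_
    have h1 : ¬ IsUnit (y * r) := fun h => by
      obtain ⟨u, hu⟩ := h
      have h2 : (↑u⁻¹ * y) * r = 1 := by rw [mul_assoc, ← hu, Units.inv_mul]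
      exact hr (IsUnit.of_mul_eq_one_right _ h2)
    have h3 : IsUnit (y * r + 1) := by
      obtain hn | hn := isNilpotent_or_isUnit k (y * r)
      · exact hn.isUnit_add_one
      · exact (h1 hn).elim
    obtain ⟨u, hu⟩ := h3
    refine ⟨↑u⁻¹, ?_⟩
    have : (↑u⁻¹ : End R) * y * r + ↑u⁻¹ - 1 = ↑u⁻¹ * (y * r + 1) - 1 := by
      rw [mul_add, mul_one, mul_assoc]
    rw [this, ← hu, Units.inv_mul, sub_self]
    exact Submodule.zero_mem _
  -- a nilpotent endomorphism of `R` acts by a nilpotent scalar on the line `Hom(R, L)`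
  have hkill : ∀ r : End R, ¬ IsUnit r → (r : R ⟶ R) ≫ x = 0 := by
    intro r hr
    obtain ⟨a, ha⟩ := hspan ((r : R ⟶ R) ≫ x)
    obtain ⟨N, hN⟩ := (isNilpotent_or_isUnit k r).resolve_right hr
    have hpow : ∀ N : ℕ, ((r ^ N : End R) : R ⟶ R) ≫ x = a ^ N • x := by
      intro N
      induction N with
      | zero => simp [End.one_def]
      | succ N ih =>
        rw [pow_succ, pow_succ', End.mul_def, Category.assoc, ih, Linear.comp_smul, ha, smul_smul,
          mul_comm]
    have h0 := hpow N
    rw [hN] at h0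
    have h1 : a ^ N • x = 0 := by
      rw [← h0]
      exact zero_comp
    obtain h2 | h2 := smul_eq_zero.1 h1
    · rw [ha, eq_zero_of_pow_eq_zero h2, zero_smul]
    · exact (hx h2).elim
  -- expand `α` on the generator in a basis of `End R`, splitting off scalars
  let B := Module.finBasis k (R ⟶ R)
  choose a r hr hr' using fun j => exists_eq_smul_add_of_isAlgClosed k (R := End R) (B j)
  have hB : ∀ j, B j = a j • 𝟙 R + (show R ⟶ R from r j) := by
    intro j
    refine (hr j).trans ?_
    rw [Algebra.algebraMap_eq_smul_one]
    rfl
  let y : P ⟶ F.obj R := c.ins R (𝟙 R) ≫ (α : F ⟶ F).app R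
  let y' := fun j => y ≫ (c.sumDecomp B).π j
  have hy : y = ∑ j, y' j ≫ c.ins R (B j) := (c.sumDecomp B).eq_comp_id y
  have hsum : ∑ j, a j • y' j = 0 := by
    have h1 : y ≫ F.map x = 0 := by
      rw [Category.assoc, ← NatTrans.naturality]
      erw [hα]
      rw [comp_zero, comp_zero]
    have h2 : y ≫ F.map x = (∑ j, a j • y' j) ≫ c.ins L x := by
      rw [hy, Preadditive.sum_comp, Preadditive.sum_comp]
      refine Finset.sum_congr rfl fun j _ => ?_
      rw [Category.assoc, c.ins_map, hB, Preadditive.add_comp, hkill _ (hr' j), add_zero,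
        Linear.smul_comp, Category.id_comp, map_smul, Linear.comp_smul, Linear.smul_comp]
    have h3 := h2.symm.trans h1 =≫ (c.isoOfSpan x hx hspan).inv
    rw [zero_comp, Category.assoc] at h3
    have h4 := (c.isoOfSpan x hx hspan).hom_inv_id
    rw [isoOfSpan_hom] at h4
    rwa [h4, Category.comp_id] at h3
  have hy2 : y = ∑ j, y' j ≫ c.ins R (r j) := by
    have h1 : ∑ j, y' j ≫ c.ins R (B j) =
        (∑ j, a j • y' j) ≫ c.ins R (𝟙 R) + ∑ j, y' j ≫ c.ins R (r j) := by
      rw [Preadditive.sum_comp, ← Finset.sum_add_distrib]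
      refine Finset.sum_congr rfl fun j _ => ?_
      rw [hB, map_add, Preadditive.comp_add, map_smul, Linear.comp_smul, Linear.smul_comp]
    rw [hy, h1, hsum, zero_comp, zero_add]
  have hα' : ∀ {X : C} (v : R ⟶ X), c.ins X v ≫ (α : F ⟶ F).app X =
      ∑ j, y' j ≫ c.ins X ((r j : R ⟶ R) ≫ v) := by
    intro X v
    rw [c.ins_eq, Category.assoc, NatTrans.naturality, ← Category.assoc]
    change y ≫ F.map v = _
    rw [hy2, Preadditive.sum_comp]
    refine Finset.sum_congr rfl fun j _ => ?_
    rw [Category.assoc, c.ins_map]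
  -- the morphisms `P → F X` which lie in `P ⊗ J ^ q v`; the power `α ^ q` takes `v` into `S q v`
  let S : ℕ → ∀ {X : C}, (R ⟶ X) → Submodule k (P ⟶ F.obj X) := fun q X v =>
    Submodule.span k {z | ∃ (w : P ⟶ P) (s : End R), s ∈ J ^ q ∧
      z = w ≫ c.ins X ((s : R ⟶ R) ≫ v)}
  have hS : ∀ (q : ℕ) {X : C} (v : R ⟶ X), c.ins X v ≫ ((α ^ q : End F) : F ⟶ F).app X ∈ S q v := by
    intro q
    induction q with
    | zero =>
      intro X v
      refine Submodule.subset_span ⟨𝟙 P, 1, by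
        rw [Submodule.pow_zero, Ideal.one_eq_top]; trivial, ?_⟩
      rw [pow_zero, End.one_def, End.one_def, NatTrans.id_app, Category.comp_id, Category.id_comp,
        Category.id_comp]
    | succ q ih =>
      intro X v
      rw [pow_succ', End.mul_def, NatTrans.comp_app, ← Category.assoc]
      have h1 := ih v
      generalize c.ins X v ≫ ((α ^ q : End F) : F ⟶ F).app X = z at h1
      induction h1 using Submodule.span_induction with
      | mem z hz =>
        obtain ⟨w, s, hs, rfl⟩ := hz
        rw [Category.assoc, hα', Preadditive.comp_sum]
        refine Submodule.sum_mem _ fun j _ => Submodule.subset_span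
          ⟨w ≫ y' j, s * r j, ?_, ?_⟩
        · rw [Submodule.pow_succ]
          exact Ideal.mul_mem_mul hs (hJ _ (hr' j))
        · rw [End.mul_def, Category.assoc w, Category.assoc (show R ⟶ R from r j)]
      | zero => rw [zero_comp]; exact Submodule.zero_mem _
      | add z z' _ _ h h' => rw [Preadditive.add_comp]; exact Submodule.add_mem _ h h'
      | smul b z _ h => rw [Linear.smul_comp]; exact Submodule.smul_mem _ b h
  obtain ⟨q, hq⟩ := IsArtinianRing.isNilpotent_jacobson_bot (R := End R)
  refine ⟨q, c.nat_ext ?_⟩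
  have h1 := hS q (𝟙 R)
  have h2 : S q (𝟙 R) = ⊥ := by
    rw [Submodule.span_eq_bot]
    rintro z ⟨w, s, hs, rfl⟩
    have : s = 0 := by
      have h3 : s ∈ J ^ q := hs
      rw [show J ^ q = 0 from hq] at h3
      simpa using h3
    subst this
    have h4 : ((0 : End R) : R ⟶ R) ≫ 𝟙 R = 0 := zero_comp
    rw [h4, map_zero, comp_zero]
  rw [h2, Submodule.mem_bot] at h1
  refine h1.trans ?_
  exact comp_zero.symm

/-- The endomorphism ring of a copower functor is local if those of `P` and `R` are: evaluation at
`L` is a surjection onto `End P` whose kernel consists of nilpotent elements. -/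
lemma isLocalRing_end [IsAlgClosed k] (c : Copower k P R F) (hP : IsLocalRing (End P))
    (hR : IsLocalRing (End R)) {L : C} (x : R ⟶ L) (hx : x ≠ 0)
    (hspan : ∀ y : R ⟶ L, ∃ r : k, y = r • x) : IsLocalRing (End F) := by
  have hFL := isLocalRing_end_of_iso (c.isoOfSpan x hx hspan) hP
  have : Nontrivial (End F) := ⟨⟨1, 0, fun h => one_ne_zero (α := End (F.obj L))
    (congrArg (fun α : F ⟶ F => α.app L) h)⟩⟩
  have key : ∀ a : End F, IsUnit (M := End (F.obj L)) ((a : F ⟶ F).app L) → IsUnit a := by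
    rintro a ⟨u, hu⟩
    obtain ⟨b, hb⟩ := c.exists_app_eq c x hx hspan ((↑u⁻¹ : End (F.obj L)) : F.obj L ⟶ F.obj L)
    let b' : End F := b
    have h1 : IsUnit (a * b') := by
      have h2 := c.isNilpotent_of_app_eq_zero hR x hx hspan (1 - a * b') (by
        change 𝟙 _ - b.app L ≫ (a : F ⟶ F).app L = 0
        rw [hb, ← hu, sub_eq_zero]
        exact u.mul_inv.symm)
      simpa using h2.isUnit_one_sub
    have h3 : IsUnit (b' * a) := by
      have h2 := c.isNilpotent_of_app_eq_zero hR x hx hspan (1 - b' * a) (by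
        change 𝟙 _ - (a : F ⟶ F).app L ≫ b.app L = 0
        rw [hb, ← hu, sub_eq_zero]
        exact u.inv_mul.symm)
      simpa using h2.isUnit_one_sub
    obtain ⟨v, hv⟩ := h1
    obtain ⟨w, hw⟩ := h3
    refine isUnit_iff_exists_and_exists.2 ⟨⟨b' * ↑v⁻¹, ?_⟩, ⟨↑w⁻¹ * b', ?_⟩⟩
    · rw [← mul_assoc, ← hv, Units.mul_inv]
    · rw [mul_assoc, ← hw, Units.inv_mul]
  refine ⟨fun {a b} hab => (hFL.isUnit_or_isUnit_of_add_one (a := (a : F ⟶ F).app L)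
    (b := (b : F ⟶ F).app L) ?_).imp (key a) (key b)⟩
  exact congrArg (fun α : F ⟶ F => α.app L) hab

end Copower

/-- If `F` takes `X` to `P ⊗ Hom(P, X)`, then the insertion `G → F ∘ G` given by the identity of `P`
is a section of the evaluation. -/
lemma Copower.inComp_counit {k : Type*} [Field k] {C : Type*} [Category C] [Preadditive C]
    [Linear k C] [∀ X Y : C, FiniteDimensional k (X ⟶ Y)] {P R : C}
    {F G : C ⥤ C} [F.Additive] [F.Linear k] [G.Additive] [G.Linear k]
    (c : Copower k P P F) (d : Copower k P R G) (X : C) :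
    (c.inComp d d (𝟙 P)).app X ≫ (c.natDesc (G := 𝟭 C) (𝟙 P)).app (G.obj X) = 𝟙 (G.obj X) := by
  refine d.hom_ext fun v => ?_
  rw [Copower.ins_inComp_assoc, Copower.ins_natDesc]
  simp

/-! ### The `2`-category of projective functors -/

section ProjMor

variable {k : Type u} [Field k] {A : Type u} [Ring A] [Algebra k A] [Module.Finite k A]
  {C : Type u} [SmallCategory C] [Preadditive C] [Linear k C]
  {ι : C ⥤ FGModuleCat.{u} A} [ι.IsEquivalence] [ι.Additive] [ι.Linear k]
  {n : ℕ} {e : Fin n → A}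

variable (k ι) in
/-- The functor underlying `projMor s t` takes `X` to a sum of copies of `Ae_s` indexed by a basis
of `Hom(Ae_t, X)`. -/
noncomputable def projMorCopower (he : IsPrimitiveDecomposition e) (s t : Fin n) :
    Copower k (projObj ι (e s)) (projObj ι (e t)) (projMor k ι e s t).obj :=
  projFunCopower k ι (e s) (he.2 t).1

instance (F : ProjMor k ι e) : F.obj.Additive := IsTwoCat.additive k F.property

instance (F : ProjMor k ι e) : F.obj.Linear k := IsTwoCat.linear F.property

lemma isLocalRing_end_projMor [IsAlgClosed k] (he : IsPrimitiveDecomposition e) (s t : Fin n) :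
    IsLocalRing (End (projMor k ι e s t)) := by
  have := finiteDimensional_hom_of_mod k ι
  obtain ⟨L, x, hx, hspan⟩ := exists_hom_one_dim (k := k) ι (he.2 t)
  exact isLocalRing_end_of_map (IsProjFun k ι e).ι ((projMorCopower k ι he s t).isLocalRing_end
    (isLocalRing_end_projObj k ι (he.2 s)) (isLocalRing_end_projObj k ι (he.2 t)) x hx hspan)

lemma isLocalRing_end_oneMor (hconn : IsConnectedAlg A) :
    IsLocalRing (End (oneMor k (IsProjFun k ι e))) :=
  isLocalRing_end_of_map (IsProjFun k ι e).ι (isLocalRing_end_id k ι hconn)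

variable (k ι e) in
/-- The generating `1`-morphisms: the identity and the functors of tensoring with
`Ae_s ⊗ e_tA`. -/
def genMor : ObjectProperty (ProjMor k ι e) := fun G =>
  G = oneMor k (IsProjFun k ι e) ∨ ∃ s t, G = projMor k ι e s t

lemma isSumOf_genMor (F : ProjMor k ι e) : IsSumOf (genMor k ι e) F := by
  obtain ⟨m, f, hf, ⟨d⟩⟩ := F.property.exists_sumDecomp
  let f' : Fin m → ProjMor k ι e := fun j => ⟨f j, IsSumOf.of_mem (hf j)⟩
  refine (SumDecomp.lift (f := f') d).isSumOf fun j => ?_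
  obtain h | ⟨s, t, h⟩ := hf j
  · exact Or.inl (ObjectProperty.FullSubcategory.ext h)
  · exact Or.inr ⟨s, t, ObjectProperty.FullSubcategory.ext h⟩

variable (k ι e) in
lemma hasFiniteBiproducts_projMor : HasFiniteBiproducts (ProjMor k ι e) := by
  have := hasFiniteBiproducts_of_mod k ι
  have : HasFiniteProducts C := inferInstance
  have : HasFiniteBiproducts (C ⥤ C) := HasFiniteBiproducts.of_hasFiniteProducts
  exact hasFiniteBiproducts_fullSubcategory _ fun _ h => h.flatten

lemma isLocalRing_end_of_genMor [IsAlgClosed k] (he : IsPrimitiveDecomposition e)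
    (hconn : IsConnectedAlg A) {F : ProjMor k ι e} (hF : genMor k ι e F) :
    IsLocalRing (End F) := by
  obtain rfl | ⟨s, t, rfl⟩ := hF
  · exact isLocalRing_end_oneMor hconn
  · exact isLocalRing_end_projMor he s t

lemma IsIndec.exists_genMor_iso {F : ProjMor k ι e} (hF : IsIndec F) :
    ∃ G, genMor k ι e G ∧ Nonempty (G ≅ F) :=
  have := hasFiniteBiproducts_projMor k ι e
  hF.exists_iso (isSumOf_genMor F)

lemma IsIndec.isLocalRing_projMor [IsAlgClosed k] (he : IsPrimitiveDecomposition e)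
    (hconn : IsConnectedAlg A) {F : ProjMor k ι e} (hF : IsIndec F) : IsLocalRing (End F) := by
  obtain ⟨G, hG, ⟨i⟩⟩ := hF.exists_genMor_iso
  exact isLocalRing_end_of_iso i (isLocalRing_end_of_genMor he hconn hG)

variable (k ι) in
/-- `F_st ∘ F_uv` is a sum of copies of `F_sv`; their number depends on `t` and `u` only. -/
noncomputable def compMorDecomp (he : IsPrimitiveDecomposition e) (s t u v : Fin n) :
    SumDecomp (fun _ : Fin (Module.finrank k (projObj ι (e t) ⟶ projObj ι (e u))) =>
      projMor k ι e s v) (compMor k (projMor k ι e s t) (projMor k ι e u v)) :=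
  have := finiteDimensional_hom_of_mod k ι
  SumDecomp.lift ((projMorCopower k ι he s t).compDecomp (projMorCopower k ι he u v)
    (projMorCopower k ι he s v) (Module.finBasis k _))

lemma finrank_end_projObj_pos (he : IsPrimitiveDecomposition e) (t : Fin n) :
    0 < Module.finrank k (projObj ι (e t) ⟶ projObj ι (e t)) := by
  have := finiteDimensional_hom_of_mod k ι (projObj ι (e t)) (projObj ι (e t))
  rw [Module.finrank_pos_iff_exists_ne_zero]
  exact ⟨𝟙 _, fun h => not_isZero_of_isLocalRing (isLocalRing_end_projObj k ι (he.2 t))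
    ((IsZero.iff_id_eq_zero _).2 h)⟩

variable (k ι e) in
/-- The counit `F_ss → Id`. -/
noncomputable def counitMor (he : IsPrimitiveDecomposition e) (s : Fin n) :
    projMor k ι e s s ⟶ oneMor k (IsProjFun k ι e) :=
  ObjectProperty.homMk ((projMorCopower k ι he s s).natDesc (G := 𝟭 C) (𝟙 _))

variable (k ι e) in
/-- A section `F_st → F_ss ∘ F_st` of the morphism induced by the counit. -/
noncomputable def sectionMor (he : IsPrimitiveDecomposition e) (s t : Fin n) :
    projMor k ι e s t ⟶ compMor k (projMor k ι e s s) (projMor k ι e s t) :=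
  have := finiteDimensional_hom_of_mod k ι
  ObjectProperty.homMk ((projMorCopower k ι he s s).inComp (projMorCopower k ι he s t)
    (projMorCopower k ι he s t) (𝟙 _))

lemma sectionMor_counitMor (he : IsPrimitiveDecomposition e) (s t : Fin n) :
    sectionMor k ι e he s t ≫ hcompMor k (counitMor k ι e he s) (𝟙 (projMor k ι e s t)) =
      𝟙 (projMor k ι e s t) := by
  have := finiteDimensional_hom_of_mod k ι
  ext X
  refine Eq.trans ?_ ((projMorCopower k ι he s s).inComp_counit (projMorCopower k ι he s t) X)
  exact congrArg (_ ≫ ·) (Category.comp_id _)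

end ProjMor

section LeftCells

variable {k : Type u} [Field k] {A : Type u} [Ring A] [Algebra k A] [Module.Finite k A]
  {C : Type u} [SmallCategory C] [Preadditive C] [Linear k C]
  {ι : C ⥤ FGModuleCat.{u} A} [ι.IsEquivalence] [ι.Additive] [ι.Linear k]
  {n : ℕ} {e : Fin n → A}

variable (k ι e) in
/-- Composition with `F` from the right, as an endofunctor of the category of `1`-morphisms. -/
def rightMul (F : ProjMor k ι e) : ProjMor k ι e ⥤ ProjMor k ι e where
  obj G := compMor k G F
  map β := ObjectProperty.homMk (Functor.whiskerLeft F.obj β.hom)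
  map_id G := by ext; simp [compMor]
  map_comp β γ := by ext; simp [compMor]

instance (F : ProjMor k ι e) : (rightMul k ι e F).Additive := ⟨by intros; ext; rfl⟩

lemma isSumOf_compMor_projMor (he : IsPrimitiveDecomposition e) (H : ProjMor k ι e) (u t : Fin n) :
    IsSumOf (fun G => ∃ s, G = projMor k ι e s t) (compMor k H (projMor k ι e u t)) := by
  refine IsSumOf.flatten ((isSumOf_genMor H).map (rightMul k ι e (projMor k ι e u t)) ?_)
  rintro _ (rfl | ⟨s, v, rfl⟩)
  · exact IsSumOf.of_mem ⟨u, rfl⟩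
  · exact (compMorDecomp k ι he s v u t).isSumOf fun _ => ⟨s, rfl⟩

lemma leftLE_projMor (he : IsPrimitiveDecomposition e) (s u t : Fin n) :
    LeftLE k (projMor k ι e u t) (projMor k ι e s t) :=
  have := hasFiniteBiproducts_projMor k ι e
  ⟨projMor k ι e s u, (compMorDecomp k ι he s u u t).isSummand
    ⟨0, finrank_end_projObj_pos he u⟩⟩

lemma isIndec_projMor [IsAlgClosed k] (he : IsPrimitiveDecomposition e) (s t : Fin n) :
    IsIndec (projMor k ι e s t) :=
  isIndec_of_isLocalRing (isLocalRing_end_projMor he s t)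

lemma isIndec_oneMor (hconn : IsConnectedAlg A) : IsIndec (oneMor k (IsProjFun k ι e)) :=
  isIndec_of_isLocalRing (isLocalRing_end_oneMor hconn)

/-- An indecomposable `1`-morphism above `F_ut` in the left preorder is some `F_st`. -/
lemma exists_iso_of_leftLE_projMor [IsAlgClosed k] (he : IsPrimitiveDecomposition e)
    (hconn : IsConnectedAlg A) {G : ProjMor k ι e} (hG : IsIndec G) {u t : Fin n}
    (h : LeftLE k (projMor k ι e u t) G) : ∃ s, Nonempty (G ≅ projMor k ι e s t) := by
  obtain ⟨H, hs⟩ := h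
  obtain ⟨r⟩ := hs.nonempty_retract
  obtain ⟨_, ⟨s, rfl⟩, ⟨r'⟩⟩ := (isSumOf_compMor_projMor he H u t).exists_retract
    (hG.isLocalRing_projMor he hconn) r
  exact ⟨s, nonempty_iso_of_retract r' (isLocalRing_end_projMor he s t) hG.1⟩

lemma mk_projMor_mem_cellL [IsAlgClosed k] (he : IsPrimitiveDecomposition e) (s t : Fin n) :
    Ind.mk (projMor k ι e s t) (isIndec_projMor he s t) ∈ cellL k ι e t :=
  ⟨_, _, rfl, leftLE_projMor he s t t, leftLE_projMor he t s t⟩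

lemma mem_cellL_iff [IsAlgClosed k] (he : IsPrimitiveDecomposition e)
    (hconn : IsConnectedAlg A) (t : Fin n) (c : Ind (ProjMor k ι e)) : c ∈ cellL k ι e t ↔
      ∃ s, c = Ind.mk (projMor k ι e s t) (isIndec_projMor he s t) := by
  constructor
  · rintro ⟨G, hG, rfl, h, -⟩
    obtain ⟨s, hs⟩ := exists_iso_of_leftLE_projMor he hconn hG h
    exact ⟨s, Ind.mk_eq_mk.2 hs⟩
  · rintro ⟨s, rfl⟩
    exact mk_projMor_mem_cellL he s t

/-- The values of `F_st` are projective, and not every object is. -/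
lemma isEmpty_oneMor_iso_projMor (he : IsPrimitiveDecomposition e)
    (hconn : IsConnectedAlg A) (hns : ¬ IsSimpleRing A) (s t : Fin n) :
    IsEmpty (oneMor k (IsProjFun k ι e) ≅ projMor k ι e s t) := by
  refine ⟨fun i => ?_⟩
  have := finiteDimensional_hom_of_mod k ι
  obtain ⟨X, hX⟩ := exists_not_projective k ι hconn hns
  have := projective_projObj k (ι := ι) (he.2 s).1
  exact hX (Projective.of_iso (((IsProjFun k ι e).ι.mapIso i.symm).app X)
    ((projMorCopower k ι he s t).projective X))

end LeftCells

/-! ### Ideals and `2`-representations -/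

section LinIdeal

variable {k : Type u} [Field k] {𝒳 : Type u} [SmallCategory 𝒳] [Preadditive 𝒳] [Linear k 𝒳]

lemma LinIdeal.proj_map_eq_zero_iff (I : LinIdeal k 𝒳) {X Y : 𝒳} (f : X ⟶ Y) :
    I.proj.map f = 0 ↔ f ∈ I.hom X Y := by
  rw [← I.proj.map_zero, CategoryTheory.Quotient.functor_map_eq_iff]
  change f - 0 ∈ _ ↔ _
  rw [sub_zero]

lemma LinIdeal.isZero_proj_iff (I : LinIdeal k 𝒳) (X : 𝒳) :
    IsZero (I.proj.obj X) ↔ 𝟙 X ∈ I.hom X X := by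
  rw [IsZero.iff_id_eq_zero, ← I.proj.map_id, I.proj_map_eq_zero_iff]

lemma mem_projIdeal_iff [HasFiniteBiproducts 𝒳] {X Y : 𝒳} (f : X ⟶ Y) :
    f ∈ (projIdeal k 𝒳).hom X Y ↔
      ∃ (Z : 𝒳) (_ : Projective Z) (g : X ⟶ Z) (h : Z ⟶ Y), f = g ≫ h := by
  have := hasZeroObject_of_hasFiniteBiproducts 𝒳
  have := hasBinaryBiproducts_of_finite_biproducts 𝒳
  refine ⟨fun hf => ?_, fun hf => Submodule.subset_span hf⟩
  induction hf using Submodule.span_induction with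
  | mem f hf => exact hf
  | zero => exact ⟨0, Projective.zero_projective, 0, 0, by simp⟩
  | add a b _ _ ha hb =>
    obtain ⟨Z, hZ, g, h, rfl⟩ := ha
    obtain ⟨Z', hZ', g', h', rfl⟩ := hb
    exact ⟨Z ⊞ Z', inferInstance, biprod.lift g g', biprod.desc h h', by simp⟩
  | smul r a _ ha =>
    obtain ⟨Z, hZ, g, h, rfl⟩ := ha
    exact ⟨Z, hZ, r • g, h, by simp⟩

lemma projective_of_id_mem_projIdeal [HasFiniteBiproducts 𝒳] {X : 𝒳}
    (h : 𝟙 X ∈ (projIdeal k 𝒳).hom X X) : Projective X := by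
  obtain ⟨Z, hZ, g, h, hgh⟩ := (mem_projIdeal_iff _).1 h
  exact projective_of_retract ⟨g, h, hgh.symm⟩

lemma id_mem_projIdeal (X : 𝒳) [hX : Projective X] : 𝟙 X ∈ (projIdeal k 𝒳).hom X X :=
  Submodule.subset_span ⟨X, hX, 𝟙 X, 𝟙 X, by simp⟩

end LinIdeal

section TwoReps

variable {k : Type u} [Field k] {C : Type u} [SmallCategory C] [Preadditive C] [Linear k C]
  {P : ObjectProperty (C ⥤ C)} [IsTwoCat k P]

/-- Direct sums of `1`-morphisms act by direct sums. -/
def SumDecomp.act {J : Type} [Fintype J] {f : J → P.FullSubcategory} {F : P.FullSubcategory}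
    (d : SumDecomp f F) (M : TwoRep k P) (X : M.carrier) :
    SumDecomp (fun j => (M.act.obj (f j)).obj X) ((M.act.obj F).obj X) :=
  (d.map M.act).map ((evaluation M.carrier M.carrier).obj X)

namespace TwoRep

variable {M N : TwoRep k P}

lemma InvIdeal.le_sum {S : Set M.InvIdeal} {I : M.InvIdeal} (hI : I ∈ S) (X Y : M.carrier) :
    I.hom X Y ≤ (InvIdeal.sum S).hom X Y :=
  le_iInf₂ fun _ hJ => hJ I hI X Y

lemma InvIdeal.sum_le {S : Set M.InvIdeal} {J : M.InvIdeal}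
    (hJ : ∀ I ∈ S, ∀ X Y : M.carrier, I.hom X Y ≤ J.hom X Y) (X Y : M.carrier) :
    (InvIdeal.sum S).hom X Y ≤ J.hom X Y :=
  iInf₂_le J hJ

lemma InvIdeal.gen_le {Q : ObjectProperty M.carrier} {J : M.InvIdeal}
    (hJ : ∀ X : M.carrier, Q X → 𝟙 X ∈ J.hom X X) (X Y : M.carrier) :
    (InvIdeal.gen Q).hom X Y ≤ J.hom X Y :=
  iInf₂_le J hJ

lemma InvIdeal.id_mem_gen {Q : ObjectProperty M.carrier} {X : M.carrier} (hX : Q X) :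
    𝟙 X ∈ (InvIdeal.gen Q).hom X X := by
  change _ ∈ ⨅ _, _
  simp only [Submodule.mem_iInf]
  exact fun J hJ => hJ X hX

lemma IsSubrep.of_iso [HasZeroObject M.carrier] {Q : ObjectProperty M.carrier} (hQ : M.IsSubrep Q)
    {X Y : M.carrier} (i : X ≅ Y) (hX : Q X) : Q Y :=
  hQ.summand _ _ (isSummand_of_iso i.symm) hX

lemma IsSubrep.mem_of_isIndec_mk {Q : ObjectProperty M.carrier} [HasZeroObject M.carrier]
    (hQ : M.IsSubrep Q) {X : M.carrier} {hX : IsIndec X} (h : Ind.mk X hX ∈ M.indIn Q) : Q X := by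
  obtain ⟨Y, hY, h1, h2⟩ := h
  obtain ⟨i⟩ := Ind.mk_eq_mk.1 h1
  exact hQ.of_iso i.symm h2

/-- The ideal generated by the identities of the objects of a subrepresentation consists of the
morphisms which factor through such objects. -/
lemma IsSubrep.exists_factor [HasFiniteBiproducts M.carrier] {Q : ObjectProperty M.carrier}
    (hQ : M.IsSubrep Q) {X Y : M.carrier} {f : X ⟶ Y} (hf : f ∈ (InvIdeal.gen Q).hom X Y) :
    ∃ (Z : M.carrier) (g : X ⟶ Z) (h : Z ⟶ Y), Q Z ∧ f = g ≫ h := by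
  have := hasZeroObject_of_hasFiniteBiproducts M.carrier
  have := hasBinaryBiproducts_of_finite_biproducts M.carrier
  let J : M.InvIdeal :=
    { hom := fun X Y =>
        { carrier := {f | ∃ (Z : M.carrier) (g : X ⟶ Z) (h : Z ⟶ Y), Q Z ∧ f = g ≫ h}
          zero_mem' := ⟨0, 0, 0, hQ.zero _ (isZero_zero _), by simp⟩
          add_mem' := by
            rintro _ _ ⟨Z, g, h, hZ, rfl⟩ ⟨Z', g', h', hZ', rfl⟩
            exact ⟨Z ⊞ Z', biprod.lift g g', biprod.desc h h',
              hQ.sum _ _ _ ⟨BinaryBiproduct.isBilimit Z Z'⟩ hZ hZ', by simp⟩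
          smul_mem' := by
            rintro r _ ⟨Z, g, h, hZ, rfl⟩
            exact ⟨Z, r • g, h, hZ, by simp⟩ }
      comp_left := by
        rintro X Y W f _ ⟨Z, g, h, hZ, rfl⟩
        exact ⟨Z, f ≫ g, h, hZ, by simp⟩
      comp_right := by
        rintro X Y W _ f ⟨Z, g, h, hZ, rfl⟩
        exact ⟨Z, g, h ≫ f, hZ, by simp⟩
      map_mem := by
        rintro F X Y _ ⟨Z, g, h, hZ, rfl⟩
        exact ⟨_, (M.act.obj F).map g, (M.act.obj F).map h, hQ.invariant F Z hZ, by simp⟩ }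
  exact InvIdeal.gen_le (J := J) (fun X hX => ⟨X, 𝟙 X, 𝟙 X, hX, by simp⟩) X Y hf

/-- The objects which vanish modulo the ideal generated by a subrepresentation are those of the
subrepresentation. -/
lemma IsSubrep.mem_of_id_mem_gen [HasFiniteBiproducts M.carrier] [IsIdempotentComplete M.carrier]
    {Q : ObjectProperty M.carrier} (hQ : M.IsSubrep Q) {X : M.carrier}
    (hX : 𝟙 X ∈ (InvIdeal.gen Q).hom X X) : Q X := by
  obtain ⟨Z, g, h, hZ, hgh⟩ := hQ.exists_factor hX
  exact hQ.summand _ _ (isSummand_of_retract ⟨g, h, hgh.symm⟩) hZ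

/-- Equivalences commute with the action, up to isomorphism. -/
def Equiv.actIso (E : M.Equiv N) (F : P.FullSubcategory) (X : M.carrier) :
    E.functor.obj ((M.act.obj F).obj X) ≅ (N.act.obj F).obj (E.functor.obj X) :=
  (E.η F).app X

lemma Equiv.isZero_iff (E : M.Equiv N) (X : M.carrier) : IsZero (E.functor.obj X) ↔ IsZero X := by
  have := E.isEquivalence
  have := E.additive
  refine ⟨fun h => ?_, fun h => E.functor.map_isZero h⟩
  rw [IsZero.iff_id_eq_zero] at h ⊢
  exact E.functor.map_injective (by rw [E.functor.map_id, h, E.functor.map_zero])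

lemma Equiv.isZero_act (E : M.Equiv N) {F : P.FullSubcategory}
    (h : ∀ Y : N.carrier, IsZero ((N.act.obj F).obj Y)) (X : M.carrier) :
    IsZero ((M.act.obj F).obj X) :=
  (E.isZero_iff _).1 ((h _).of_iso (E.actIso F X))

lemma isZero_of_isZero_sub {Q : ObjectProperty M.carrier} (hQ : M.IsInvariant Q)
    {X : M.carrier} (hX : Q X) (h : IsZero (show (M.sub Q hQ).carrier from ⟨X, hX⟩)) : IsZero X := by
  rw [IsZero.iff_id_eq_zero] at h ⊢
  exact congrArg (fun f => Q.ι.map f) h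

/-- If the action of `F` kills the representation on `Q`, then it kills the objects of `Q`. -/
lemma isZero_act_of_sub {Q : ObjectProperty M.carrier} (hQ : M.IsInvariant Q)
    (E : (M.sub Q hQ).Equiv N) {F : P.FullSubcategory}
    (h : ∀ Y : N.carrier, IsZero ((N.act.obj F).obj Y)) {X : M.carrier} (hX : Q X) :
    IsZero ((M.act.obj F).obj X) :=
  isZero_of_isZero_sub hQ (hQ F X hX) (E.isZero_act h ⟨X, hX⟩)

/-- If the action of `F` kills the quotient representation, then it takes values in `Q`. -/
lemma IsSubrep.act_mem_of_quot [HasFiniteBiproducts M.carrier] [IsIdempotentComplete M.carrier]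
    {Q : ObjectProperty M.carrier} (hQ : M.IsSubrep Q) (E : (M.quot (InvIdeal.gen Q)).Equiv N)
    {F : P.FullSubcategory} (h : ∀ Y : N.carrier, IsZero ((N.act.obj F).obj Y)) (X : M.carrier) :
    Q ((M.act.obj F).obj X) :=
  hQ.mem_of_id_mem_gen (((InvIdeal.gen Q).isZero_proj_iff _).1
    (E.isZero_act h ((InvIdeal.gen Q).proj.obj X)))

/-- Isomorphic `1`-morphisms act isomorphically. -/
def actMapIso (M : TwoRep k P) {F G : P.FullSubcategory} (i : F ≅ G) (X : M.carrier) :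
    (M.act.obj F).obj X ≅ (M.act.obj G).obj X :=
  (M.act.mapIso i).app X

end TwoRep

end TwoReps

/-! ### Extensions involving the cell `2`-representation of the identity -/

section Extensions

variable {k : Type u} [Field k] {A : Type u} [Ring A] [Algebra k A] [Module.Finite k A]
  {C : Type u} [SmallCategory C] [Preadditive C] [Linear k C]
  {ι : C ⥤ FGModuleCat.{u} A} [ι.IsEquivalence] [ι.Additive] [ι.Linear k]
  {n : ℕ} {e : Fin n → A}

/-- Projective functors preserve projective objects. -/
lemma projective_obj (he : IsPrimitiveDecomposition e) (F : ProjMor k ι e) (X : C)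
    [hX : Projective X] : Projective (F.obj.obj X) := by
  have := finiteDimensional_hom_of_mod k ι
  obtain ⟨m, f, hf, ⟨d⟩⟩ := F.property.exists_sumDecomp
  refine projective_of_sumDecomp (d.map ((evaluation C C).obj X)) fun j => ?_
  obtain h | ⟨s, t, h⟩ := hf j
  · rw [h]
    exact hX
  · rw [h]
    have := projective_projObj k (ι := ι) (he.2 s).1
    exact (projMorCopower k ι he s t).projective X

/-- The natural transformations which factor through projective objects at each object of `C`. -/
def stableIdeal (he : IsPrimitiveDecomposition e) :
    (leftIdealRep (k := k) (oneMor k (IsProjFun k ι e))).InvIdeal where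
  hom G G' :=
    { carrier := {f | ∀ X : C, f.hom.hom.app X ∈
        (projIdeal k C).hom (G.obj.obj.obj X) (G'.obj.obj.obj X)}
      zero_mem' := fun X => Submodule.zero_mem _
      add_mem' := fun hf hg X => Submodule.add_mem _ (hf X) (hg X)
      smul_mem' := fun r f hf X => Submodule.smul_mem _ r (hf X) }
  comp_left f g hg X := (projIdeal k C).comp_left _ (hg X)
  comp_right g hf X := (projIdeal k C).comp_right _ (hf X)
  map_mem := fun F G G' f hf X => by
    have := hasFiniteBiproducts_of_mod k ι
    obtain ⟨Z, hZ, a, b, hab⟩ := (mem_projIdeal_iff _).1 (hf X)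
    refine (mem_projIdeal_iff _).2 ⟨F.obj.obj Z, projective_obj he F Z, F.obj.map a, F.obj.map b, ?_⟩
    exact (congrArg F.obj.map hab).trans (F.obj.map_comp a b)

/-- The stable ideal contains no identity of a `1`-morphism `G` in the cell of the identity: if all
`G X` were projective, then so would be all `X`, being summands of the `H G X` for some `H`. -/
lemma stableIdeal_le_cellIdeal (he : IsPrimitiveDecomposition e) (hconn : IsConnectedAlg A)
    (hns : ¬ IsSimpleRing A) (G G' : (leftIdealRep (k := k) (oneMor k (IsProjFun k ι e))).carrier) :
    (stableIdeal he).hom G G' ≤ (cellIdeal (oneMor k (IsProjFun k ι e))).hom G G' := by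
  refine TwoRep.InvIdeal.le_sum ?_ G G'
  rintro G hG - ⟨H, hs⟩ h
  have := hasFiniteBiproducts_of_mod k ι
  obtain ⟨X, hX⟩ := exists_not_projective k ι hconn hns
  have hGX : Projective (G.obj.obj X) := projective_of_id_mem_projIdeal (k := k) (h X)
  obtain ⟨r⟩ := hs.nonempty_retract
  have : Projective (H.obj.obj (G.obj.obj X)) := projective_obj he H _
  exact hX (projective_of_retract (Y := H.obj.obj (G.obj.obj X))
    ((r.map (IsProjFun k ι e).ι).map ((evaluation C C).obj X)))

/-- The functors `F_st` kill the cell `2`-representation of the identity. -/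
lemma isZero_act_cellRep0 (he : IsPrimitiveDecomposition e) (hconn : IsConnectedAlg A)
    (hns : ¬ IsSimpleRing A) (s t : Fin n) (Y : (cellRep0 k ι e).carrier) :
    IsZero (((cellRep0 k ι e).act.obj (projMor k ι e s t)).obj Y) := by
  obtain ⟨G⟩ := Y
  have := finiteDimensional_hom_of_mod k ι
  refine ((cellIdeal (oneMor k (IsProjFun k ι e))).isZero_proj_iff _).2
    (stableIdeal_le_cellIdeal he hconn hns _ _ fun X => ?_)
  have := projective_projObj k (ι := ι) (he.2 s).1
  exact id_mem_projIdeal (hX := (projMorCopower k ι he s t).projective (G.obj.obj.obj X)) _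

/-- If `F_ss` kills `Y`, then there are no nonzero morphisms from an object `F_st X` to `Y`: the
counit `F_ss F_st X → F_st X` is a split epimorphism, and by naturality its composition with a
morphism `F_st X → Y` factors through `F_ss Y`. -/
lemma hom_eq_zero_of_isZero_act (he : IsPrimitiveDecomposition e)
    (M : TwoRep k (IsProjFun k ι e)) (s t : Fin n) (X Y : M.carrier)
    (hY : IsZero ((M.act.obj (projMor k ι e s s)).obj Y))
    (f : (M.act.obj (projMor k ι e s t)).obj X ⟶ Y) : f = 0 := by
  let j : compMor k (oneMor k (IsProjFun k ι e)) (projMor k ι e s t) ⟶ projMor k ι e s t := 𝟙 _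
  have h1 : sectionMor k ι e he s t ≫
      hcompMor k (counitMor k ι e he s) (𝟙 (projMor k ι e s t)) ≫ j = 𝟙 _ :=
    (congrArg (_ ≫ ·) (Category.comp_id _)).trans (sectionMor_counitMor he s t)
  have h2 := congrArg (fun α => (M.act.map α).app X) h1
  simp only [Functor.map_comp, NatTrans.comp_app, M.act_hcomp_app, Category.assoc,
    CategoryTheory.Functor.map_id, NatTrans.id_app, Category.id_comp] at h2
  have h3 : ∀ {Z : M.carrier} (g : (M.act.obj (oneMor k (IsProjFun k ι e))).obj Z ⟶ Y),
      (M.act.map (counitMor k ι e he s)).app Z ≫ g = 0 := by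
    intro Z g
    have h4 := (M.act.map (counitMor k ι e he s)).naturality (eqToHom (M.act_one_obj Z).symm ≫ g)
    rw [hY.eq_of_tgt ((M.act.obj (projMor k ι e s s)).map _) 0, zero_comp, M.act_one_map] at h4
    rw [← cancel_mono (eqToHom (M.act_one_obj Y).symm), zero_comp, h4]
    simp
  rw [← Category.id_comp f, ← h2]
  simp only [Category.assoc, h3, comp_zero]

/-- Whether `F_st` kills `X` does not depend on `s`: the functor `F_ut` is a summand of
`F_us ∘ F_st`. -/
lemma isZero_act_projMor (he : IsPrimitiveDecomposition e) (M : TwoRep k (IsProjFun k ι e))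
    (s u t : Fin n) (X : M.carrier) (h : IsZero ((M.act.obj (projMor k ι e s t)).obj X)) :
    IsZero ((M.act.obj (projMor k ι e u t)).obj X) := by
  have d := (compMorDecomp k ι he u s s t).act M X
  have r := d.retract ⟨0, finrank_end_projObj_pos he s⟩
  refine isZero_of_retract r ?_
  rw [M.act_comp_obj]
  exact Functor.map_isZero _ h

/-- An indecomposable summand in `Q` of `F X`, for an indecomposable `X` outside of `Q`, occurs only
if `F` is some `F_st`. -/
lemma exists_iso_projMor_of_isSummand [IsAlgClosed k] {M : TwoRep k (IsProjFun k ι e)}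
    {Q : ObjectProperty M.carrier} (hQ : M.IsSubrep Q) (hfin : IsFinitary k M.carrier)
    {F : ProjMor k ι e} (hF : IsIndec F) {X Y : M.carrier} (hX : IsIndec X) (hY : IsIndec Y)
    (hXQ : ¬ Q X) (hYQ : Q Y) (h : IsSummand Y ((M.act.obj F).obj X)) :
    ∃ s t, Nonempty (F ≅ projMor k ι e s t) := by
  have := hfin.additive
  have := hfin.idempotent_split
  have := hasZeroObject_of_hasFiniteBiproducts M.carrier
  obtain ⟨G, rfl | ⟨s, t, rfl⟩, ⟨i⟩⟩ := hF.exists_genMor_iso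
  · have h1 := h.of_iso (M.actMapIso i.symm X ≪≫ eqToIso (M.act_one_obj X))
    obtain ⟨r⟩ := h1.nonempty_retract
    obtain ⟨j⟩ := nonempty_iso_of_retract r (hX.isLocalRing k hfin.finite_hom) hY.1
    exact (hXQ (hQ.of_iso j hYQ)).elim
  · exact ⟨s, t, ⟨i.symm⟩⟩

lemma exists_of_mem_decoration {M : TwoRep k (IsProjFun k ι e)}
    {Q : ObjectProperty M.carrier} (hQ : M.IsSubrep Q) [HasZeroObject M.carrier]
    {c : Ind (ProjMor k ι e)} (hc : c ∈ M.decoration (M.indIn Q) (M.indIn Q)ᶜ) :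
    ∃ (F : ProjMor k ι e) (hF : IsIndec F) (X Y : M.carrier), c = Ind.mk F hF ∧ IsIndec X ∧
      IsIndec Y ∧ ¬ Q X ∧ Q Y ∧ IsSummand Y ((M.act.obj F).obj X) := by
  obtain ⟨F, hF, X, hX, Y, hY, rfl, h1, h2, h3⟩ := hc
  exact ⟨F, hF, X, Y, rfl, hX, hY, fun h => h1 ⟨X, hX, rfl, h⟩, hQ.mem_of_isIndec_mk h2, h3⟩

/-- There are no discrete extensions by the cell `2`-representation of the identity. -/
theorem dext_cellRep0_eq_empty [IsAlgClosed k] (he : IsPrimitiveDecomposition e)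
    (hconn : IsConnectedAlg A) (hns : ¬ IsSimpleRing A) (N : TwoRep k (IsProjFun k ι e)) :
    Dext N (cellRep0 k ι e) = ∅ := by
  rw [Set.eq_empty_iff_forall_notMem]
  rintro Θ ⟨⟨c, hc⟩, M, Q, hQ, hfin, -, ⟨_, _, rfl, rfl, -, -, rfl⟩, ⟨E⟩, -⟩
  have := hfin.additive
  have := hasZeroObject_of_hasFiniteBiproducts M.carrier
  obtain ⟨F, hF, X, Y, -, hX, hY, hXQ, hYQ, h⟩ := exists_of_mem_decoration hQ hc.2
  obtain ⟨s, t, ⟨i⟩⟩ := exists_iso_projMor_of_isSummand hQ hfin hF hX hY hXQ hYQ h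
  obtain ⟨r⟩ := (h.of_iso (M.actMapIso i X)).nonempty_retract
  refine hY.1 ((IsZero.iff_id_eq_zero Y).2 ?_)
  rw [← r.retract, hom_eq_zero_of_isZero_act he M s t X Y
    (TwoRep.isZero_act_of_sub hQ.invariant E (isZero_act_cellRep0 he hconn hns s s) hYQ) r.r,
    comp_zero]

/-- If all `F_st` take values in `Q`, then the decoration is a union of left cells: the class of
`F_st` belongs to it if and only if `F_tt` does not kill all indecomposable objects outside of
`Q`. -/
lemma decoration_eq_cellUnion [IsAlgClosed k] (he : IsPrimitiveDecomposition e)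
    (hconn : IsConnectedAlg A) {M : TwoRep k (IsProjFun k ι e)}
    {Q : ObjectProperty M.carrier} (hQ : M.IsSubrep Q) (hfin : IsFinitary k M.carrier)
    (hact : ∀ s t X, Q ((M.act.obj (projMor k ι e s t)).obj X)) :
    M.decoration (M.indIn Q) (M.indIn Q)ᶜ = cellUnion k ι e
      {t | ∃ X, IsIndec X ∧ ¬ Q X ∧ ¬ IsZero ((M.act.obj (projMor k ι e t t)).obj X)} := by
  have := hfin.additive
  have := hfin.idempotent_split
  have := hasZeroObject_of_hasFiniteBiproducts M.carrier
  ext c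
  simp only [cellUnion, Set.mem_iUnion, exists_prop]
  constructor
  · intro hc
    obtain ⟨F, hF, X, Y, rfl, hX, hY, hXQ, hYQ, h⟩ := exists_of_mem_decoration hQ hc
    obtain ⟨s, t, ⟨i⟩⟩ := exists_iso_projMor_of_isSummand hQ hfin hF hX hY hXQ hYQ h
    obtain ⟨r⟩ := (h.of_iso (M.actMapIso i X)).nonempty_retract
    exact ⟨t, ⟨X, hX, hXQ, fun h0 => hY.1 (isZero_of_retract r (isZero_act_projMor he M t s t X h0))⟩,
      (mem_cellL_iff he hconn t _).2 ⟨s, Ind.mk_eq_mk.2 ⟨i⟩⟩⟩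
  · rintro ⟨t, ⟨X, hX, hXQ, h0⟩, hc⟩
    obtain ⟨s, rfl⟩ := (mem_cellL_iff he hconn t _).1 hc
    obtain ⟨m, f, hf, ⟨d⟩⟩ := (isSumOf_isIndec k hfin.finite_hom
      ((M.act.obj (projMor k ι e s t)).obj X)).exists_sumDecomp
    obtain ⟨j, -⟩ : ∃ j, ¬ IsZero (f j) := by
      by_contra! h1
      exact h0 (isZero_act_projMor he M s t t X (d.isZero h1))
    refine ⟨_, isIndec_projMor he s t, X, hX, f j, hf j, rfl, fun h => hXQ (hQ.mem_of_isIndec_mk h),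
      ⟨f j, hf j, rfl, hQ.summand _ _ (d.isSummand j) (hact s t X)⟩, d.isSummand j⟩

/-- The discrete extensions with quotient the cell `2`-representation of the identity are unions of
left cells. -/
theorem dext_cellRep0_subset [IsAlgClosed k] (he : IsPrimitiveDecomposition e)
    (hconn : IsConnectedAlg A) (hns : ¬ IsSimpleRing A) (K : TwoRep k (IsProjFun k ι e)) :
    Dext (cellRep0 k ι e) K ⊆ {E | ∃ S : Set (Fin n), S.Nonempty ∧ E = cellUnion k ι e S} := by
  rintro Θ ⟨⟨c, hc⟩, M, Q, hQ, hfin, -, ⟨_, _, rfl, rfl, -, -, rfl⟩, -, ⟨E⟩⟩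
  have := hfin.additive
  have := hfin.idempotent_split
  have h1 := decoration_eq_cellUnion he hconn hQ hfin
    fun s t X => hQ.act_mem_of_quot E (isZero_act_cellRep0 he hconn hns s t) X
  refine ⟨{t | ∃ X, IsIndec X ∧ ¬ Q X ∧ ¬ IsZero ((M.act.obj (projMor k ι e t t)).obj X)}, ?_, ?_⟩
  · have h2 := hc.2
    rw [h1] at h2
    simp only [cellUnion, Set.mem_iUnion] at h2
    obtain ⟨t, ht, -⟩ := h2
    exact ⟨t, ht⟩
  · rw [← h1]
    ext d
    exact ⟨fun h => h.2, fun h => ⟨hc.1, h⟩⟩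

end Extensions

/-! ### Morphisms of `2`-representations -/

section Morphisms

variable {k : Type u} [Field k] {C : Type u} [SmallCategory C] [Preadditive C] [Linear k C]
  {P : ObjectProperty (C ⥤ C)} [IsTwoCat k P]

namespace TwoRep

variable {M N : TwoRep k P}

/-- Strong `2`-natural transformations of `2`-representations, given by additive `k`-linear
functors. -/
structure Hom (M N : TwoRep k P) where
  functor : M.carrier ⥤ N.carrier
  additive : functor.Additive
  linear : functor.Linear k
  η : ∀ F, M.act.obj F ⋙ functor ≅ functor ⋙ N.act.obj F
  naturality : ∀ {F G : P.FullSubcategory} (α : F ⟶ G) (X : M.carrier),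
    functor.map ((M.act.map α).app X) ≫ (η G).hom.app X =
      (η F).hom.app X ≫ (N.act.map α).app (functor.obj X)
  η_one : ∀ X : M.carrier, (η (oneMor k P)).hom.app X =
    eqToHom (by simp [act_one_obj])
  η_comp : ∀ (F G : P.FullSubcategory) (X : M.carrier), (η (compMor k F G)).hom.app X =
    eqToHom (by simp [act_comp_obj]) ≫ (η F).hom.app ((M.act.obj G).obj X) ≫
      (N.act.obj F).map ((η G).hom.app X) ≫ eqToHom (by simp [act_comp_obj])

attribute [instance] Hom.additive Hom.linear

lemma Hom.map_act_map (Φ : M.Hom N) (F : P.FullSubcategory) {X Y : M.carrier} (f : X ⟶ Y) :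
    Φ.functor.map ((M.act.obj F).map f) = (Φ.η F).hom.app X ≫
      (N.act.obj F).map (Φ.functor.map f) ≫ (Φ.η F).inv.app Y := by
  have := (Φ.η F).hom.naturality f
  dsimp at this
  rw [← reassoc_of% this]
  simp

/-- The kernel of a morphism. -/
def Hom.ker (Φ : M.Hom N) : M.InvIdeal where
  hom X Y := LinearMap.ker (Φ.functor.mapLinearMap k (X := X) (Y := Y))
  comp_left f g hg := by
    rw [LinearMap.mem_ker] at hg ⊢
    change Φ.functor.map g = 0 at hg
    change Φ.functor.map _ = 0
    rw [Functor.map_comp, hg, comp_zero]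
  comp_right g hf := by
    rw [LinearMap.mem_ker] at hf ⊢
    change Φ.functor.map _ = 0 at hf
    change Φ.functor.map _ = 0
    rw [Functor.map_comp, hf, zero_comp]
  map_mem F X Y f hf := by
    rw [LinearMap.mem_ker] at hf ⊢
    change Φ.functor.map _ = 0 at hf
    change Φ.functor.map _ = 0
    rw [Φ.map_act_map, hf, Functor.map_zero, zero_comp, comp_zero]

lemma Hom.mem_ker (Φ : M.Hom N) {X Y : M.carrier} {f : X ⟶ Y} :
    f ∈ Φ.ker.hom X Y ↔ Φ.functor.map f = 0 := Iff.rfl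

lemma InvIdeal.ext' {I J : M.InvIdeal} (h : ∀ X Y, I.hom X Y = J.hom X Y) : I = J := by
  obtain ⟨I, hI⟩ := I
  obtain ⟨J, hJ⟩ := J
  have : I = J := LinIdeal.ext (funext₂ h)
  subst this
  rfl

/-- The functor on the quotient by the kernel. -/
def Hom.kerLift (Φ : M.Hom N) : Φ.ker.Quot ⥤ N.carrier :=
  CategoryTheory.Quotient.lift Φ.ker.rel Φ.functor fun X Y f g h => by
    have h' : Φ.functor.map (f - g) = 0 := h
    rwa [Functor.map_sub, sub_eq_zero] at h'

/-- A full and essentially surjective morphism induces an equivalence from the quotient by its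
kernel. -/
def Hom.quotEquiv (Φ : M.Hom N) (hfull : Φ.functor.Full) (hess : Φ.functor.EssSurj) :
    (M.quot Φ.ker).Equiv N where
  functor := Φ.kerLift
  additive := ⟨by
    rintro ⟨X⟩ ⟨Y⟩ ⟨f⟩ ⟨g⟩
    exact Φ.functor.map_add⟩
  linear := ⟨by
    rintro ⟨X⟩ ⟨Y⟩ ⟨f⟩ a
    exact Φ.functor.map_smul a f⟩
  isEquivalence :=
    { faithful := ⟨by
        rintro ⟨X⟩ ⟨Y⟩ ⟨f⟩ ⟨g⟩ h
        apply CategoryTheory.Quotient.sound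
        have h' : Φ.functor.map f = Φ.functor.map g := h
        change Φ.functor.map (f - g) = 0
        rw [Functor.map_sub, h', sub_self]⟩
      full := ⟨by
        rintro ⟨X⟩ ⟨Y⟩ f
        obtain ⟨g, hg⟩ := Φ.functor.map_surjective (X := X) (Y := Y) f
        exact ⟨Φ.ker.proj.map g, hg⟩⟩
      essSurj := ⟨fun Y => by
        obtain ⟨X, hX⟩ := hess.mem_essImage Y
        exact ⟨Φ.ker.proj.obj X, hX⟩⟩ }
  η F := NatIso.ofComponents (fun X => (Φ.η F).app X.as) (by
    rintro ⟨X⟩ ⟨Y⟩ ⟨f⟩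
    exact (Φ.η F).hom.naturality f)
  naturality α X := Φ.naturality α X.as
  η_one X := Φ.η_one X.as
  η_comp F G X := Φ.η_comp F G X.as

lemma sub_hom_ext {Q : ObjectProperty M.carrier} {hQ : M.IsInvariant Q}
    {X Y : (M.sub Q hQ).carrier} {f g : X ⟶ Y} (h : f.hom = g.hom) : f = g :=
  Q.ι.map_injective h

lemma sub_eqToHom_hom {Q : ObjectProperty M.carrier} {hQ : M.IsInvariant Q}
    {X Y : (M.sub Q hQ).carrier} (h : X = Y) :
    (eqToHom h).hom = eqToHom (congrArg (fun Z : (M.sub Q hQ).carrier => Z.obj) h) := by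
  subst h
  rfl

lemma sub_eqToHom_comp_hom {Q : ObjectProperty M.carrier} {hQ : M.IsInvariant Q}
    {X X' Y Z Z' : (M.sub Q hQ).carrier} (h : X = X') (f : X' ⟶ Y) (g : Y ⟶ Z) (h' : Z = Z') :
    (eqToHom h ≫ f ≫ g ≫ eqToHom h').hom =
      eqToHom (congrArg (fun Z : (M.sub Q hQ).carrier => Z.obj) h) ≫ f.hom ≫ g.hom ≫
        eqToHom (congrArg (fun Z : (M.sub Q hQ).carrier => Z.obj) h') := by
  subst h h'
  simp
  rfl

/-- A morphism whose values lie in an invariant subcategory. -/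
def Hom.corestrict (Φ : M.Hom N) (Q : ObjectProperty N.carrier) (hQ : N.IsInvariant Q)
    (h : ∀ X, Q (Φ.functor.obj X)) : M.Hom (N.sub Q hQ) where
  functor := Q.lift Φ.functor h
  additive := ⟨by intros; exact sub_hom_ext Φ.functor.map_add⟩
  linear := ⟨by intros; exact sub_hom_ext (Φ.functor.map_smul _ _)⟩
  η F := NatIso.ofComponents (fun X => Q.isoMk ((Φ.η F).app X)) (by
    intro X Y f
    exact sub_hom_ext ((Φ.η F).hom.naturality f))
  naturality α X := sub_hom_ext (Φ.naturality α X)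
  η_one X := sub_hom_ext (by
    rw [sub_eqToHom_hom]
    exact Φ.η_one X)
  η_comp F G X := sub_hom_ext (by
    refine (Φ.η_comp F G X).trans ?_
    exact (sub_eqToHom_comp_hom (hQ := hQ)
      (X := (Q.lift Φ.functor h).obj ((M.act.obj (compMor k F G)).obj X))
      (X' := (Q.lift Φ.functor h).obj ((M.act.obj F).obj ((M.act.obj G).obj X)))
      (Y := ((N.sub Q hQ).act.obj F).obj ((Q.lift Φ.functor h).obj ((M.act.obj G).obj X)))
      (Z := ((N.sub Q hQ).act.obj F).obj (((N.sub Q hQ).act.obj G).obj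
        ((Q.lift Φ.functor h).obj X)))
      (Z' := ((N.sub Q hQ).act.obj (compMor k F G)).obj ((Q.lift Φ.functor h).obj X))
      _ _ _ _).symm)

lemma act_hcompMor_id_left (M : TwoRep k P) (F : P.FullSubcategory) {G G' : P.FullSubcategory}
    (f : G ⟶ G') (X : M.carrier) :
    (M.act.map (hcompMor k (𝟙 F) f)).app X ≫ eqToHom (M.act_comp_obj F G' X) =
      eqToHom (M.act_comp_obj F G X) ≫ (M.act.obj F).map ((M.act.map f).app X) := by
  rw [M.act_hcomp_app, M.act.map_id, NatTrans.id_app, Category.id_comp]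
  simp

lemma act_hcompMor_id_right (M : TwoRep k P) {F F' : P.FullSubcategory} (α : F ⟶ F')
    (G : P.FullSubcategory) (X : M.carrier) :
    (M.act.map (hcompMor k α (𝟙 G))).app X ≫ eqToHom (M.act_comp_obj F' G X) =
      eqToHom (M.act_comp_obj F G X) ≫ (M.act.map α).app ((M.act.obj G).obj X) := by
  rw [M.act_hcomp_app, M.act.map_id, NatTrans.id_app, CategoryTheory.Functor.map_id,
    Category.comp_id]
  simp

/-- Evaluation at an object `X`, as a morphism from a left ideal of `1`-morphisms. -/
def evalHom (M : TwoRep k P) (F₀ : P.FullSubcategory) (X : M.carrier) :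
    (leftIdealRep (k := k) F₀).Hom M where
  functor := ObjectProperty.ι _ ⋙ M.act ⋙ (evaluation _ _).obj X
  additive := ⟨by
    intro G G' f g
    exact congrArg (fun α => α.app X) (M.act.map_add (f := f.hom) (g := g.hom))⟩
  linear := ⟨by
    intro G G' f a
    exact congrArg (fun α => α.app X) (M.act.map_smul a f.hom)⟩
  η F := NatIso.ofComponents (fun G => eqToIso (M.act_comp_obj F G.obj X)) (by
    intro G G' f
    have h1 : (leftMul k P F).map f.hom = hcompMor k (𝟙 F) f.hom := by
      ext Y
      exact (Category.id_comp _).symm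
    refine Eq.trans ?_ (M.act_hcompMor_id_left F f.hom X)
    rw [← h1]
    rfl)
  naturality {F G} α H := by
    have h1 : (leftMulMap k P α).app H.obj = hcompMor k α (𝟙 H.obj) := by
      ext Y
      exact (Category.comp_id _).symm.trans (congrArg (_ ≫ ·) (G.obj.map_id _).symm)
    exact (congrArg (fun β : compMor k F H.obj ⟶ compMor k G H.obj => (M.act.map β).app X ≫
      eqToHom (M.act_comp_obj G H.obj X)) h1).trans (M.act_hcompMor_id_right α H.obj X)
  η_one G := rfl
  η_comp F G H := by
    have : ∀ {X₁ X₂ X₃ X₄ : M.carrier} (h₁ : X₁ = (M.act.obj F).obj X₂) (h₂ : X₂ = X₃)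
        (h₃ : (M.act.obj F).obj X₃ = X₄), eqToHom (by rw [h₁, h₂, h₃]) =
        eqToHom rfl ≫ eqToHom h₁ ≫ (M.act.obj F).map (eqToHom h₂) ≫ eqToHom h₃ := by
      rintro _ _ _ _ rfl rfl rfl
      simp
    exact this (M.act_comp_obj F (compMor k G H.obj) X) (M.act_comp_obj G H.obj X)
      (M.act_comp_obj F G _).symm

end TwoRep

/-- The kernel of a morphism from a left ideal is the ideal defining the cell
`2`-representation if it does not contain identities of `1`-morphisms in the cell, and every
morphism outside of it generates such an identity. -/
lemma cellIdeal_eq_ker {F₀ : P.FullSubcategory} {N : TwoRep k P}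
    (Φ : (leftIdealRep (k := k) F₀).Hom N)
    (h1 : ∀ (G : P.FullSubcategory) (hG : LeftLE k F₀ G), IsIndec G → LeftLE k G F₀ →
      ¬ IsZero (Φ.functor.obj ⟨G, hG⟩))
    (h2 : ∀ {X Y : (leftIdealRep (k := k) F₀).carrier} (f : X ⟶ Y), Φ.functor.map f ≠ 0 →
      ∃ (H G : P.FullSubcategory) (hG : LeftLE k F₀ G), IsIndec G ∧ LeftLE k G F₀ ∧
        ∃ (a : (show (leftIdealRep (k := k) F₀).carrier from ⟨G, hG⟩) ⟶
            ((leftIdealRep (k := k) F₀).act.obj H).obj X)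
          (b : ((leftIdealRep (k := k) F₀).act.obj H).obj Y ⟶ ⟨G, hG⟩),
          a ≫ ((leftIdealRep (k := k) F₀).act.obj H).map f ≫ b = 𝟙 _) :
    cellIdeal F₀ = Φ.ker := by
  refine TwoRep.InvIdeal.ext' fun X Y => le_antisymm ?_ ?_
  · refine TwoRep.InvIdeal.sum_le (fun I hI X Y f hf => ?_) X Y
    rw [TwoRep.Hom.mem_ker]
    by_contra h0
    -- a morphism of `I` outside of the kernel would put an excluded identity into `I`
    obtain ⟨H, G, hG, hi, hc, a, b, hab⟩ := h2 f h0
    refine hI G hG hi hc ?_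
    have := I.comp_left a (I.comp_right b (I.map_mem H hf))
    rw [hab] at this
    exact this
  · refine TwoRep.InvIdeal.le_sum ?_ X Y
    intro G hG hi hc h0
    refine h1 G hG hi hc ?_
    exact (IsZero.iff_id_eq_zero _).2 ((Φ.functor.map_id _).symm.trans h0)

/-- Recognition of the cell `2`-representation. -/
lemma nonempty_cellRep_equiv {F₀ : P.FullSubcategory} {N : TwoRep k P}
    (Φ : (leftIdealRep (k := k) F₀).Hom N) (hfull : Φ.functor.Full) (hess : Φ.functor.EssSurj)
    (h : cellIdeal F₀ = Φ.ker) : Nonempty ((cellRep F₀).Equiv N) := by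
  rw [cellRep, h]
  exact ⟨Φ.quotEquiv hfull hess⟩

end Morphisms

/-! ### Functors on direct sums -/

section Components

variable {𝒳 𝒴 : Type*} [Category 𝒳] [Preadditive 𝒳] [Category 𝒴] [Preadditive 𝒴] (Φ : 𝒳 ⥤ 𝒴)
  [Φ.Additive] {T : ObjectProperty 𝒳}

/-- Fullness can be checked on a class of objects whose direct sums are all objects. -/
lemma full_of_isSumOf (hT : ∀ X, IsSumOf T X)
    (h : ∀ X Y, T X → T Y → ∀ g : Φ.obj X ⟶ Φ.obj Y, ∃ f : X ⟶ Y, Φ.map f = g) : Φ.Full where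
  map_surjective {X Y} g := by
    obtain ⟨m, x, hx, ⟨d⟩⟩ := (hT X).exists_sumDecomp
    obtain ⟨m', y, hy, ⟨d'⟩⟩ := (hT Y).exists_sumDecomp
    choose f hf using fun j l => h _ _ (hx j) (hy l) (Φ.map (d.ι j) ≫ g ≫ Φ.map (d'.π l))
    refine ⟨∑ j, d.π j ≫ ∑ l, f j l ≫ d'.ι l, ?_⟩
    rw [(d.map Φ).eq_id_comp g, Φ.map_sum]
    refine Finset.sum_congr rfl fun j _ => ?_
    conv_rhs => rw [(d'.map Φ).eq_comp_id ((d.map Φ).ι j ≫ g)]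
    rw [Φ.map_comp, Φ.map_sum]
    refine congrArg _ (Finset.sum_congr rfl fun l _ => ?_)
    rw [Φ.map_comp, hf]
    simp

/-- A morphism with nonzero image has a component with nonzero image. -/
lemma exists_component_ne_zero (hT : ∀ X, IsSumOf T X) {X Y : 𝒳} (f : X ⟶ Y) (hf : Φ.map f ≠ 0) :
    ∃ (X' Y' : 𝒳) (i : X' ⟶ X) (p : Y ⟶ Y'), T X' ∧ T Y' ∧ Φ.map (i ≫ f ≫ p) ≠ 0 := by
  obtain ⟨m, x, hx, ⟨d⟩⟩ := (hT X).exists_sumDecomp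
  obtain ⟨m', y, hy, ⟨d'⟩⟩ := (hT Y).exists_sumDecomp
  by_contra! h
  refine hf ?_
  rw [d.eq_id_comp f, Φ.map_sum]
  refine Finset.sum_eq_zero fun j _ => ?_
  rw [d'.eq_comp_id (d.ι j ≫ f), Preadditive.comp_sum, Φ.map_sum]
  refine Finset.sum_eq_zero fun l _ => ?_
  have := h _ _ (d.ι j) (d'.π l) (hx j) (hy l)
  rw [Φ.map_comp, Category.assoc (d.ι j), Φ.map_comp, this, zero_comp,
    comp_zero]

/-- Two direct sums of the same family are isomorphic. -/
def SumDecomp.iso {J : Type} [Fintype J] {f : J → 𝒳} {X Y : 𝒳} (d : SumDecomp f X)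
    (d' : SumDecomp f Y) : X ≅ Y where
  hom := ∑ j, d.π j ≫ d'.ι j
  inv := ∑ j, d'.π j ≫ d.ι j
  hom_inv_id := by
    classical
    rw [Preadditive.sum_comp, ← d.total]
    refine Finset.sum_congr rfl fun j _ => ?_
    rw [Preadditive.comp_sum, Finset.sum_eq_single j]
    · rw [Category.assoc, reassoc_of% d'.ι_π j]
    · intro l _ hl
      rw [Category.assoc, reassoc_of% d'.ι_π_ne j l hl.symm, zero_comp, comp_zero]
    · simp
  inv_hom_id := by
    classical
    rw [Preadditive.sum_comp, ← d'.total]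
    refine Finset.sum_congr rfl fun j _ => ?_
    rw [Preadditive.comp_sum, Finset.sum_eq_single j]
    · rw [Category.assoc, reassoc_of% d.ι_π j]
    · intro l _ hl
      rw [Category.assoc, reassoc_of% d.ι_π_ne j l hl.symm, zero_comp, comp_zero]
    · simp

end Components

lemma IsSummand.biproduct {𝒳 : Type u} [SmallCategory 𝒳] [Preadditive 𝒳] [HasFiniteBiproducts 𝒳]
    {J : Type} [Fintype J] {X Y : J → 𝒳} (h : ∀ j, IsSummand (Y j) (X j)) :
    IsSummand (⨁ Y) (⨁ X) := by
  choose Z b hb i using h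
  let r : Retract (⨁ Y) (⨁ X) := ⟨biproduct.map fun j => (b j).inl ≫ (i j).some.hom,
    biproduct.map fun j => (i j).some.inv ≫ (b j).fst, by ext; simp⟩
  let s : Retract (⨁ Z) (⨁ X) := ⟨biproduct.map fun j => (b j).inr ≫ (i j).some.hom,
    biproduct.map fun j => (i j).some.inv ≫ (b j).snd, by ext; simp⟩
  have hrs : r.r ≫ r.i + s.r ≫ s.i = 𝟙 (⨁ X) := by
    apply biproduct.hom_ext'
    intro j
    have h2 := IsBilimit.binary_total (hb j).some
    have h3 : ((i j).some.inv ≫ (b j).fst) ≫ (b j).inl ≫ (i j).some.hom +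
        ((i j).some.inv ≫ (b j).snd) ≫ (b j).inr ≫ (i j).some.hom = 𝟙 _ := by
      have : (i j).some.inv ≫ ((b j).fst ≫ (b j).inl + (b j).snd ≫ (b j).inr) ≫ (i j).some.hom =
          𝟙 _ := by rw [h2, Category.id_comp, Iso.inv_hom_id]
      rw [← this]
      simp
    rw [Preadditive.comp_add]
    dsimp only [r, s]
    simp only [biproduct.ι_map_assoc, biproduct.ι_map, Category.comp_id]
    rw [← Category.assoc, ← Category.assoc ((i j).some.inv ≫ (b j).snd), ← Preadditive.add_comp,
      h3, Category.id_comp]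
  exact ⟨_, _, ⟨complBiconeIsBilimit r s hrs⟩, ⟨Iso.refl _⟩⟩

/-! ### Inverse equivalences -/

section Symm

variable {k : Type u} [Field k] {C : Type u} [SmallCategory C] [Preadditive C] [Linear k C]
  {P : ObjectProperty (C ⥤ C)} [IsTwoCat k P] {M N : TwoRep k P}

namespace TwoRep.Equiv

instance (E : M.Equiv N) : E.functor.IsEquivalence := E.isEquivalence

instance (E : M.Equiv N) : E.functor.Additive := E.additive

/-- The counit of the underlying equivalence of categories. -/
noncomputable def counit (E : M.Equiv N) (Y : N.carrier) :
    E.functor.obj (E.functor.inv.obj Y) ≅ Y :=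
  E.functor.asEquivalence.counitIso.app Y

lemma counit_naturality (E : M.Equiv N) {Y Z : N.carrier} (f : Y ⟶ Z) :
    E.functor.map (E.functor.inv.map f) ≫ (E.counit Z).hom = (E.counit Y).hom ≫ f :=
  E.functor.asEquivalence.counitIso.hom.naturality f

/-- The compatibility of the inverse functor with the action. -/
noncomputable def symmη (E : M.Equiv N) (F : P.FullSubcategory) (Y : N.carrier) :
    E.functor.inv.obj ((N.act.obj F).obj Y) ≅ (M.act.obj F).obj (E.functor.inv.obj Y) :=
  E.functor.preimageIso (E.counit _ ≪≫ (N.act.obj F).mapIso (E.counit Y).symm ≪≫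
    ((E.η F).app (E.functor.inv.obj Y)).symm)

lemma map_symmη (E : M.Equiv N) (F : P.FullSubcategory) (Y : N.carrier) :
    E.functor.map (E.symmη F Y).hom ≫ (E.η F).hom.app (E.functor.inv.obj Y) =
      (E.counit _).hom ≫ (N.act.obj F).map (E.counit Y).inv := by
  simp [symmη]

/-- Morphisms to an object of the form `F (E⁻¹ Y)` are determined by their images over `F Y`. This
reduces the coherence of the inverse to that of the equivalence. -/
lemma hom_ext_symm (E : M.Equiv N) {F : P.FullSubcategory} {X : M.carrier} {Y : N.carrier}
    {f g : X ⟶ (M.act.obj F).obj (E.functor.inv.obj Y)}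
    (h : E.functor.map f ≫ (E.η F).hom.app (E.functor.inv.obj Y) ≫
      (N.act.obj F).map (E.counit Y).hom = E.functor.map g ≫
        (E.η F).hom.app (E.functor.inv.obj Y) ≫ (N.act.obj F).map (E.counit Y).hom) : f = g := by
  apply E.functor.map_injective
  rwa [cancel_mono] at h

lemma map_symmη' (E : M.Equiv N) (F : P.FullSubcategory) (Y : N.carrier) :
    E.functor.map (E.symmη F Y).hom ≫ (E.η F).hom.app (E.functor.inv.obj Y) ≫
      (N.act.obj F).map (E.counit Y).hom = (E.counit _).hom := by
  rw [reassoc_of% E.map_symmη F Y, ← Functor.map_comp, Iso.inv_hom_id, CategoryTheory.Functor.map_id,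
    Category.comp_id]

lemma map_symmη'_assoc (E : M.Equiv N) (F : P.FullSubcategory) (Y : N.carrier) {Z : N.carrier}
    (h : (N.act.obj F).obj Y ⟶ Z) :
    E.functor.map (E.symmη F Y).hom ≫ (E.η F).hom.app (E.functor.inv.obj Y) ≫
      (N.act.obj F).map (E.counit Y).hom ≫ h = (E.counit _).hom ≫ h := by
  rw [← E.map_symmη' F Y]
  simp only [Category.assoc]

/-- The inverse of an equivalence of `2`-representations. -/
noncomputable def symm (E : M.Equiv N) : N.Equiv M where
  functor := E.functor.inv
  additive :=
    have : E.functor.asEquivalence.functor.Additive := E.additive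
    E.functor.asEquivalence.inverse_additive
  linear :=
    have : E.functor.asEquivalence.functor.Linear k := E.linear
    Equivalence.inverseLinear k E.functor.asEquivalence
  isEquivalence := inferInstance
  η F := NatIso.ofComponents (E.symmη F) (by
    intro Y Z f
    apply E.hom_ext_symm
    have h1 := (E.η F).hom.naturality (E.functor.inv.map f)
    dsimp at h1 ⊢
    rw [Functor.map_comp, Functor.map_comp, Category.assoc, Category.assoc, map_symmη',
      counit_naturality, reassoc_of% h1, ← Functor.map_comp, counit_naturality, Functor.map_comp,
      map_symmη'_assoc])
  naturality {F G} α Y := by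
    apply E.hom_ext_symm
    have h1 := E.naturality α (E.functor.inv.obj Y)
    dsimp
    rw [Functor.map_comp, Functor.map_comp, Category.assoc, Category.assoc, map_symmη',
      counit_naturality, reassoc_of% h1, ← NatTrans.naturality, map_symmη'_assoc]
  η_one Y := by
    apply E.hom_ext_symm
    have h1 := E.counit_naturality (eqToHom (N.act_one_obj Y))
    have h2 : (E.counit ((N.act.obj (oneMor k P)).obj Y)).hom =
        E.functor.map (E.functor.inv.map (eqToHom (N.act_one_obj Y))) ≫ (E.counit Y).hom ≫
          eqToHom (N.act_one_obj Y).symm := by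
      rw [reassoc_of% h1]
      simp
    dsimp
    rw [map_symmη', h2, E.η_one, N.act_one_map]
    simp [eqToHom_map]
  η_comp F G Y := by
    apply E.hom_ext_symm
    have h1 := E.counit_naturality (eqToHom (N.act_comp_obj F G Y))
    have h2 : (E.counit ((N.act.obj (compMor k F G)).obj Y)).hom =
        E.functor.map (E.functor.inv.map (eqToHom (N.act_comp_obj F G Y))) ≫
          (E.counit _).hom ≫ eqToHom (N.act_comp_obj F G Y).symm := by
      rw [reassoc_of% h1]
      simp
    have h3 := (E.η F).hom.naturality (E.symmη G Y).hom
    dsimp at h3 ⊢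
    rw [map_symmη', h2, E.η_comp, N.act_comp_map, ← E.map_symmη' F, ← E.map_symmη' G]
    simp only [Functor.map_comp, Category.assoc, eqToHom_map, eqToHom_trans_assoc, eqToHom_refl,
      Category.id_comp, reassoc_of% h3]

end TwoRep.Equiv

end Symm

/-! ### The cell `2`-representations and the defining `2`-representation -/

section NatRep

variable (k : Type u) [Field k] {C : Type u} [SmallCategory C] [Preadditive C] [Linear k C]
  (P : ObjectProperty (C ⥤ C)) [IsTwoCat k P]

/-- The defining `2`-representation: the action of the endofunctors in `P` on `C`. -/
def natRep : TwoRep k P where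
  carrier := C
  act := P.ι
  act_additive := inferInstance
  act_linear := inferInstance
  obj_additive F := IsTwoCat.additive k F.property
  obj_linear F := IsTwoCat.linear F.property
  act_one := rfl
  act_comp _ _ := rfl
  act_hcomp _ _ := ((Category.id_comp _).trans (Category.comp_id _)).symm

end NatRep

/-- If the component at `L` of a natural transformation `u` of copower functors is nonzero, then
composing `u` with a copower functor generates an identity. -/
lemma Copower.exists_comp_eq_id {k : Type*} [Field k] [IsAlgClosed k] {C : Type*} [Category C]
    [Preadditive C] [Linear k C] [∀ X Y : C, FiniteDimensional k (X ⟶ Y)] {P P' Q R : C}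
    {F F' K H : C ⥤ C} [F.Additive] [F.Linear k] [F'.Additive] [F'.Linear k] [K.Additive]
    [K.Linear k] [H.Additive] [H.Linear k] (c : Copower k P R F) (c' : Copower k P' R F')
    (d : Copower k Q P K) (h : Copower k Q R H) (hR : IsLocalRing (End R)) {L : C} (x : R ⟶ L)
    (hx : x ≠ 0) (hspan : ∀ y : R ⟶ L, ∃ r : k, y = r • x) (u : F ⟶ F') (hu : u.app L ≠ 0) :
    ∃ (a : H ⟶ F ⋙ K) (b : F' ⋙ K ⟶ H), a ≫ Functor.whiskerRight u K ≫ b = 𝟙 H := by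
  let g : P ⟶ P' := c.ins L x ≫ u.app L ≫ (c'.isoOfSpan x hx hspan).inv
  have hg : c.ins L x ≫ u.app L = g ≫ c'.ins L x := by
    have := (c'.isoOfSpan x hx hspan).inv_hom_id
    rw [isoOfSpan_hom] at this
    simp only [g, Category.assoc, this, Category.comp_id]
  have hg0 : g ≠ 0 := fun h0 => hu (c.hom_ext fun v => by
    obtain ⟨r, rfl⟩ := hspan v
    rw [map_smul, Linear.smul_comp, hg, h0, zero_comp, smul_zero, comp_zero])
  obtain ⟨φ, hφ⟩ := Module.Projective.exists_dual_eq_one k hg0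
  -- `z` is the identity at `L`, hence differs from the identity by a nilpotent endomorphism
  let a := d.inComp c h (𝟙 P)
  let b := d.outComp c' h φ
  let z : H ⟶ H := a ≫ Functor.whiskerRight u K ≫ b
  have hz : z.app L = 𝟙 _ := h.hom_ext fun v => by
    obtain ⟨r, rfl⟩ := hspan v
    have h1 : h.ins L x ≫ z.app L = h.ins L x := by
      change h.ins L x ≫ (d.inComp c h (𝟙 P)).app L ≫ K.map (u.app L) ≫ b.app L = _
      rw [ins_inComp_assoc, Category.id_comp, reassoc_of% d.ins_map, hg, ins_outComp, hφ, one_smul]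
    rw [map_smul, Linear.smul_comp, h1, Category.comp_id]
  have hn := h.isNilpotent_of_app_eq_zero hR x hx hspan (1 - (show End H from z)) (by
    change 𝟙 _ - z.app L = 0
    rw [hz, sub_self])
  obtain ⟨w, hw⟩ := hn.isUnit_one_sub
  rw [sub_sub_cancel] at hw
  refine ⟨(↑w⁻¹ : End H) ≫ a, b, ?_⟩
  have h2 : (show End H from z) * ↑w⁻¹ = 1 := by rw [← hw, Units.mul_inv]
  rw [Category.assoc]
  exact h2

section ProjRep

variable {k : Type u} [Field k] {A : Type u} [Ring A] [Algebra k A] [Module.Finite k A]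
  {C : Type u} [SmallCategory C] [Preadditive C] [Linear k C]
  {ι : C ⥤ FGModuleCat.{u} A} [ι.IsEquivalence] [ι.Additive] [ι.Linear k]
  {n : ℕ} {e : Fin n → A}

/-- The projective objects among the objects satisfying `R`. -/
def projProp {R : ObjectProperty C} (hR : (natRep k (IsProjFun k ι e)).IsInvariant R) :
    ObjectProperty ((natRep k (IsProjFun k ι e)).sub R hR).carrier :=
  fun X => Projective (C := C) X.obj

lemma isInvariant_projProp (he : IsPrimitiveDecomposition e) {R : ObjectProperty C}
    (hR : (natRep k (IsProjFun k ι e)).IsInvariant R) :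
    ((natRep k (IsProjFun k ι e)).sub R hR).IsInvariant (projProp hR) := fun F _ hX =>
  projective_obj (hX := hX) he F _

lemma exists_iso_of_retract_compMor (he : IsPrimitiveDecomposition e)
    [IsAlgClosed k] {G H : ProjMor k ι e} (hG : IsLocalRing (End G)) {u t : Fin n}
    (r : Retract G (compMor k H (projMor k ι e u t))) : ∃ s, Nonempty (G ≅ projMor k ι e s t) := by
  obtain ⟨_, ⟨s, rfl⟩, ⟨r'⟩⟩ := (isSumOf_compMor_projMor he H u t).exists_retract hG r
  exact ⟨s, nonempty_iso_of_retract r' (isLocalRing_end_projMor he s t)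
    (not_isZero_of_isLocalRing hG)⟩

variable (k ι) in
/-- The `1`-morphism `F_st` as an object of the left ideal generated by `F_tt`. -/
noncomputable def idealMor (he : IsPrimitiveDecomposition e) (s t : Fin n) :
    (leftIdealRep (k := k) (projMor k ι e t t)).carrier :=
  ⟨projMor k ι e s t, leftLE_projMor he s t t⟩

lemma isSumOf_idealMor [IsAlgClosed k] (he : IsPrimitiveDecomposition e)
    (hconn : IsConnectedAlg A) {t : Fin n}
    (X : (leftIdealRep (k := k) (projMor k ι e t t)).carrier) :
    IsSumOf (fun Z => ∃ s, Z = idealMor k ι he s t) X := by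
  obtain ⟨m, f, hf, ⟨d⟩⟩ := (isSumOf_genMor X.obj).exists_sumDecomp
  obtain ⟨H, hH⟩ := X.property
  obtain ⟨r⟩ := hH.nonempty_retract
  choose s i using fun j => exists_iso_of_retract_compMor he
    (isLocalRing_end_of_genMor he hconn (hf j)) ((d.retract j).trans r)
  let R : ObjectProperty (ProjMor k ι e) := fun G => LeftLE k (projMor k ι e t t) G
  let X' : R.FullSubcategory := ⟨X.obj, X.property⟩
  let f' : Fin m → R.FullSubcategory := fun j => ⟨projMor k ι e (s j) t, leftLE_projMor he (s j) t t⟩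
  have d' := SumDecomp.lift (X := X') (f := f')
    (d.congr (fun j => (i j).some) (Iso.refl _))
  exact d'.isSumOf fun j => ⟨s j, rfl⟩

lemma projective_obj_of_leftLE (he : IsPrimitiveDecomposition e) {t : Fin n} {G : ProjMor k ι e}
    (hG : LeftLE k (projMor k ι e t t) G) (X : C) : Projective (G.obj.obj X) := by
  have := finiteDimensional_hom_of_mod k ι
  obtain ⟨H, hH⟩ := hG
  obtain ⟨r⟩ := hH.nonempty_retract
  have := projective_projObj k (ι := ι) (he.2 t).1
  have := (projMorCopower k ι he t t).projective X
  have := projective_obj he H ((projMor k ι e t t).obj.obj X)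
  exact projective_of_retract (Y := H.obj.obj ((projMor k ι e t t).obj.obj X))
    ((r.map (IsProjFun k ι e).ι).map ((evaluation C C).obj X))

/-- Every projective object is a direct sum of objects `Ae_t`. -/
lemma isSumOf_projObj (k : Type u) [Field k] [Algebra k A] [Module.Finite k A] [Linear k C]
    (ι : C ⥤ FGModuleCat.{u} A) [ι.IsEquivalence] [ι.Additive] [ι.Linear k]
    (he : IsPrimitiveDecomposition e) (X : C) [Projective X] :
    IsSumOf (fun Z => ∃ t, Z = projObj ι (e t)) X := by
  have := isIdempotentComplete_of_mod k ι
  have hfin := finiteDimensional_hom_of_mod k ι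
  obtain ⟨W, hW, ⟨r⟩⟩ := exists_retract_of_projective (ι := ι) he k X
  obtain ⟨m, f, hf, ⟨d⟩⟩ := (isSumOf_isIndec k hfin X).exists_sumDecomp
  have h1 : ∀ j, ∃ t, Nonempty (f j ≅ projObj ι (e t)) := fun j => by
    obtain ⟨_, ⟨t, rfl⟩, ⟨r'⟩⟩ := hW.exists_retract ((hf j).isLocalRing k hfin)
      ((d.retract j).trans r)
    exact ⟨t, nonempty_iso_of_retract r' (isLocalRing_end_projObj k ι (he.2 t)) (hf j).1⟩
  choose t i using h1
  exact (d.congr (fun j => (i j).some) (Iso.refl _)).isSumOf fun j => ⟨t j, rfl⟩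

lemma leftLE_biproduct (he : IsPrimitiveDecomposition e) (t : Fin n)
    {J : Type} [Fintype J] (s : J → Fin n) [HasFiniteBiproducts (ProjMor k ι e)] :
    LeftLE k (projMor k ι e t t) (⨁ fun j => projMor k ι e (s j) t) := by
  have h1 := IsSummand.biproduct fun j =>
    (compMorDecomp k ι he (s j) t t t).isSummand ⟨0, finrank_end_projObj_pos he t⟩
  refine ⟨⨁ fun j => projMor k ι e (s j) t, h1.of_iso ?_⟩
  exact (SumDecomp.ofBiproduct _).iso ((SumDecomp.ofBiproduct fun j => projMor k ι e (s j) t).map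
    (rightMul k ι e (projMor k ι e t t)))

/-- Evaluation at `L`, as a morphism from the left ideal generated by `F_tt` to the projective
objects. -/
noncomputable def projEvalHom (he : IsPrimitiveDecomposition e) {R : ObjectProperty C}
    (hR : (natRep k (IsProjFun k ι e)).IsInvariant R) (hR' : ∀ X : C, Projective X → R X)
    (t : Fin n) (L : C) : (leftIdealRep (k := k) (projMor k ι e t t)).Hom
      (((natRep k (IsProjFun k ι e)).sub R hR).sub (projProp hR) (isInvariant_projProp he hR)) :=
  (((natRep k (IsProjFun k ι e)).evalHom (projMor k ι e t t) L).corestrict R hR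
    (fun G => hR' _ (projective_obj_of_leftLE he G.property L))).corestrict _ _
    (fun G => projective_obj_of_leftLE he G.property L)

section

variable (he : IsPrimitiveDecomposition e) {R : ObjectProperty C}
  (hR : (natRep k (IsProjFun k ι e)).IsInvariant R) (hR' : ∀ X : C, Projective X → R X)
  (t : Fin n) {L : C} (x : projObj ι (e t) ⟶ L) (hx : x ≠ 0)
  (hspan : ∀ y : projObj ι (e t) ⟶ L, ∃ r : k, y = r • x)

lemma projEvalHom_map_eq_iff {X Y : (leftIdealRep (k := k) (projMor k ι e t t)).carrier}
    (f : X ⟶ Y) (g : (projEvalHom he hR hR' t L).functor.obj X ⟶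
      (projEvalHom he hR hR' t L).functor.obj Y) :
    (projEvalHom he hR hR' t L).functor.map f = g ↔ f.hom.hom.app L = g.hom.hom :=
  ⟨fun h => h ▸ rfl, fun h => TwoRep.sub_hom_ext (TwoRep.sub_hom_ext h)⟩

include hx hspan in
/-- Every morphism between the values at `L` of the functors `F_st` is the component of a natural
transformation. -/
lemma full_projEvalHom [IsAlgClosed k] (hconn : IsConnectedAlg A) :
    (projEvalHom he hR hR' t L).functor.Full := by
  have := finiteDimensional_hom_of_mod k ι
  refine full_of_isSumOf _ (isSumOf_idealMor he hconn) ?_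
  rintro _ _ ⟨s, rfl⟩ ⟨s', rfl⟩ g
  obtain ⟨α, hα⟩ := (projMorCopower k ι he s t).exists_app_eq (projMorCopower k ι he s' t) x hx hspan
    g.hom.hom
  exact ⟨ObjectProperty.homMk (ObjectProperty.homMk α),
    (projEvalHom_map_eq_iff he hR hR' t _ g).2 hα⟩

include hx hspan in
lemma essSurj_projEvalHom : (projEvalHom he hR hR' t L).functor.EssSurj where
  mem_essImage Y := by
    have := hasFiniteBiproducts_projMor k ι e
    have : Projective (C := C) Y.obj.obj := Y.property
    obtain ⟨m, f, hf, ⟨d⟩⟩ := (isSumOf_projObj k ι he (Y.obj.obj : C)).exists_sumDecomp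
    choose s hs using hf
    obtain rfl : f = fun j => projObj ι (e (s j)) := funext hs
    let d' := (((SumDecomp.ofBiproduct fun j => projMor k ι e (s j) t).map (IsProjFun k ι e).ι).map
      ((evaluation C C).obj L)).congr
      (fun j => ((projMorCopower k ι he (s j) t).isoOfSpan x hx hspan).symm) (Iso.refl _)
    let G : ProjMor k ι e := ⨁ fun j => projMor k ι e (s j) t
    exact ⟨⟨G, leftLE_biproduct he t s⟩,
      ⟨ObjectProperty.isoMk _ (ObjectProperty.isoMk _ (d'.iso d))⟩⟩

include hx hspan in
/-- A morphism with nonzero value at `L` generates the identity of `F_tt`. -/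
lemma exists_id_of_projEvalHom_map_ne_zero [IsAlgClosed k] (hconn : IsConnectedAlg A)
    {X Y : (leftIdealRep (k := k) (projMor k ι e t t)).carrier} (f : X ⟶ Y)
    (hf : (projEvalHom he hR hR' t L).functor.map f ≠ 0) :
    ∃ (H : ProjMor k ι e)
      (a : idealMor k ι he t t ⟶ ((leftIdealRep (k := k) (projMor k ι e t t)).act.obj H).obj X)
      (b : ((leftIdealRep (k := k) (projMor k ι e t t)).act.obj H).obj Y ⟶ idealMor k ι he t t),
      a ≫ ((leftIdealRep (k := k) (projMor k ι e t t)).act.obj H).map f ≫ b = 𝟙 _ := by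
  have := finiteDimensional_hom_of_mod k ι
  obtain ⟨_, _, i, p, ⟨s, rfl⟩, ⟨s', rfl⟩, hu⟩ :=
    exists_component_ne_zero _ (isSumOf_idealMor he hconn) f hf
  obtain ⟨a, b, hab⟩ := (projMorCopower k ι he s t).exists_comp_eq_id (projMorCopower k ι he s' t)
    (projMorCopower k ι he t s) (projMorCopower k ι he t t) (isLocalRing_end_projObj k ι (he.2 t))
    x hx hspan (i ≫ f ≫ p).hom.hom
    (fun h0 => hu ((projEvalHom_map_eq_iff he hR hR' t _ 0).2 h0))
  let H := (leftIdealRep (k := k) (projMor k ι e t t)).act.obj (projMor k ι e t s)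
  let a' : idealMor k ι he t t ⟶ H.obj (idealMor k ι he s t) :=
    ObjectProperty.homMk (ObjectProperty.homMk a)
  let b' : H.obj (idealMor k ι he s' t) ⟶ idealMor k ι he t t :=
    ObjectProperty.homMk (ObjectProperty.homMk b)
  have h1 : a' ≫ H.map (i ≫ f ≫ p) ≫ b' = 𝟙 _ :=
    TwoRep.sub_hom_ext ((IsProjFun k ι e).ι.map_injective hab)
  refine ⟨projMor k ι e t s, a' ≫ H.map i, H.map p ≫ b', ?_⟩
  rw [← h1]
  simp [H]

end

end ProjRep

lemma TwoRep.isZero_sub_iff {k : Type u} [Field k] {C : Type u} [SmallCategory C] [Preadditive C]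
    [Linear k C] {P : ObjectProperty (C ⥤ C)} [IsTwoCat k P] {M : TwoRep k P}
    {Q : ObjectProperty M.carrier} {hQ : M.IsInvariant Q} (X : (M.sub Q hQ).carrier) :
    IsZero X ↔ IsZero X.obj := by
  rw [IsZero.iff_id_eq_zero, IsZero.iff_id_eq_zero]
  exact ⟨fun h => congrArg (fun f => f.hom) h, fun h => TwoRep.sub_hom_ext h⟩

section CellRepAt

variable {k : Type u} [Field k] [IsAlgClosed k] {A : Type u} [Ring A] [Algebra k A]
  [Module.Finite k A] {C : Type u} [SmallCategory C] [Preadditive C] [Linear k C]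
  {ι : C ⥤ FGModuleCat.{u} A} [ι.IsEquivalence] [ι.Additive] [ι.Linear k]
  {n : ℕ} {e : Fin n → A}

/-- The cell `2`-representation of `L_i` is the action of projective functors on the projective
objects of `C`, by evaluation at the object `L` of `exists_hom_one_dim`, where `F_si` takes the
value `Ae_s`. -/
theorem nonempty_cellRepAt_equiv (he : IsPrimitiveDecomposition e) (hconn : IsConnectedAlg A)
    {R : ObjectProperty C} (hR : (natRep k (IsProjFun k ι e)).IsInvariant R)
    (hR' : ∀ X : C, Projective X → R X) (i : Fin n) : Nonempty ((cellRepAt k ι e i).Equiv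
      (((natRep k (IsProjFun k ι e)).sub R hR).sub (projProp hR) (isInvariant_projProp he hR))) := by
  have := finiteDimensional_hom_of_mod k ι
  obtain ⟨L, x, hx, hspan⟩ := exists_hom_one_dim (k := k) ι (he.2 i)
  refine nonempty_cellRep_equiv (projEvalHom he hR hR' i L)
    (full_projEvalHom he hR hR' i x hx hspan hconn) (essSurj_projEvalHom he hR hR' i x hx hspan)
    (cellIdeal_eq_ker _ ?_ ?_)
  · intro G hG hi _ h0
    obtain ⟨s, ⟨j⟩⟩ := exists_iso_of_leftLE_projMor he hconn hi hG
    have h1 : IsZero (G.obj.obj L) := (TwoRep.isZero_sub_iff _).1 ((TwoRep.isZero_sub_iff _).1 h0)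
    refine not_isZero_of_isLocalRing (isLocalRing_end_projObj k ι (he.2 s)) (h1.of_iso ?_)
    exact (projMorCopower k ι he s i).isoOfSpan x hx hspan ≪≫
      (((IsProjFun k ι e).ι.mapIso j).app L).symm
  · intro X Y f hf
    obtain ⟨H, a, b, hab⟩ := exists_id_of_projEvalHom_map_ne_zero he hR hR' i x hx hspan hconn f hf
    exact ⟨H, projMor k ι e i i, leftLE_projMor he i i i, isIndec_projMor he i i,
      leftLE_projMor he i i i, a, b, hab⟩

/-- If all `F_ss` kill `X`, then `Hom(Ae_s, X)` is zero for all `s`. -/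
lemma isZero_of_isZero_projMor (he : IsPrimitiveDecomposition e) (X : C)
    (h : ∀ s, IsZero ((projMor k ι e s s).obj.obj X)) : IsZero X := by
  have := finiteDimensional_hom_of_mod k ι
  rw [IsZero.iff_id_eq_zero]
  refine hom_ext_projObj (ι := ι) he fun s v => ?_
  rw [((projMorCopower k ι he s s).isZero_iff (not_isZero_of_isLocalRing
    (isLocalRing_end_projObj k ι (he.2 s)))).1 (h s) v, zero_comp, zero_comp]

lemma isInvariant_top (M : TwoRep k (IsProjFun k ι e)) : M.IsInvariant fun _ => True :=
  fun _ _ _ => trivial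

/-- An object of the cell `2`-representation of `L_i` which is killed by all `F_ss` is zero. -/
lemma isZero_of_isZero_act_cellRepAt (he : IsPrimitiveDecomposition e) (hconn : IsConnectedAlg A)
    (i : Fin n) (Z : (cellRepAt k ι e i).carrier)
    (hZ : ∀ s, IsZero (((cellRepAt k ι e i).act.obj (projMor k ι e s s)).obj Z)) : IsZero Z := by
  have := finiteDimensional_hom_of_mod k ι
  obtain ⟨E⟩ := nonempty_cellRepAt_equiv he hconn
    (isInvariant_top (natRep k (IsProjFun k ι e))) (fun _ _ => trivial) i
  refine (E.isZero_iff Z).1 ?_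
  have h1 : IsZero (C := C) (E.functor.obj Z).obj.obj := isZero_of_isZero_projMor he _ fun s =>
    (TwoRep.isZero_sub_iff _).1 ((TwoRep.isZero_sub_iff _).1
      (((E.isZero_iff _).2 (hZ s)).of_iso (E.actIso (projMor k ι e s s) Z).symm))
  exact (TwoRep.isZero_sub_iff _).2 ((TwoRep.isZero_sub_iff _).2 h1)

end CellRepAt

/-! ### Extensions of a cell `2`-representation by itself -/

section General

lemma isLocalRing_end_of_full {𝒳 𝒴 : Type*} [Category 𝒳] [Category 𝒴] [Preadditive 𝒳]
    [Preadditive 𝒴] (Φ : 𝒳 ⥤ 𝒴) [Φ.Additive] [Φ.Full] {X : 𝒳}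
    (h : IsLocalRing (End X)) (h0 : ¬ IsZero (Φ.obj X)) : IsLocalRing (End (Φ.obj X)) := by
  have : Nontrivial (End (Φ.obj X)) := ⟨⟨1, 0, fun h1 => h0 ((IsZero.iff_id_eq_zero _).2 h1)⟩⟩
  refine ⟨fun {a b} hab => ?_⟩
  obtain ⟨a', ha'⟩ := Φ.map_surjective (X := X) (Y := X) a
  have hb : Φ.map (𝟙 X - a') = b := by
    rw [Φ.map_sub, Φ.map_id, ha']
    exact sub_eq_of_eq_add' hab.symm
  have key : ∀ c : End X, IsUnit c → IsUnit (M := End (Φ.obj X)) (Φ.map c) := by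
    rintro _ ⟨u, rfl⟩
    refine ⟨⟨Φ.map (show X ⟶ X from (u : End X)), Φ.map (show X ⟶ X from (↑u⁻¹ : End X)), ?_, ?_⟩, rfl⟩
    · refine (Φ.map_comp _ _).symm.trans ((congrArg (fun c => Φ.map c) u.mul_inv).trans (Φ.map_id X))
    · refine (Φ.map_comp _ _).symm.trans ((congrArg (fun c => Φ.map c) u.inv_mul).trans (Φ.map_id X))
  obtain h1 | h1 := h.isUnit_or_isUnit_of_add_one (a := (show End X from a'))
    (b := (show End X from 𝟙 X - a')) (add_sub_cancel a' (𝟙 X))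
  · exact Or.inl (ha' ▸ key _ h1)
  · exact Or.inr (hb ▸ key _ h1)

/-- The direct sum decomposition obtained from one of a member and a complement. -/
def SumDecomp.option {𝒳 : Type*} [Category 𝒳] [Preadditive 𝒳] {J : Type} [Fintype J] {f : J → 𝒳}
    {V B U : 𝒳} (d : SumDecomp f V) (r : Retract V U) (s : Retract B U)
    (h : r.r ≫ r.i + s.r ≫ s.i = 𝟙 U) : SumDecomp (fun o : Option J => o.elim B f) U where
  ι o := match o with
    | none => s.i
    | some j => d.ι j ≫ r.i
  π o := match o with
    | none => s.r
    | some j => r.r ≫ d.π j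
  ι_π := by
    rintro (_ | j)
    · exact s.retract
    · simp [d.ι_π]
  ι_π_ne := by
    have h1 : r.i ≫ s.r = 0 := (complBicone r s h).inl_snd
    have h2 : s.i ≫ r.r = 0 := (complBicone r s h).inr_fst
    rintro (_ | j) (_ | l) hjl
    · exact (hjl rfl).elim
    · change s.i ≫ r.r ≫ d.π l = 0
      rw [reassoc_of% h2, zero_comp]
    · change (d.ι j ≫ r.i) ≫ s.r = 0
      rw [Category.assoc, h1, comp_zero]
    · change (d.ι j ≫ r.i) ≫ r.r ≫ d.π l = 0
      rw [Category.assoc, r.retract_assoc, d.ι_π_ne j l (fun h' => hjl (congrArg some h'))]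
  total := by
    rw [Fintype.sum_option, add_comm, ← h]
    congr 1
    have : r.r ≫ (∑ j, d.π j ≫ d.ι j) ≫ r.i = r.r ≫ r.i := by rw [d.total, Category.id_comp]
    rw [← this, Preadditive.sum_comp, Preadditive.comp_sum]
    exact Finset.sum_congr rfl fun j _ => by simp

end General

section SelfExt

variable {k : Type u} [Field k] [IsAlgClosed k] {A : Type u} [Ring A] [Algebra k A]
  [Module.Finite k A] {C : Type u} [SmallCategory C] [Preadditive C] [Linear k C]
  {ι : C ⥤ FGModuleCat.{u} A} [ι.IsEquivalence] [ι.Additive] [ι.Linear k]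
  {n : ℕ} {e : Fin n → A} {M : TwoRep k (IsProjFun k ι e)} {Q : ObjectProperty M.carrier}

section

variable (hQ : M.IsSubrep Q) (hfin : IsFinitary k M.carrier)
  (Φ : M.carrier ⥤ C) [Φ.Additive] [Φ.Full]
  (hker : ∀ {X Y : M.carrier} (f : X ⟶ Y), Φ.map f = 0 ↔
    f ∈ (TwoRep.InvIdeal.gen Q).hom X Y)

include hQ hfin hker in
lemma mem_of_isZero_map {X : M.carrier} (h : IsZero (Φ.obj X)) : Q X := by
  have := hfin.additive
  have := hfin.idempotent_split
  refine hQ.mem_of_id_mem_gen ((hker _).1 ?_)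
  rw [Φ.map_id, ← IsZero.iff_id_eq_zero]
  exact h

include hker in
lemma isZero_map_of_mem {X : M.carrier} (h : Q X) : IsZero (Φ.obj X) := by
  rw [IsZero.iff_id_eq_zero, ← Φ.map_id]
  exact (hker _).2 (TwoRep.InvIdeal.id_mem_gen h)

include hQ hfin hker in
lemma exists_iso_projObj_of_isIndec (he : IsPrimitiveDecomposition e)
    (hproj : ∀ X, Projective (Φ.obj X)) {X : M.carrier} (hX : IsIndec X) (hXQ : ¬ Q X) :
    ∃ s, Nonempty (Φ.obj X ≅ projObj ι (e s)) := by
  have := hfin.idempotent_split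
  have h0 : ¬ IsZero (Φ.obj X) := fun h => hXQ (mem_of_isZero_map hQ hfin Φ hker h)
  have hloc := isLocalRing_end_of_full Φ (hX.isLocalRing k hfin.finite_hom) h0
  have := hproj X
  obtain ⟨_, ⟨s, rfl⟩, ⟨r⟩⟩ :=
    (isSumOf_projObj k ι he (Φ.obj X)).exists_retract hloc (Retract.refl _)
  exact ⟨s, nonempty_iso_of_retract r (isLocalRing_end_projObj k ι (he.2 s)) h0⟩

include hker in
/-- An object with local endomorphism ring in the image of `Φ` is the image of an indecomposable
object outside of `Q`: decompose a preimage. -/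
lemma exists_isIndec_lift (hfin : IsFinitary k M.carrier) {Z : C} (hZ : IsLocalRing (End Z))
    {X : M.carrier} (i : Φ.obj X ≅ Z) :
    ∃ Y, IsIndec Y ∧ ¬ Q Y ∧ Nonempty (Φ.obj Y ≅ Z) := by
  have hZ0 := not_isZero_of_isLocalRing hZ
  obtain ⟨m, f, hf, ⟨d⟩⟩ := (isSumOf_isIndec k hfin.finite_hom X).exists_sumDecomp
  obtain ⟨j, ⟨r⟩⟩ := (d.map Φ).exists_retract hZ (Retract.ofIso i.symm)
  have h0 : ¬ IsZero (Φ.obj (f j)) := fun h => hZ0 (isZero_of_retract r h)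
  exact ⟨f j, hf j, fun h => h0 (isZero_map_of_mem Φ hker h),
    nonempty_iso_of_retract (((d.map Φ).retract j).trans (Retract.ofIso i)) hZ h0⟩

include hQ hfin hker in
/-- If `U` becomes a direct sum of copies of the indecomposable object `X` modulo `Q`, then it is the
direct sum of copies of `X` and of an object in `Q`. -/
lemma exists_sumDecomp_option {X : M.carrier} (hX : IsIndec X) (hXQ : ¬ Q X) {U : M.carrier} {m : ℕ}
    (d : SumDecomp (fun _ : Fin m => Φ.obj X) (Φ.obj U)) : ∃ B, Q B ∧
      Nonempty (SumDecomp (fun o : Option (Fin m) => o.elim B fun _ => X) U) := by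
  have := hfin.additive
  have := hfin.idempotent_split
  have := hasZeroObject_of_hasFiniteBiproducts M.carrier
  let dV := SumDecomp.ofBiproduct (fun _ : Fin m => X)
  let i := d.iso (dV.map Φ)
  obtain ⟨f, hf⟩ := Φ.map_surjective i.hom
  obtain ⟨g, hg⟩ := Φ.map_surjective i.inv
  have hV : ∀ p : (⨁ fun _ : Fin m => X) ⟶ (⨁ fun _ : Fin m => X), p ≫ p = p →
      p ∈ (TwoRep.InvIdeal.gen Q).hom _ _ → p = 0 := by
    intro p hp hpI
    -- the image `B` of `p` lies in `Q`, and its indecomposable summands are isomorphic to `X`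
    obtain ⟨B, j, q, h1, h2⟩ := IsIdempotentComplete.idempotents_split _ p hp
    have hB : Q B := by
      refine hQ.mem_of_id_mem_gen ?_
      have := (TwoRep.InvIdeal.gen Q).comp_left j ((TwoRep.InvIdeal.gen Q).comp_right q hpI)
      rw [← h2] at this
      simpa [h1, reassoc_of% h1] using this
    obtain ⟨l, b, hb, ⟨dB⟩⟩ := (isSumOf_isIndec k hfin.finite_hom B).exists_sumDecomp
    have h0 : IsZero B := dB.isZero fun a => by
      obtain ⟨_, ⟨r⟩⟩ := dV.exists_retract ((hb a).isLocalRing k hfin.finite_hom)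
        ((dB.retract a).trans ⟨j, q, h1⟩)
      obtain ⟨i⟩ := nonempty_iso_of_retract r (hX.isLocalRing k hfin.finite_hom) (hb a).1
      exact (hXQ (hQ.of_iso i (hQ.summand _ _ (dB.isSummand a) hB))).elim
    rw [← h2, h0.eq_of_tgt q 0, zero_comp]
  obtain ⟨r, B, s, hrs, hB⟩ := exists_split_of_iso_mod hfin.finite_hom
    (TwoRep.InvIdeal.gen Q).toLinIdeal hV f g
    ((hker _).1 (by rw [Φ.map_sub, Φ.map_comp, hf, hg, Iso.inv_hom_id, Φ.map_id, sub_self]))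
    ((hker _).1 (by rw [Φ.map_sub, Φ.map_comp, hf, hg, Iso.hom_inv_id, Φ.map_id, sub_self]))
  exact ⟨B, hQ.mem_of_id_mem_gen hB, ⟨dV.option r s hrs⟩⟩

end

end SelfExt

/-- Summing the relations over all indices, the left-hand sides and the first terms on the
right-hand sides have the same total. -/
lemma eq_zero_of_forall_mul_eq_add {n : ℕ} (c : Fin n → Fin n → ℕ) (b : Fin n → Fin n → Fin n → ℕ)
    (z : Fin n → Fin n → Fin n → Fin n → Fin n → ℕ)
    (h : ∀ r s p q u, c s p * b r q u = c q u * b r s p + z r s p q u) (r s p q u : Fin n) :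
    z r s p q u = 0 := by
  have h1 : ∑ s, ∑ p, ∑ q, ∑ u, c s p * b r q u =
      ∑ s, ∑ p, ∑ q, ∑ u, (c q u * b r s p + z r s p q u) :=
    Finset.sum_congr rfl fun s _ => Finset.sum_congr rfl fun p _ => Finset.sum_congr rfl fun q _ =>
      Finset.sum_congr rfl fun u _ => h r s p q u
  have h2 : ∑ s, ∑ p, ∑ q, ∑ u, c s p * b r q u = ∑ s, ∑ p, ∑ q, ∑ u, c q u * b r s p := by
    simp only [← Finset.sum_mul, ← Finset.mul_sum]
  simp only [Finset.sum_add_distrib] at h1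
  rw [h2] at h1
  have h5 : ∑ s, ∑ p, ∑ q, ∑ u, z r s p q u = 0 := by omega
  simp only [Finset.sum_eq_zero_iff, Finset.mem_univ, true_implies] at h5
  exact h5 s p q u

section SelfExt

variable {k : Type u} [Field k] [IsAlgClosed k] {A : Type u} [Ring A] [Algebra k A]
  [Module.Finite k A] {C : Type u} [SmallCategory C] [Preadditive C] [Linear k C]
  {ι : C ⥤ FGModuleCat.{u} A} [ι.IsEquivalence] [ι.Additive] [ι.Linear k]
  {n : ℕ} {e : Fin n → A} {M : TwoRep k (IsProjFun k ι e)} {Q : ObjectProperty M.carrier}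

/-- If `F_pq X_u` is the direct sum of `c_qu` copies of `X_p` and an object `B_pqu`, then
the two ways to compute `F_rs F_pq X_u` show that all `F_rs` kill all `B_pqu`. -/
lemma isZero_act_of_sumDecomp (hfin : ∀ X Y : M.carrier, FiniteDimensional k (X ⟶ Y))
    (he : IsPrimitiveDecomposition e) (X : Fin n → M.carrier) (B : Fin n → Fin n → Fin n → M.carrier)
    (d : ∀ p q u, Nonempty (SumDecomp (fun o : Option (Fin (Module.finrank k
      (projObj ι (e q) ⟶ projObj ι (e u)))) => o.elim (B p q u) fun _ => X p)
      ((M.act.obj (projMor k ι e p q)).obj (X u)))) (r s p q u : Fin n) :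
    IsZero ((M.act.obj (projMor k ι e r s)).obj (B p q u)) := by
  -- dimensions of spaces of morphisms from `T`, which is to be shown to be zero
  let T := (M.act.obj (projMor k ι e r s)).obj (B p q u)
  let c : Fin n → Fin n → ℕ := fun t u => Module.finrank k (projObj ι (e t) ⟶ projObj ι (e u))
  let h : M.carrier → ℕ := fun W => Module.finrank k (T ⟶ W)
  have h1 : ∀ p q u, h ((M.act.obj (projMor k ι e p q)).obj (X u)) =
      h (B p q u) + c q u * h (X p) := by
    intro p q u
    have h2 := (d p q u).some.finrank_hom (k := k) T
    rw [Fintype.sum_option] at h2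
    refine h2.trans ?_
    change _ + ∑ _ : Fin _, h (X p) = _
    rw [Finset.sum_const, Finset.card_univ, Fintype.card_fin, smul_eq_mul]
    rfl
  have h3 : ∀ r s p q u,
      h ((M.act.obj (projMor k ι e r s)).obj ((M.act.obj (projMor k ι e p q)).obj (X u))) =
      h ((M.act.obj (projMor k ι e r s)).obj (B p q u)) +
        c q u * h ((M.act.obj (projMor k ι e r s)).obj (X p)) := by
    intro r s p q u
    have h2 := ((d p q u).some.map (M.act.obj (projMor k ι e r s))).finrank_hom (k := k) T
    rw [Fintype.sum_option] at h2
    refine h2.trans ?_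
    change _ + ∑ _ : Fin _, h ((M.act.obj (projMor k ι e r s)).obj (X p)) = _
    rw [Finset.sum_const, Finset.card_univ, Fintype.card_fin, smul_eq_mul]
    rfl
  have h4 : ∀ r s p q u,
      h ((M.act.obj (projMor k ι e r s)).obj ((M.act.obj (projMor k ι e p q)).obj (X u))) =
      c s p * h ((M.act.obj (projMor k ι e r q)).obj (X u)) := by
    intro r s p q u
    have h2 := ((compMorDecomp k ι he r s p q).act M (X u)).finrank_hom (k := k) T
    rw [M.act_comp_obj] at h2
    simpa using h2
  have h5 := eq_zero_of_forall_mul_eq_add c (fun p q u => h (B p q u))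
    (fun r s p q u => h ((M.act.obj (projMor k ι e r s)).obj (B p q u))) (fun r s p q u => by
      have h6 := h3 r s p q u
      rw [h4, h1, h1] at h6
      have h7 : c s p * (c q u * h (X r)) = c q u * (c s p * h (X r)) := by ring
      linarith) r s p q u
  rw [IsZero.iff_id_eq_zero]
  have : Module.finrank k (T ⟶ T) = 0 := h5
  have := Module.finrank_zero_iff.1 this
  exact Subsingleton.elim _ _

/-- Suppose that the quotient of `M` by `Q` is the action on projective objects, by way of `Φ`. Then
no object `F_pq X` with `X` outside of `Q` has a summand in `Q`. For indecomposable lifts `X_s` of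
the `Ae_s`, the object `F_pq X_u` is a direct sum of copies of `X_p` and an object `B` of `Q`; the
dimension count of `isZero_act_of_sumDecomp` shows that all `F_ss` kill `B`, which is then zero. -/
lemma not_isSummand_act (hQ : M.IsSubrep Q) (hfin : IsFinitary k M.carrier)
    (Φ : M.carrier ⥤ C) [Φ.Additive] [Φ.Full]
    (hker : ∀ {X Y : M.carrier} (f : X ⟶ Y), Φ.map f = 0 ↔ f ∈ (TwoRep.InvIdeal.gen Q).hom X Y)
    (he : IsPrimitiveDecomposition e) (hproj : ∀ X, Projective (Φ.obj X))
    (hact : ∀ (F : ProjMor k ι e) X,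
      Nonempty (Φ.obj ((M.act.obj F).obj X) ≅ F.obj.obj (Φ.obj X)))
    (hess : ∀ s, ∃ X, Nonempty (Φ.obj X ≅ projObj ι (e s)))
    (hK : ∀ Y, Q Y → (∀ s, IsZero ((M.act.obj (projMor k ι e s s)).obj Y)) → IsZero Y)
    {X Y : M.carrier} (hX : IsIndec X) (hXQ : ¬ Q X) (hY : IsIndec Y) (hYQ : Q Y) (p q : Fin n) :
    ¬ IsSummand Y ((M.act.obj (projMor k ι e p q)).obj X) := by
  intro hYX
  have := hfin.additive
  have := hfin.idempotent_split
  have := hasZeroObject_of_hasFiniteBiproducts M.carrier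
  have := finiteDimensional_hom_of_mod k ι
  -- a family of lifts of the objects `Ae_s`, containing `X`
  have hex : ∀ s, ∃ Y, IsIndec Y ∧ ¬ Q Y ∧ Nonempty (Φ.obj Y ≅ projObj ι (e s)) := fun s => by
    obtain ⟨Z, ⟨i⟩⟩ := hess s
    exact exists_isIndec_lift Φ hker hfin (isLocalRing_end_projObj k ι (he.2 s)) i
  choose X₀ hX₀ using hex
  obtain ⟨u, hu⟩ := exists_iso_projObj_of_isIndec hQ hfin Φ hker he hproj hX hXQ
  obtain ⟨X', hX', hX'u⟩ : ∃ X' : Fin n → M.carrier, (∀ s, IsIndec (X' s) ∧ ¬ Q (X' s) ∧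
      Nonempty (Φ.obj (X' s) ≅ projObj ι (e s))) ∧ X' u = X := by
    refine ⟨Function.update X₀ u X, fun s => ?_, Function.update_self _ _ _⟩
    by_cases hs : s = u
    · subst hs
      rw [Function.update_self]
      exact ⟨hX, hXQ, hu⟩
    · rw [Function.update_of_ne hs]
      exact hX₀ s
  have hd : ∀ p q u, ∃ B, Q B ∧ Nonempty (SumDecomp (fun o : Option (Fin (Module.finrank k
      (projObj ι (e q) ⟶ projObj ι (e u)))) => o.elim B fun _ => X' p)
      ((M.act.obj (projMor k ι e p q)).obj (X' u))) := fun p q u =>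
    exists_sumDecomp_option hQ hfin Φ hker (hX' p).1 (hX' p).2.1
      (((projMorCopower k ι he p q).sumDecomp (Module.finBasis k _)).congr
        (fun _ => (hX' p).2.2.some.symm)
        ((projMor k ι e p q).obj.mapIso (hX' u).2.2.some.symm ≪≫ (hact _ _).some.symm))
  choose B hBQ d using hd
  have hB0 : ∀ p q u, IsZero (B p q u) := fun p q u => hK _ (hBQ p q u) fun s =>
    isZero_act_of_sumDecomp hfin.finite_hom he X' B d s s p q u
  rw [← hX'u] at hYX
  obtain ⟨r⟩ := hYX.nonempty_retract
  obtain ⟨o, ⟨r'⟩⟩ := (d p q u).some.exists_retract (hY.isLocalRing k hfin.finite_hom) r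
  cases o with
  | none => exact hY.1 (isZero_of_retract r' (hB0 p q u))
  | some j =>
    obtain ⟨i⟩ := nonempty_iso_of_retract r' ((hX' p).1.isLocalRing k hfin.finite_hom) hY.1
    exact (hX' p).2.1 (hQ.of_iso i hYQ)

/-- The cell `2`-representation of `L_i` has no discrete self-extensions. -/
theorem dext_cellRepAt_eq_empty (he : IsPrimitiveDecomposition e) (hconn : IsConnectedAlg A)
    (i : Fin n) : Dext (cellRepAt k ι e i) (cellRepAt k ι e i) = ∅ := by
  rw [Set.eq_empty_iff_forall_notMem]
  rintro Θ ⟨⟨c, hc⟩, M, Q, hQ, hfin, -, ⟨_, _, rfl, rfl, -, -, rfl⟩, ⟨EK⟩, ⟨EN⟩⟩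
  have := hfin.additive
  have := hasZeroObject_of_hasFiniteBiproducts M.carrier
  obtain ⟨F, hF, X, Y, -, hX, hY, hXQ, hYQ, h⟩ := exists_of_mem_decoration hQ hc.2
  obtain ⟨s, t, ⟨j⟩⟩ := exists_iso_projMor_of_isSummand hQ hfin hF hX hY hXQ hYQ h
  obtain ⟨E⟩ := nonempty_cellRepAt_equiv he hconn
    (isInvariant_top (natRep k (IsProjFun k ι e))) (fun _ _ => trivial) i
  let Ψ : (M.quot (TwoRep.InvIdeal.gen Q)).carrier ⥤ C := EN.functor ⋙ E.functor ⋙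
    ObjectProperty.ι (projProp _) ⋙ ObjectProperty.ι (fun _ => True)
  have hΨa : Ψ.Additive := ⟨by
    intro X Y f g
    exact congrArg (fun f => f.hom.hom) ((EN.functor ⋙ E.functor).map_add (f := f) (g := g))⟩
  have hΨf : Ψ.Full := ⟨by
    intro X Y f
    obtain ⟨g, hg⟩ := (EN.functor ⋙ E.functor).map_surjective (X := X) (Y := Y)
      (ObjectProperty.homMk (ObjectProperty.homMk f))
    exact ⟨g, congrArg (fun f => f.hom.hom) hg⟩⟩
  let Φ : M.carrier ⥤ C := (TwoRep.InvIdeal.gen Q).proj ⋙ Ψ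
  have hΦa : Φ.Additive := ⟨by
    intro X Y f g
    exact (congrArg Ψ.map ((TwoRep.InvIdeal.gen Q).proj.map_add (f := f) (g := g))).trans Ψ.map_add⟩
  have hΦf : Φ.Full := ⟨by
    intro X Y f
    obtain ⟨g, hg⟩ := Ψ.map_surjective f
    obtain ⟨g', hg'⟩ := (TwoRep.InvIdeal.gen Q).proj.map_surjective g
    exact ⟨g', (congrArg Ψ.map hg').trans hg⟩⟩
  refine not_isSummand_act hQ hfin Φ ?_ he ?_ ?_ ?_ ?_ hX hXQ hY hYQ s t (h.of_iso (M.actMapIso j X))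
  · intro X Y f
    rw [← LinIdeal.proj_map_eq_zero_iff]
    refine ⟨fun h0 => ?_, fun h0 => (congrArg Ψ.map h0).trans (Ψ.map_zero _ _)⟩
    refine (EN.functor ⋙ E.functor).map_injective (TwoRep.sub_hom_ext (TwoRep.sub_hom_ext ?_))
    exact h0.trans (Ψ.map_zero _ _).symm
  · intro X
    exact (E.functor.obj (EN.functor.obj ((TwoRep.InvIdeal.gen Q).proj.obj X))).property
  · intro F X
    exact ⟨(ObjectProperty.ι (projProp _) ⋙ ObjectProperty.ι (fun _ => True)).mapIso
      (E.functor.mapIso (EN.actIso F ((TwoRep.InvIdeal.gen Q).proj.obj X)) ≪≫ E.actIso F _)⟩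
  · intro s
    have hR := isInvariant_top (natRep k (IsProjFun k ι e))
    let Z : (((natRep k (IsProjFun k ι e)).sub _ hR).sub (projProp hR)
      (isInvariant_projProp he hR)).carrier :=
      ⟨⟨(show C from projObj ι (e s)), trivial⟩, projective_projObj k (ι := ι) (he.2 s).1⟩
    refine ⟨(EN.functor.objPreimage (E.functor.objPreimage Z)).as, ⟨?_⟩⟩
    exact (ObjectProperty.ι (projProp hR) ⋙ ObjectProperty.ι (fun _ => True)).mapIso
      (E.functor.mapIso (EN.functor.objObjPreimageIso _) ≪≫ E.functor.objObjPreimageIso Z)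
  · intro Y hY h0
    let Y' : (M.sub Q hQ.invariant).carrier := ⟨Y, hY⟩
    refine (TwoRep.isZero_sub_iff Y').1 ((EK.isZero_iff Y').1
      (isZero_of_isZero_act_cellRepAt he hconn i _ fun s => ?_))
    exact ((EK.isZero_iff _).2 ((TwoRep.isZero_sub_iff _).2 (h0 s))).of_iso (EK.actIso _ _).symm

end SelfExt

/-! ### The subrepresentation generated by an object and the projective objects -/

lemma isIdempotentComplete_fullSubcategory {𝒳 : Type*} [Category 𝒳] [IsIdempotentComplete 𝒳]
    (R : ObjectProperty 𝒳) (h : ∀ {X Y : 𝒳}, Retract X Y → R Y → R X) :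
    IsIdempotentComplete R.FullSubcategory where
  idempotents_split X p hp := by
    obtain ⟨Y, i, q, h1, h2⟩ := IsIdempotentComplete.idempotents_split X.obj p.hom
      (congrArg (fun f => f.hom) hp)
    exact ⟨⟨Y, h ⟨i, q, h1⟩ X.property⟩, ObjectProperty.homMk i, ObjectProperty.homMk q,
      by ext; exact h1, by ext; exact h2⟩

lemma finiteDimensional_hom_fullSubcategory (k : Type*) [Field k] {𝒳 : Type*} [Category 𝒳]
    [Preadditive 𝒳] [Linear k 𝒳] (h : ∀ X Y : 𝒳, FiniteDimensional k (X ⟶ Y))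
    (R : ObjectProperty 𝒳) (X Y : R.FullSubcategory) : FiniteDimensional k (X ⟶ Y) :=
  have := h X.obj Y.obj
  FiniteDimensional.of_injective (R.ι.mapLinearMap k (X := X) (Y := Y)) R.ι.map_injective

section AddRep

variable {k : Type u} [Field k] {A : Type u} [Ring A] [Algebra k A] [Module.Finite k A]
  {C : Type u} [SmallCategory C] [Preadditive C] [Linear k C]
  {ι : C ⥤ FGModuleCat.{u} A} [ι.IsEquivalence] [ι.Additive] [ι.Linear k]
  {n : ℕ} {e : Fin n → A}

lemma projective_obj_of_isSummand {R : ObjectProperty C} {X Y : R.FullSubcategory}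
    (h : IsSummand X Y) [hY : Projective Y.obj] : Projective X.obj := by
  obtain ⟨r⟩ := h.nonempty_retract
  exact projective_of_retract (Y := Y.obj) (r.map R.ι)

lemma projective_obj_pt {R : ObjectProperty C} {X Y : R.FullSubcategory} (b : BinaryBicone X Y)
    (hb : b.IsBilimit) (hX : Projective X.obj) (hY : Projective Y.obj) : Projective b.pt.obj :=
  projective_of_sumDecomp ((SumDecomp.ofBinaryBicone b hb (Iso.refl _)).map R.ι)
    (by rintro (_ | _) <;> assumption)

lemma isSubrep_projProp (he : IsPrimitiveDecomposition e) {R : ObjectProperty C}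
    (hR : (natRep k (IsProjFun k ι e)).IsInvariant R) :
    ((natRep k (IsProjFun k ι e)).sub R hR).IsSubrep (projProp hR) where
  invariant := isInvariant_projProp he hR
  zero X h := by
    have := hasFiniteBiproducts_of_mod k ι
    have := hasZeroObject_of_hasFiniteBiproducts C
    exact Projective.of_iso (isZero_zero C |>.iso ((TwoRep.isZero_sub_iff X).1 h))
      Projective.zero_projective
  summand X Y h hX := by
    have h' : IsSummand (𝒳 := R.FullSubcategory) Y X := h
    exact projective_obj_of_isSummand (hY := hX) h'
  sum X Y b := fun ⟨hb⟩ hX hY => by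
    let b' : BinaryBicone (C := R.FullSubcategory) X Y := b
    have hb' : b'.IsBilimit := hb
    exact projective_obj_pt b' hb' hX hY

variable (ι e) in
/-- The direct sums of copies of `V` and of the projective objects `Ae_t`. -/
def addProp (V : C) : ObjectProperty C := IsSumOf fun Z => Z = V ∨ ∃ t, Z = projObj ι (e t)

lemma addProp_self (V : C) : addProp ι e V V := IsSumOf.of_mem (Or.inl rfl)

lemma addProp_projObj (V : C) (t : Fin n) : addProp ι e V (projObj ι (e t)) :=
  IsSumOf.of_mem (Or.inr ⟨t, rfl⟩)

lemma addProp_of_projective (k : Type u) [Field k] [Algebra k A] [Module.Finite k A] [Linear k C]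
    [ι.Linear k] (he : IsPrimitiveDecomposition e) (V X : C) (hX : Projective X) :
    addProp ι e V X :=
  (isSumOf_projObj k ι he X).mono fun _ h => Or.inr h

lemma addProp_of_retract (k : Type u) [Field k] [Algebra k A] [Module.Finite k A] [Linear k C]
    [ι.Linear k] (he : IsPrimitiveDecomposition e) {V : C} (hV : IsLocalRing (End V))
    {X Y : C} (r : Retract X Y) (hY : addProp ι e V Y) : addProp ι e V X := by
  have := isIdempotentComplete_of_mod k ι
  have hfin := finiteDimensional_hom_of_mod k ι
  obtain ⟨m, f, hf, ⟨d⟩⟩ := (isSumOf_isIndec k hfin X).exists_sumDecomp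
  have h1 : ∀ j, ∃ Z, (Z = V ∨ ∃ t, Z = projObj ι (e t)) ∧ Nonempty (f j ≅ Z) := fun j => by
    obtain ⟨Z, hZ, ⟨r'⟩⟩ := hY.exists_retract ((hf j).isLocalRing k hfin) ((d.retract j).trans r)
    refine ⟨Z, hZ, nonempty_iso_of_retract r' ?_ (hf j).1⟩
    obtain rfl | ⟨t, rfl⟩ := hZ
    · exact hV
    · exact isLocalRing_end_projObj k ι (he.2 t)
  choose Z hZ i using h1
  exact (d.congr (fun j => (i j).some) (Iso.refl _)).isSumOf hZ

lemma isInvariant_addProp (he : IsPrimitiveDecomposition e) (V : C) :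
    (natRep k (IsProjFun k ι e)).IsInvariant (addProp (C := C) ι e V) := fun F (X : C) hX => by
  have := finiteDimensional_hom_of_mod k ι
  obtain ⟨m, f, hf, ⟨d⟩⟩ := F.property.exists_sumDecomp
  refine ((d.map ((evaluation C C).obj X)).isSumOf (Q := addProp ι e V) fun j => ?_).flatten
  obtain h | ⟨s, t, h⟩ := hf j
  · rw [h]
    exact hX
  · rw [h]
    have := projective_projObj k (ι := ι) (he.2 s).1
    exact addProp_of_projective k he V _ ((projMorCopower k ι he s t).projective X)

/-- The action of projective functors on the direct sums of copies of `V` and of projective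
objects. -/
abbrev addRep (he : IsPrimitiveDecomposition e) (V : C) : TwoRep k (IsProjFun k ι e) :=
  (natRep k (IsProjFun k ι e)).sub (addProp (C := C) ι e V) (isInvariant_addProp he V)

variable (ι e) in
/-- The object `V` of `addProp ι e V`. -/
def addSelf (V : C) : (addProp ι e V).FullSubcategory := ⟨V, addProp_self V⟩

variable (ι e) in
/-- The object `Ae_t` of `addProp ι e V`. -/
noncomputable def addProj (V : C) (t : Fin n) : (addProp ι e V).FullSubcategory :=
  ⟨projObj ι (e t), addProp_projObj V t⟩

lemma isSumOf_addProp (V : C) (X : (addProp ι e V).FullSubcategory) :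
    IsSumOf (fun Z => Z = addSelf ι e V ∨ ∃ t, Z = addProj ι e V t) X := by
  obtain ⟨m, f, hf, ⟨d⟩⟩ := X.property.exists_sumDecomp
  let f' : Fin m → (addProp ι e V).FullSubcategory := fun j => ⟨f j, IsSumOf.of_mem (hf j)⟩
  refine (SumDecomp.lift (f := f') d).isSumOf fun j => ?_
  obtain h | ⟨t, h⟩ := hf j
  · exact Or.inl (ObjectProperty.FullSubcategory.ext h)
  · exact Or.inr ⟨t, ObjectProperty.FullSubcategory.ext h⟩

lemma hasFiniteBiproducts_addProp (k : Type u) [Field k] [Algebra k A] [Module.Finite k A] [Linear k C]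
    [ι.Linear k] (V : C) :
    HasFiniteBiproducts (addProp ι e V).FullSubcategory :=
  have := hasFiniteBiproducts_of_mod k ι
  hasFiniteBiproducts_fullSubcategory _ fun _ h => h.flatten

lemma isIndec_addSelf {V : C} (hV : IsLocalRing (End V)) : IsIndec (addSelf ι e V) :=
  isIndec_of_isLocalRing (isLocalRing_end_of_map (addProp ι e V).ι hV)

lemma isIndec_addProj (k : Type u) [Field k] [Algebra k A] [Module.Finite k A] [Linear k C]
    [ι.Linear k] (he : IsPrimitiveDecomposition e) (V : C) (t : Fin n) :
    IsIndec (addProj ι e V t) :=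
  isIndec_of_isLocalRing (isLocalRing_end_of_map (addProp ι e V).ι
    (isLocalRing_end_projObj k ι (he.2 t)))

lemma exists_iso_of_isIndec_addProp (k : Type u) [Field k] [Algebra k A] [Module.Finite k A] [Linear k C]
    [ι.Linear k] {V : C} {X : (addProp ι e V).FullSubcategory} (hX : IsIndec X) :
    Nonempty (addSelf ι e V ≅ X) ∨ ∃ t, Nonempty (addProj ι e V t ≅ X) := by
  have := hasFiniteBiproducts_addProp k (ι := ι) (e := e) V
  obtain ⟨_, rfl | ⟨t, rfl⟩, h⟩ := hX.exists_iso (isSumOf_addProp V X)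
  · exact Or.inl h
  · exact Or.inr ⟨t, h⟩

lemma isFinitary_addProp (k : Type u) [Field k] [Algebra k A] [Module.Finite k A] [Linear k C]
    [ι.Linear k] (he : IsPrimitiveDecomposition e) {V : C} (hV : IsLocalRing (End V)) :
    IsFinitary k (addProp ι e V).FullSubcategory := by
  have := isIdempotentComplete_of_mod k ι
  have h1 : IsIdempotentComplete (addProp ι e V).FullSubcategory :=
    isIdempotentComplete_fullSubcategory _ (addProp_of_retract k he hV)
  have h2 := finiteDimensional_hom_fullSubcategory k (finiteDimensional_hom_of_mod k ι)
    (addProp ι e V)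
  refine ⟨hasFiniteBiproducts_addProp k V, h1, fun X => ?_, ?_, h2⟩
  · obtain ⟨m, f, b, hf, hb, hX⟩ := isSumOf_isIndec k h2 X
    exact ⟨m, f, b, hb, hX, fun j => (hf j).isLocalRing k h2⟩
  · let g : Option (Fin n) → Ind (addProp ι e V).FullSubcategory := fun o => match o with
      | none => Ind.mk _ (isIndec_addSelf hV)
      | some t => Ind.mk _ (isIndec_addProj k he V t)
    refine Finite.of_surjective g ?_
    rintro ⟨X, hX⟩
    obtain h | ⟨t, h⟩ := exists_iso_of_isIndec_addProp k hX
    · exact ⟨none, Ind.mk_eq_mk.2 h⟩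
    · exact ⟨some t, Ind.mk_eq_mk.2 h⟩

lemma isFinitary_addRep (he : IsPrimitiveDecomposition e) {V : C} (hV : IsLocalRing (End V)) :
    IsFinitary k (addRep (k := k) (ι := ι) he V).carrier :=
  isFinitary_addProp k (ι := ι) he hV

/-- A nonzero morphism from `Ae_t` to `X` makes `Ae_s` a summand of `F_st X`. -/
lemma nonempty_retract_projMor (he : IsPrimitiveDecomposition e) (s : Fin n) {t : Fin n} {X : C}
    (v : projObj ι (e t) ⟶ X) (hv : v ≠ 0) :
    Nonempty (Retract (projObj ι (e s)) ((projMor k ι e s t).obj.obj X)) := by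
  have := finiteDimensional_hom_of_mod k ι
  have : Nontrivial (projObj ι (e t) ⟶ X) := ⟨v, 0, hv⟩
  exact ⟨((projMorCopower k ι he s t).sumDecomp (Module.finBasis k _)).retract
    ⟨0, Module.finrank_pos⟩⟩

lemma isTransitive_projProp (he : IsPrimitiveDecomposition e) {R : ObjectProperty C}
    (hR : (natRep k (IsProjFun k ι e)).IsInvariant R) (hR' : ∀ X : C, Projective X → R X) :
    (((natRep k (IsProjFun k ι e)).sub R hR).sub (projProp hR)
      (isInvariant_projProp he hR)).IsTransitive := by
  have := isIdempotentComplete_of_mod k ι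
  have := hasFiniteBiproducts_of_mod k ι
  let S : ObjectProperty R.FullSubcategory := fun X => Projective X.obj
  let P : Fin n → S.FullSubcategory := fun t => ⟨⟨projObj ι (e t),
    hR' _ (projective_projObj k (he.2 t).1)⟩, projective_projObj k (ι := ι) (he.2 t).1⟩
  have hS : ∀ X : S.FullSubcategory, IsSumOf (fun Z => ∃ t, Z = P t) X := fun X => by
    have : Projective X.obj.obj := X.property
    obtain ⟨m, f, hf, ⟨d⟩⟩ := (isSumOf_projObj k ι he X.obj.obj).exists_sumDecomp
    choose t ht using hf
    obtain rfl : f = fun j => projObj ι (e (t j)) := funext ht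
    exact (SumDecomp.lift (f := fun j => P (t j)) (SumDecomp.lift (f := fun j => (P (t j)).obj)
      d)).isSumOf fun j => ⟨t j, rfl⟩
  have hbi : HasFiniteBiproducts S.FullSubcategory := by
    refine hasFiniteBiproducts_of_sumDecomp fun m f => ?_
    let Y : C := ⨁ fun j => (f j).obj.obj
    have d := SumDecomp.ofBiproduct fun j => (f j).obj.obj
    have hY : Projective Y := projective_of_sumDecomp d fun j => (f j).property
    exact ⟨⟨⟨Y, hR' Y hY⟩, hY⟩, ⟨SumDecomp.lift (SumDecomp.lift d)⟩⟩
  have hidem : IsIdempotentComplete S.FullSubcategory := ⟨fun X p hp => by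
    obtain ⟨Y, i, q, h1, h2⟩ := IsIdempotentComplete.idempotents_split X.obj.obj p.hom.hom
      (congrArg (fun f => f.hom.hom) hp)
    have : Projective X.obj.obj := X.property
    have hY : Projective Y := projective_of_retract ⟨i, q, h1⟩
    refine ⟨⟨⟨Y, hR' _ hY⟩, hY⟩, ObjectProperty.homMk (ObjectProperty.homMk i),
      ObjectProperty.homMk (ObjectProperty.homMk q), ?_, ?_⟩
    · ext; exact h1
    · ext; exact h2⟩
  have := hasZeroObject_of_hasFiniteBiproducts S.FullSubcategory
  rintro ⟨X, hX⟩ ⟨Y, hY⟩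
  have hX' : IsIndec (𝒳 := S.FullSubcategory) X := hX
  have hY' : IsIndec (𝒳 := S.FullSubcategory) Y := hY
  obtain ⟨_, ⟨t, rfl⟩, ⟨i⟩⟩ := hX'.exists_iso (hS X)
  obtain ⟨_, ⟨s, rfl⟩, ⟨j⟩⟩ := hY'.exists_iso (hS Y)
  refine ⟨P t, hX'.of_iso i.symm, P s, hY'.of_iso j.symm, Ind.mk_eq_mk.2 ⟨i.symm⟩,
    Ind.mk_eq_mk.2 ⟨j.symm⟩, projMor k ι e s t, ?_⟩
  have hid : 𝟙 (projObj ι (e t)) ≠ 0 := fun h0 => not_isZero_of_isLocalRing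
    (isLocalRing_end_projObj k ι (he.2 t)) ((IsZero.iff_id_eq_zero _).2 h0)
  obtain ⟨r⟩ := nonempty_retract_projMor (k := k) he s (𝟙 (projObj ι (e t))) hid
  let Y : S.FullSubcategory := ⟨⟨(projMor k ι e s t).obj.obj (projObj ι (e t)),
    hR (projMor k ι e s t) _ (P t).obj.property⟩,
    isInvariant_projProp he hR (projMor k ι e s t) _ (P t).property⟩
  exact isSummand_of_retract (𝒳 := S.FullSubcategory) (Y := P s) (X := Y)
    (liftRetract (X := P s) (Y := Y) (liftRetract (X := (P s).obj) (Y := Y.obj) r))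

end AddRep

/-! ### The quotient by the projective objects -/

section StableQuot

variable {k : Type u} [Field k] {A : Type u} [Ring A] [Algebra k A] [Module.Finite k A]
  {C : Type u} [SmallCategory C] [Preadditive C] [Linear k C]
  {ι : C ⥤ FGModuleCat.{u} A} [ι.IsEquivalence] [ι.Additive] [ι.Linear k]
  {n : ℕ} {e : Fin n → A}

/-- The ideal of `addRep he V` generated by the projective objects. -/
abbrev addIdeal (he : IsPrimitiveDecomposition e) (V : C) :
    (addRep (k := k) (ι := ι) he V).InvIdeal :=
  TwoRep.InvIdeal.gen (projProp (isInvariant_addProp he V))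

/-- The morphisms which vanish in the stable quotient are those which factor through projective
objects. -/
lemma addIdeal_proj_map_eq_zero_iff (he : IsPrimitiveDecomposition e) {V : C}
    (hV : IsLocalRing (End V)) {X Y : (addProp ι e V).FullSubcategory} (f : X ⟶ Y) :
    (addIdeal (k := k) (ι := ι) he V).proj.map f = 0 ↔ f.hom ∈ (projIdeal k C).hom X.obj Y.obj := by
  have := hasFiniteBiproducts_of_mod k ι
  have := (isFinitary_addRep (k := k) (ι := ι) he hV).additive
  refine (LinIdeal.proj_map_eq_zero_iff (addIdeal (k := k) (ι := ι) he V).toLinIdeal f).trans ?_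
  constructor
  · intro hf
    obtain ⟨Z, g, h, hZ, hgh⟩ := (isSubrep_projProp he (isInvariant_addProp he V)).exists_factor hf
    exact (mem_projIdeal_iff _).2 ⟨Z.obj, hZ, g.hom, h.hom, congrArg (fun f => f.hom) hgh⟩
  · intro hf
    obtain ⟨Z, hZ, g, h, hgh⟩ := (mem_projIdeal_iff _).1 hf
    let Z' : (addProp ι e V).FullSubcategory := ⟨Z, addProp_of_projective k he V Z hZ⟩
    let g' : X ⟶ Z' := ObjectProperty.homMk g
    let h' : Z' ⟶ Y := ObjectProperty.homMk h
    have h1 : f = g' ≫ h' := by ext; exact hgh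
    have h2 := TwoRep.InvIdeal.id_mem_gen (M := addRep (k := k) (ι := ι) he V)
      (Q := projProp (isInvariant_addProp he V)) (X := Z') hZ
    have h3 := (addIdeal (k := k) (ι := ι) he V).comp_right h' h2
    have h4 := (addIdeal (k := k) (ι := ι) he V).comp_left g' h3
    rw [h1]
    exact (congrArg (fun q : X ⟶ Y => q ∈ (addIdeal (k := k) (ι := ι) he V).hom X Y)
      (congrArg (g' ≫ ·) (Category.id_comp h'))).mp h4

lemma isZero_addIdeal_proj_iff (he : IsPrimitiveDecomposition e) {V : C}
    (hV : IsLocalRing (End V)) (X : (addProp ι e V).FullSubcategory) :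
    IsZero ((addIdeal (k := k) (ι := ι) he V).proj.obj X) ↔ Projective X.obj := by
  have := hasFiniteBiproducts_of_mod k ι
  have h1 := addIdeal_proj_map_eq_zero_iff (k := k) (ι := ι) he hV (𝟙 X)
  rw [IsZero.iff_id_eq_zero]
  refine Iff.trans ?_ (h1.trans
    ⟨fun h => projective_of_id_mem_projIdeal (k := k) h, fun h => id_mem_projIdeal (hX := h) _⟩)
  exact ⟨fun h => ((addIdeal (k := k) (ι := ι) he V).proj.map_id X).trans h,
    fun h => ((addIdeal (k := k) (ι := ι) he V).proj.map_id X).symm.trans h⟩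

section Stable

variable {V : C} (φ : End ((projIdeal k C).proj.obj V) ≃ₐ[k] k)

include φ

lemma exists_sub_smul_mem_projIdeal (f : V ⟶ V) :
    ∃ r : k, f - r • 𝟙 V ∈ (projIdeal k C).hom V V := by
  refine ⟨φ ((projIdeal k C).proj.map f), ((projIdeal k C).proj_map_eq_zero_iff _).1 ?_⟩
  rw [Functor.map_sub, Functor.map_smul, sub_eq_zero, CategoryTheory.Functor.map_id]
  apply φ.injective
  exact ((map_smul φ (φ ((projIdeal k C).proj.map f)) 1).trans
    (by rw [map_one, smul_eq_mul, mul_one])).symm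

lemma not_projective_of_stable_end : ¬ Projective V := fun h => by
  have h1 := ((projIdeal k C).proj_map_eq_zero_iff (𝟙 V)).2 (id_mem_projIdeal V)
  rw [CategoryTheory.Functor.map_id] at h1
  have h2 : (1 : End ((projIdeal k C).proj.obj V)) = 0 := h1
  have h3 := congrArg φ h2
  rw [map_one, map_zero] at h3
  exact one_ne_zero h3

end Stable

/-- Every `1`-morphism lies above the identity in the left preorder. -/
lemma leftLE_oneMor (G : ProjMor k ι e) : LeftLE k (oneMor k (IsProjFun k ι e)) G :=
  have := hasFiniteBiproducts_projMor k ι e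
  have := hasZeroObject_of_hasFiniteBiproducts (ProjMor k ι e)
  ⟨G, isSummand_of_iso (Iso.refl G)⟩

/-- A `1`-morphism as an object of the left ideal generated by the identity. -/
def oneIdealMor (G : ProjMor k ι e) :
    (leftIdealRep (k := k) (oneMor k (IsProjFun k ι e))).carrier :=
  ⟨G, leftLE_oneMor G⟩

lemma isSumOf_oneIdealMor (X : (leftIdealRep (k := k) (oneMor k (IsProjFun k ι e))).carrier) :
    IsSumOf (fun Z => ∃ G, genMor k ι e G ∧ Z = oneIdealMor G) X := by
  obtain ⟨m, f, hf, ⟨d⟩⟩ := (isSumOf_genMor X.obj).exists_sumDecomp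
  let R : ObjectProperty (ProjMor k ι e) := fun G => LeftLE k (oneMor k (IsProjFun k ι e)) G
  let X' : R.FullSubcategory := ⟨X.obj, X.property⟩
  let f' : Fin m → R.FullSubcategory := fun j => ⟨f j, leftLE_oneMor (f j)⟩
  have d' := SumDecomp.lift (X := X') (f := f') d
  exact d'.isSumOf fun j => ⟨f j, hf j, rfl⟩

/-- Evaluation at `V`, as a morphism from the left ideal generated by the identity to the stable
quotient. -/
def stableEvalHom (he : IsPrimitiveDecomposition e) (V : C) :
    (leftIdealRep (k := k) (oneMor k (IsProjFun k ι e))).Hom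
      ((addRep (k := k) (ι := ι) he V).quot (addIdeal he V)) :=
  ((addRep (k := k) (ι := ι) he V).quot (addIdeal he V)).evalHom _
    ((addIdeal he V).proj.obj (addSelf ι e V))

variable (he : IsPrimitiveDecomposition e) {V : C} (hV : IsLocalRing (End V))

include hV in
lemma stableEvalHom_map_eq_zero_iff
    {X Y : (leftIdealRep (k := k) (oneMor k (IsProjFun k ι e))).carrier} (f : X ⟶ Y) :
    (stableEvalHom he V).functor.map f = 0 ↔
      f.hom.hom.app V ∈ (projIdeal k C).hom (X.obj.obj.obj V) (Y.obj.obj.obj V) :=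
  addIdeal_proj_map_eq_zero_iff he hV
    (((addRep (k := k) (ι := ι) he V).act.map f.hom).app (addSelf ι e V))

include hV in
lemma isZero_stableEvalHom_obj_iff
    (X : (leftIdealRep (k := k) (oneMor k (IsProjFun k ι e))).carrier) :
    IsZero ((stableEvalHom he V).functor.obj X) ↔ Projective (X.obj.obj.obj V) :=
  isZero_addIdeal_proj_iff he hV
    (((addRep (k := k) (ι := ι) he V).act.obj X.obj).obj (addSelf ι e V))

include hV in
lemma isZero_stableEvalHom_projMor (s t : Fin n) :
    IsZero ((stableEvalHom (k := k) he V).functor.obj (oneIdealMor (projMor k ι e s t))) := by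
  have := finiteDimensional_hom_of_mod k ι
  have := projective_projObj k (ι := ι) (he.2 s).1
  exact (isZero_stableEvalHom_obj_iff he hV _).2 ((projMorCopower k ι he s t).projective V)

include hV in
/-- The functors `F_st` take projective values, and all endomorphisms of `V` are scalar modulo
projective objects. -/
lemma full_stableEvalHom (φ : End ((projIdeal k C).proj.obj V) ≃ₐ[k] k) :
    (stableEvalHom (k := k) (ι := ι) he V).functor.Full := by
  refine full_of_isSumOf _ isSumOf_oneIdealMor ?_
  rintro _ _ ⟨G, hG, rfl⟩ ⟨G', hG', rfl⟩ g
  obtain rfl | ⟨s, t, rfl⟩ := hG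
  swap
  · exact ⟨0, (isZero_stableEvalHom_projMor he hV s t).eq_of_src _ _⟩
  obtain rfl | ⟨s, t, rfl⟩ := hG'
  swap
  · exact ⟨0, (isZero_stableEvalHom_projMor he hV s t).eq_of_tgt _ _⟩
  obtain ⟨(g' : addSelf ι e V ⟶ addSelf ι e V)⟩ := g
  obtain ⟨r, hr⟩ := exists_sub_smul_mem_projIdeal φ g'.hom
  refine ⟨r • 𝟙 _, ?_⟩
  have h1 := (addIdeal_proj_map_eq_zero_iff (k := k) (ι := ι) he hV (g' - r • 𝟙 _)).2 hr
  have h2 : (addIdeal (k := k) (ι := ι) he V).proj.map g' =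
      (addIdeal (k := k) (ι := ι) he V).proj.map (r • 𝟙 (addSelf ι e V)) := by
    refine sub_eq_zero.1 (Eq.trans ?_ h1)
    exact ((addIdeal (k := k) (ι := ι) he V).proj.map_sub).symm
  exact h2.symm

include hV in
lemma essSurj_stableEvalHom : (stableEvalHom (k := k) (ι := ι) he V).functor.EssSurj where
  mem_essImage Y := by
    have := hasFiniteBiproducts_projMor k ι e
    have := hasZeroObject_of_hasFiniteBiproducts (ProjMor k ι e)
    obtain ⟨Y⟩ := Y
    obtain ⟨m, f, hf, ⟨d⟩⟩ := (isSumOf_addProp (C := C) (ι := ι) (e := e) V Y).exists_sumDecomp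
    have h1 : ∀ j, ∃ G : ProjMor k ι e, Nonempty ((stableEvalHom (k := k) (ι := ι) he V).functor.obj
        (oneIdealMor G) ≅ (addIdeal (k := k) (ι := ι) he V).proj.obj (f j)) := fun j => by
      obtain h | ⟨t, h⟩ := hf j
      · rw [h]
        exact ⟨oneMor k (IsProjFun k ι e), ⟨Iso.refl _⟩⟩
      · rw [h]
        exact ⟨projMor k ι e t t, ⟨(isZero_stableEvalHom_projMor he hV t t).iso
          ((isZero_addIdeal_proj_iff he hV _).2 (projective_projObj k (ι := ι) (he.2 t).1))⟩⟩
    choose G i using h1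
    let R : ObjectProperty (ProjMor k ι e) := fun G => LeftLE k (oneMor k (IsProjFun k ι e)) G
    let X' : R.FullSubcategory := ⟨⨁ G, leftLE_oneMor _⟩
    let d' : SumDecomp (fun j => (⟨G j, leftLE_oneMor (G j)⟩ : R.FullSubcategory)) X' :=
      SumDecomp.lift (SumDecomp.ofBiproduct G)
    let d₂ : SumDecomp (fun j => oneIdealMor (G j)) (oneIdealMor (⨁ G)) := d'
    let d₃ : SumDecomp (𝒳 := (addRep (k := k) (ι := ι) he V).carrier) f Y := d
    exact ⟨oneIdealMor (⨁ G), ⟨((d₂.map (stableEvalHom (k := k) (ι := ι) he V).functor).congr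
      (fun j => (i j).some) (Iso.refl _)).iso (d₃.map (addIdeal (k := k) (ι := ι) he V).proj)⟩⟩

/-- An indecomposable `1`-morphism in the left cell of the identity is isomorphic to the
identity. -/
lemma nonempty_iso_oneMor_of_leftLE [IsAlgClosed k] (he : IsPrimitiveDecomposition e)
    (hconn : IsConnectedAlg A) (hns : ¬ IsSimpleRing A) {G : ProjMor k ι e} (hG : IsIndec G)
    (h : LeftLE k G (oneMor k (IsProjFun k ι e))) : Nonempty (oneMor k (IsProjFun k ι e) ≅ G) := by
  obtain ⟨_, rfl | ⟨s, t, rfl⟩, ⟨i⟩⟩ := hG.exists_genMor_iso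
  · exact ⟨i⟩
  · obtain ⟨H, hH⟩ := h
    obtain ⟨s', ⟨j⟩⟩ := exists_iso_of_leftLE_projMor (k := k) (u := s) (t := t) he hconn
      (isIndec_oneMor hconn) ⟨H, hH.of_iso ((leftMul k _ H).mapIso i.symm)⟩
    exact ((isEmpty_oneMor_iso_projMor he hconn hns s' t).false j).elim

include hV in
/-- A morphism with nonzero image in the stable quotient has a component `u` which is an automorphism
of the identity: modulo projective objects `u` is a nonzero scalar `r` at `V`, so that `1 - r⁻¹ u`
is not a unit in the local ring of endomorphisms of the identity, and hence `u` is one. -/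
lemma exists_id_of_stableEvalHom_map_ne_zero (hconn : IsConnectedAlg A)
    (φ : End ((projIdeal k C).proj.obj V) ≃ₐ[k] k)
    {X Y : (leftIdealRep (k := k) (oneMor k (IsProjFun k ι e))).carrier} (f : X ⟶ Y)
    (hf : (stableEvalHom he V).functor.map f ≠ 0) :
    ∃ (a : oneIdealMor (oneMor k (IsProjFun k ι e)) ⟶ X)
      (b : Y ⟶ oneIdealMor (oneMor k (IsProjFun k ι e))), a ≫ f ≫ b = 𝟙 _ := by
  have := hasFiniteBiproducts_of_mod k ι
  obtain ⟨_, _, i, p, ⟨G, hG, rfl⟩, ⟨G', hG', rfl⟩, hu⟩ :=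
    exists_component_ne_zero _ isSumOf_oneIdealMor f hf
  obtain rfl | ⟨s, t, rfl⟩ := hG
  swap
  · exact (hu ((isZero_stableEvalHom_projMor he hV s t).eq_of_src _ _)).elim
  obtain rfl | ⟨s, t, rfl⟩ := hG'
  swap
  · exact (hu ((isZero_stableEvalHom_projMor he hV s t).eq_of_tgt _ _)).elim
  let X' : ProjMor k ι e := X.obj
  let Y' : ProjMor k ι e := Y.obj
  let i' : oneMor k (IsProjFun k ι e) ⟶ X' := i.hom
  let f' : X' ⟶ Y' := f.hom
  let p' : Y' ⟶ oneMor k (IsProjFun k ι e) := p.hom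
  let u : oneMor k (IsProjFun k ι e) ⟶ oneMor k (IsProjFun k ι e) := i' ≫ f' ≫ p'
  let uV : V ⟶ V := u.hom.app V
  have hu' : uV ∉ (projIdeal k C).hom V V := fun h =>
    hu ((stableEvalHom_map_eq_zero_iff he hV _).2 h)
  obtain ⟨r, hr⟩ := exists_sub_smul_mem_projIdeal φ uV
  have hr0 : r ≠ 0 := by
    rintro rfl
    rw [zero_smul, sub_zero] at hr
    exact hu' hr
  have hloc := isLocalRing_end_oneMor (k := k) (ι := ι) (e := e) hconn
  have hunit : IsUnit (show End (oneMor k (IsProjFun k ι e)) from r⁻¹ • u) := by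
    refine (hloc.isUnit_or_isUnit_of_add_one
      (b := (show End (oneMor k (IsProjFun k ι e)) from 𝟙 _ - r⁻¹ • u))
      (add_sub_cancel (r⁻¹ • u) (𝟙 _))).resolve_right ?_
    rintro ⟨w, hw⟩
    refine not_projective_of_stable_end φ (projective_of_id_mem_projIdeal (k := k) ?_)
    have h1 : (w.1 : oneMor k (IsProjFun k ι e) ⟶ oneMor k (IsProjFun k ι e)).hom.app V ∈
        (projIdeal k C).hom V V := by
      rw [hw]
      change 𝟙 V - r⁻¹ • uV ∈ _
      have h2 := Submodule.smul_mem _ (-r⁻¹) hr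
      rwa [smul_sub, smul_smul, neg_mul, inv_mul_cancel₀ hr0, neg_smul, neg_smul, one_smul,
        sub_neg_eq_add, neg_add_eq_sub] at h2
    have h3 := (projIdeal k C).comp_left ((w.2 : oneMor k (IsProjFun k ι e) ⟶
      oneMor k (IsProjFun k ι e)).hom.app V) h1
    exact (congrArg (fun z : oneMor k (IsProjFun k ι e) ⟶ oneMor k (IsProjFun k ι e) =>
      z.hom.app V ∈ (projIdeal k C).hom V V) w.val_inv).mp h3
  obtain ⟨w, hw⟩ := hunit
  let z : oneMor k (IsProjFun k ι e) ⟶ oneMor k (IsProjFun k ι e) := w.2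
  have hz : u ≫ (r⁻¹ • z) = 𝟙 _ := by
    rw [Linear.comp_smul, ← Linear.smul_comp]
    exact (congrArg (· ≫ z) hw.symm).trans w.inv_val
  refine ⟨i, p ≫ ObjectProperty.homMk (r⁻¹ • z), ?_⟩
  refine TwoRep.sub_hom_ext (Eq.trans ?_ hz)
  change i' ≫ f' ≫ p' ≫ (r⁻¹ • z) = (i' ≫ f' ≫ p') ≫ (r⁻¹ • z)
  simp only [Category.assoc]

/-- If the stable endomorphism algebra of `V` is `k`, then the quotient of the action on sums of
copies of `V` and of projective objects by the projective objects is the cell `2`-representation of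
the identity. -/
theorem nonempty_cellRep0_equiv [IsAlgClosed k] (he : IsPrimitiveDecomposition e)
    (hconn : IsConnectedAlg A) (hns : ¬ IsSimpleRing A) {V : C} (hV : IsLocalRing (End V))
    (φ : End ((projIdeal k C).proj.obj V) ≃ₐ[k] k) : Nonempty ((cellRep0 k ι e).Equiv
      ((addRep (k := k) (ι := ι) he V).quot (addIdeal he V))) := by
  refine nonempty_cellRep_equiv (stableEvalHom he V) (full_stableEvalHom he hV φ)
    (essSurj_stableEvalHom he hV) (cellIdeal_eq_ker _ ?_ ?_)
  · intro G hG hi h h0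
    obtain ⟨i⟩ := nonempty_iso_oneMor_of_leftLE he hconn hns hi h
    have h1 : Projective (G.obj.obj V) := (isZero_stableEvalHom_obj_iff he hV ⟨G, hG⟩).1 h0
    exact not_projective_of_stable_end φ (Projective.of_iso
      (((IsProjFun k ι e).ι.mapIso i.symm).app V) h1)
  · intro X Y f hf
    obtain ⟨a, b, hab⟩ := exists_id_of_stableEvalHom_map_ne_zero he hV hconn φ f hf
    exact ⟨oneMor k (IsProjFun k ι e), oneMor k (IsProjFun k ι e), leftLE_oneMor _,
      isIndec_oneMor hconn, leftLE_oneMor _, a, b, hab⟩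

end StableQuot

/-! ### Extensions of the cell `2`-representation of the identity -/

section Represents

variable {k : Type u} [Field k] {C : Type u} [SmallCategory C] [Preadditive C] [Linear k C]
  {P : ObjectProperty (C ⥤ C)} [IsTwoCat k P] {M : TwoRep k P}

namespace TwoRep

lemma reaches_refl [HasZeroObject M.carrier] (x : Ind M.carrier) : M.Reaches x x := by
  obtain ⟨X, hX⟩ := x
  exact ⟨X, hX, X, hX, rfl, rfl, oneMor k P, isSummand_of_iso (eqToIso (M.act_one_obj X).symm)⟩

lemma IsSubrep.mem_of_reaches [HasZeroObject M.carrier] {Q : ObjectProperty M.carrier}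
    (hQ : M.IsSubrep Q) {x y : Ind M.carrier} (h : M.Reaches x y) (hx : x ∈ M.indIn Q) :
    y ∈ M.indIn Q := by
  obtain ⟨X, hX, Y, hY, rfl, rfl, F, hF⟩ := h
  exact ⟨Y, hY, rfl, hQ.summand _ _ hF (hQ.invariant F X (hQ.mem_of_isIndec_mk hx))⟩

/-- The diagram has exactly two vertices if any two indecomposable objects in `Q`, and any two
outside of `Q`, reach each other. -/
lemma IsSubrep.represents_decoration [HasZeroObject M.carrier] {Q : ObjectProperty M.carrier}
    (hQ : M.IsSubrep Q) (hτ : ∀ x ∈ M.indIn Q, ∀ y ∈ M.indIn Q, M.Reaches x y)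
    (hρ : ∀ x ∉ M.indIn Q, ∀ y ∉ M.indIn Q, M.Reaches x y)
    (h : ∃ x ∉ M.indIn Q, ∃ y ∈ M.indIn Q, M.Reaches x y) :
    M.Represents Q (M.decoration (M.indIn Q) (M.indIn Q)ᶜ) := by
  obtain ⟨x₀, hx₀, y₀, hy₀, hxy⟩ := h
  have h1 : ∀ x ∈ M.indIn Q, M.indIn Q = {y | M.Reaches x y ∧ M.Reaches y x} := fun x hx =>
    Set.ext fun y => ⟨fun hy => ⟨hτ x hx y hy, hτ y hy x hx⟩, fun hy => hQ.mem_of_reaches hy.1 hx⟩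
  have h2 : ∀ x ∉ M.indIn Q, (M.indIn Q)ᶜ = {y | M.Reaches x y ∧ M.Reaches y x} := fun x hx =>
    Set.ext fun y => ⟨fun hy => ⟨hρ x hx y hy, hρ y hy x hx⟩,
      fun hy hy' => hx (hQ.mem_of_reaches hy.2 hy')⟩
  have hne : (M.indIn Q)ᶜ ≠ M.indIn Q := fun h => by
    rw [← h] at hy₀
    exact hy₀ (h ▸ hy₀)
  have hv : M.vertices = {(M.indIn Q)ᶜ, M.indIn Q} := by
    ext σ
    constructor
    · rintro ⟨x, rfl⟩
      by_cases hx : x ∈ M.indIn Q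
      · exact Or.inr (h1 x hx).symm
      · exact Or.inl (h2 x hx).symm
    · rintro (rfl | rfl)
      · exact ⟨x₀, h2 x₀ hx₀⟩
      · exact ⟨y₀, h1 y₀ hy₀⟩
  refine ⟨_, _, rfl, rfl, hne, hv, Set.ext fun c => ⟨fun hc => ⟨?_, hc⟩, fun hc => hc.2⟩⟩
  rw [IsEdge, hv]
  exact ⟨Or.inl rfl, Or.inr rfl, hne, ⟨x₀, hx₀, y₀, hy₀, hxy⟩, fun σ hσ _ _ => hσ⟩

end TwoRep

end Represents

section Realization

variable {k : Type u} [Field k] [IsAlgClosed k] {A : Type u} [Ring A] [Algebra k A]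
  [Module.Finite k A] {C : Type u} [SmallCategory C] [Preadditive C] [Linear k C]
  {ι : C ⥤ FGModuleCat.{u} A} [ι.IsEquivalence] [ι.Additive] [ι.Linear k]
  {n : ℕ} {e : Fin n → A} (he : IsPrimitiveDecomposition e) {V : C}

include he in
/-- A nonzero morphism `Ae_t → X` exhibits `Ae_s` as a summand of `F_st X`. -/
lemma isSummand_addProj (hV : IsLocalRing (End V)) (s : Fin n) {t : Fin n}
    (X : (addProp ι e V).FullSubcategory) (v : projObj ι (e t) ⟶ X.obj) (hv : v ≠ 0) :
    IsSummand (𝒳 := (addRep (k := k) he V).carrier) (addProj ι e V s)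
      (((addRep (k := k) he V).act.obj (projMor k ι e s t)).obj X) := by
  have := (isFinitary_addProp k (ι := ι) he hV).idempotent_split
  obtain ⟨r⟩ := nonempty_retract_projMor (k := k) he s v hv
  let Y : (addProp ι e V).FullSubcategory :=
    ((addRep (k := k) he V).act.obj (projMor k ι e s t)).obj X
  exact isSummand_of_retract (𝒳 := (addProp ι e V).FullSubcategory)
    (liftRetract (X := addProj ι e V s) (Y := Y) r)

include he in
lemma projProp_addProj (t : Fin n) :
    projProp (isInvariant_addProp (k := k) he V) (addProj ι e V t) :=
  projective_projObj k (ι := ι) (he.2 t).1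

include he in
lemma nonempty_iso_of_not_projProp (k : Type u) [Field k] [Algebra k A] [Module.Finite k A]
    [Linear k C] [ι.Linear k] {X : (addProp ι e V).FullSubcategory} (hX : IsIndec X)
    (hXQ : ¬ Projective X.obj) : Nonempty (addSelf ι e V ≅ X) := by
  obtain h | ⟨t, ⟨i⟩⟩ := exists_iso_of_isIndec_addProp k hX
  · exact h
  · exact (hXQ (Projective.of_iso ((addProp ι e V).ι.mapIso i)
      (projective_projObj k (ι := ι) (he.2 t).1))).elim

lemma exists_iso_addProj_of_projProp (k : Type u) [Field k] [Algebra k A] [Module.Finite k A]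
    [Linear k C] [ι.Linear k] (hV : ¬ Projective V)
    {X : (addProp ι e V).FullSubcategory} (hX : IsIndec X) (hXQ : Projective X.obj) :
    ∃ t, Nonempty (addProj ι e V t ≅ X) := by
  obtain ⟨⟨i⟩⟩ | h := exists_iso_of_isIndec_addProp k hX
  · exact (hV (Projective.of_iso ((addProp ι e V).ι.mapIso i.symm) hXQ)).elim
  · exact h

include he in
lemma exists_ne_zero_of_isLocalRing (hV : IsLocalRing (End V)) :
    ∃ t, ∃ v : projObj ι (e t) ⟶ V, v ≠ 0 := by
  by_contra! h
  refine not_isZero_of_isLocalRing hV ((IsZero.iff_id_eq_zero _).2 ?_)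
  exact hom_ext_projObj (ι := ι) he fun t v => by rw [h t v, zero_comp, zero_comp]

/-- The diagram of the action on sums of copies of `V` and of projective objects has two vertices:
the class of `V`, and the classes of the indecomposable projective objects. -/
lemma represents_addRep (hV : IsLocalRing (End V)) (hnp : ¬ Projective V) :
    (addRep (k := k) (ι := ι) he V).Represents (projProp (isInvariant_addProp he V))
      ((addRep (k := k) (ι := ι) he V).decoration
        ((addRep (k := k) (ι := ι) he V).indIn (projProp (isInvariant_addProp he V)))
        ((addRep (k := k) (ι := ι) he V).indIn (projProp (isInvariant_addProp he V)))ᶜ) := by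
  have := (isFinitary_addRep (k := k) (ι := ι) he hV).additive
  have := hasZeroObject_of_hasFiniteBiproducts (addRep (k := k) (ι := ι) he V).carrier
  have hQ := isSubrep_projProp (k := k) (ι := ι) he (isInvariant_addProp he V)
  refine hQ.represents_decoration ?_ ?_ ?_
  · rintro _ ⟨X, hX, rfl, hXQ⟩ _ ⟨Y, hY, rfl, hYQ⟩
    obtain ⟨t, ⟨i⟩⟩ := exists_iso_addProj_of_projProp k hnp hX hXQ
    obtain ⟨s, ⟨j⟩⟩ := exists_iso_addProj_of_projProp k hnp hY hYQ
    refine ⟨addProj ι e V t, isIndec_addProj k he V t, addProj ι e V s, isIndec_addProj k he V s,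
      Ind.mk_eq_mk.2 ⟨i.symm⟩, Ind.mk_eq_mk.2 ⟨j.symm⟩, projMor k ι e s t,
      isSummand_addProj he hV s (addProj ι e V t) (𝟙 _) fun h0 => ?_⟩
    exact not_isZero_of_isLocalRing (isLocalRing_end_projObj k ι (he.2 t))
      ((IsZero.iff_id_eq_zero _).2 h0)
  · rintro ⟨X, hX⟩ hx ⟨Y, hY⟩ hy
    obtain ⟨i⟩ := nonempty_iso_of_not_projProp (C := C) (ι := ι) he k hX fun h => hx ⟨X, hX, rfl, h⟩
    obtain ⟨j⟩ := nonempty_iso_of_not_projProp (C := C) (ι := ι) he k hY fun h => hy ⟨Y, hY, rfl, h⟩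
    have : Ind.mk X hX = Ind.mk Y hY := Ind.mk_eq_mk.2 ⟨i.symm ≪≫ j⟩
    change (addRep (k := k) (ι := ι) he V).Reaches (Ind.mk X hX) (Ind.mk Y hY)
    rw [this]
    exact TwoRep.reaches_refl _
  · obtain ⟨t, v, hv⟩ := exists_ne_zero_of_isLocalRing (ι := ι) he hV
    exact ⟨Ind.mk _ (isIndec_addSelf (C := C) (ι := ι) (e := e) hV),
      fun h => hnp (hQ.mem_of_isIndec_mk h),
      Ind.mk _ (isIndec_addProj (C := C) (ι := ι) k he V t),
      ⟨_, _, rfl, projProp_addProj (k := k) (ι := ι) he t⟩,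
      _, _, _, _, rfl, rfl, projMor k ι e t t, isSummand_addProj he hV t (addSelf ι e V) v hv⟩

/-- The functor `F_tt` does not kill `V` if and only if `e_t V` is nonzero. -/
lemma decoration_addRep (hconn : IsConnectedAlg A) (hV : IsLocalRing (End V))
    (hnp : ¬ Projective V) : (addRep (k := k) (ι := ι) he V).decoration
        ((addRep (k := k) (ι := ι) he V).indIn (projProp (isInvariant_addProp he V)))
        ((addRep (k := k) (ι := ι) he V).indIn (projProp (isInvariant_addProp he V)))ᶜ =
      cellUnion k ι e (signature ι e V) := by
  have := finiteDimensional_hom_of_mod k ι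
  have h1 : ∀ t, IsZero ((projMor k ι e t t).obj.obj V) ↔ ∀ v : projObj ι (e t) ⟶ V, v = 0 :=
    fun t => (projMorCopower k ι he t t).isZero_iff
      (not_isZero_of_isLocalRing (isLocalRing_end_projObj k ι (he.2 t)))
  rw [decoration_eq_cellUnion he hconn (isSubrep_projProp he (isInvariant_addProp he V))
    (isFinitary_addRep he hV) fun s t X => by
      have := projective_projObj k (ι := ι) (he.2 s).1
      exact (projMorCopower k ι he s t).projective X.obj]
  congr 1
  ext t
  rw [mem_signature_iff k ι he]
  constructor
  · rintro ⟨X, hX, hXQ, h0⟩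
    obtain ⟨i⟩ := nonempty_iso_of_not_projProp (C := C) (ι := ι) he k hX hXQ
    by_contra! h2
    exact h0 ((TwoRep.isZero_sub_iff _).2 (((h1 t).2 h2).of_iso
      ((projMor k ι e t t).obj.mapIso ((addProp ι e V).ι.mapIso i.symm))))
  · rintro ⟨v, hv⟩
    exact ⟨addSelf ι e V, isIndec_addSelf hV, hnp, fun h0 =>
      hv ((h1 t).1 ((TwoRep.isZero_sub_iff _).1 h0) v)⟩

include he in
/-- The signature of an indecomposable object with stable endomorphism algebra `k` gives a discrete
extension. -/
theorem cellUnion_signature_mem_dext (hconn : IsConnectedAlg A) (hns : ¬ IsSimpleRing A)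
    (i : Fin n) (hV : IsIndec V) (φ : End ((projIdeal k C).proj.obj V) ≃ₐ[k] k) :
    cellUnion k ι e (signature ι e V) ∈ Dext (cellRep0 k ι e) (cellRepAt k ι e i) := by
  have := isIdempotentComplete_of_mod k ι
  have hloc := hV.isLocalRing k (finiteDimensional_hom_of_mod k ι)
  have hnp := not_projective_of_stable_end φ
  obtain ⟨E⟩ := nonempty_cellRepAt_equiv (k := k) (ι := ι) he hconn (isInvariant_addProp he V)
    (addProp_of_projective k he V) i
  obtain ⟨E'⟩ := nonempty_cellRep0_equiv (k := k) (ι := ι) he hconn hns hloc φ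
  refine ⟨?_, addRep he V, projProp (isInvariant_addProp he V), isSubrep_projProp he _,
    isFinitary_addRep he hloc, isTransitive_projProp he _ (addProp_of_projective k he V), ?_,
    ⟨E.symm⟩, ⟨E'.symm⟩⟩
  · obtain ⟨t, ht⟩ := exists_ne_zero_of_isLocalRing (ι := ι) he hloc
    exact ⟨_, Set.mem_biUnion ((mem_signature_iff k ι he V t).2 ht) (mk_projMor_mem_cellL he t t)⟩
  · rw [← decoration_addRep he hconn hloc hnp]
    exact represents_addRep he hloc hnp

end Realization

end DiscExt

theorem theorem32 {k : Type u} [Field k] [IsAlgClosed k]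
    {A : Type u} [Ring A] [Algebra k A] [Module.Finite k A]
    {n : ℕ} (e : Fin n → A) (he : DiscExt.IsPrimitiveDecomposition e)
    (hbasic : DiscExt.IsBasicWrt e) (hconn : DiscExt.IsConnectedAlg A)
    (hnonsimple : ¬ IsSimpleRing A)
    {C : Type u} [SmallCategory C] [Preadditive C] [Linear k C]
    (ι : C ⥤ FGModuleCat.{u} A) [ι.IsEquivalence] [ι.Additive] [ι.Linear k] :
    DiscExt.Dext (DiscExt.cellRep0 k ι e) (DiscExt.cellRep0 k ι e) = ∅ ∧
    (∀ i : Fin n, DiscExt.Dext (DiscExt.cellRepAt k ι e i) (DiscExt.cellRepAt k ι e i) = ∅) ∧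
    (Module.Injective A A →
      ∀ i : Fin n, DiscExt.Dext (DiscExt.cellRepAt k ι e i) (DiscExt.cellRep0 k ι e) = ∅) ∧
    (∀ i : Fin n,
      DiscExt.Dext (DiscExt.cellRep0 k ι e) (DiscExt.cellRepAt k ι e i) ⊆
          {E | ∃ S : Set (Fin n), S.Nonempty ∧ E = DiscExt.cellUnion k ι e S} ∧
      ∀ M : C, DiscExt.IsIndec M →
        Nonempty (End ((DiscExt.projIdeal k C).proj.obj M) ≃ₐ[k] k) →
        DiscExt.cellUnion k ι e (DiscExt.signature ι e M) ∈
          DiscExt.Dext (DiscExt.cellRep0 k ι e) (DiscExt.cellRepAt k ι e i)) := by 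
  refine ⟨DiscExt.dext_cellRep0_eq_empty he hconn hnonsimple _, ?_,
    fun _ i => DiscExt.dext_cellRep0_eq_empty he hconn hnonsimple _, fun i =>
    ⟨DiscExt.dext_cellRep0_subset he hconn hnonsimple _, ?_⟩⟩
  · exact fun i => DiscExt.dext_cellRepAt_eq_empty he hconn i
  · exact fun M hM ⟨φ⟩ => DiscExt.cellUnion_signature_mem_dext he hconn hnonsimple i hM φ
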